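/- Fix a dimension $d\ge 1$ and a Littlewood–Paley cutoff, that is, an even function $\chi\in C_c^\infty(\mathbb{R}^d;\mathbb{R})$ with $\mathrm{supp}\,\chi=\{\frac12\le|\xi|\le2\}$, $\chi(\xi)>0$ for $\frac12<|\xi|<2$, and $\sum_{n\in\mathbb{Z}}\chi(2^{-n}\xi)=1$ for all $\xi\neq0$. Let $\psi_n$ be the real Schwartz function with Fourier transform $\hat\psi_n(\xi)=\chi(2^{-n}\xi)$ and write $$\|f\|_{\dot B^0_{p,q}}=\Big(\sum_{n\in\mathbb{Z}}\|\psi_n*f\|_{L^p(\mathbb{R}^d)}^q\Big)^{1/q}$$ (a supremum over $n$ if $q=\infty$). Let $\varphi\in\mathcal{S}(\mathbb{R}^d;\mathbb{R})$ be a Schwartz function with $\int_{\mathbb{R}^d}\varphi\,dx=1$, and let $\varphi_\delta(x)=\delta^{-d}\varphi(x/\delta)$ for $\delta>0$. Let $p,p',q,r\in[1,\infty]$ with $\frac1p+\frac1{p'}=\frac1r$ (where $\frac1\infty=0$; $p'$ need not be the conjugate exponent of $p$). Let $\rho:\mathbb{R}^d\to\mathbb{R}$ satisfy $\rho\in L^{p'}$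 and $\|\rho\|_{\dot B^0_{p',q}}<\infty$. Let $u:\mathbb{R}^d\to\mathbb{R}^d$ be a locally integrable vector field that is divergence-free in the sense of distributions and whose weak gradient $\nabla u=(\partial_j u_i)_{i,j}$ satisfies $\nabla u\in L^p$ and $\|\nabla u\|_{\dot B^0_{p,q}}<\infty$. Define the commutator $$R_\delta(u,\rho)(x)=u(x)\cdot\nabla(\rho*\varphi_\delta)(x)-\nabla\cdot\big((u\rho)*\varphi_\delta\big)(x).$$ Then $$\Big(\int_0^\infty\|R_\delta(u,\rho)\|_{L^r}^q\,\frac{d\delta}{\delta}\Big)^{1/q}\le C\Big(\|\nabla u\|_{\dot B^0_{p,q}}\|\rho\|_{L^{p'}}+\|\nabla u\|_{L^p}\|\rho\|_{\dot B^0_{p',q}}\Big)$$ (for $q=\infty$ the left-hand side is the essential supremum of $\|R_\delta(u,\rho)\|_{L^r}$ over $\delta\in(0,\infty)$). The constant $C>0$ depends only on $d$, the fixed choice of $\chi$, and an upper bound $M$ for the quantity $\|(1+|x|^2)\nabla\varphi\|_{L^1}+\||x|\nabla^2\varphi\|_{L^1}$. In particular it does not depend on $p,p',q,r$. -/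

import Mathlib

open MeasureTheory Set
open scoped ENNReal NNReal ContDiff FourierTransform Convolution

noncomputable section

/-- The cutoff `χ` generating a Littlewood-Paley decomposition of `ℝᵈ`. -/
structure IsLittlewoodPaleyCutoff {d : ℕ} (χ : EuclideanSpace ℝ (Fin d) → ℝ) : Prop where
  smooth : ContDiff ℝ ∞ χ
  tsupport_eq : tsupport χ = {ξ | 1 / 2 ≤ ‖ξ‖ ∧ ‖ξ‖ ≤ 2}
  pos : ∀ ξ, 1 / 2 < ‖ξ‖ → ‖ξ‖ < 2 → 0 < χ ξ
  hasSum_one : ∀ ξ, ξ ≠ 0 → HasSum (fun n : ℤ => χ ((2 : ℝ) ^ (-n) • ξ)) 1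
  /-- Evenness of `χ` says that the kernels `ψₙ` are real-valued. -/
  even : ∀ ξ, χ (-ξ) = χ ξ

/-- The kernel `ψₙ`, whose Fourier transform is `ξ ↦ χ (2⁻ⁿ ξ)`. For even `χ` the inverse Fourier
transform is real-valued, see `im_fourierInv_eq_zero`. -/
def lpKernel {d : ℕ} (χ : EuclideanSpace ℝ (Fin d) → ℝ) (n : ℤ) (x : EuclideanSpace ℝ (Fin d)) :
    ℝ :=
  (𝓕⁻ (fun ξ : EuclideanSpace ℝ (Fin d) => ((χ ((2 : ℝ) ^ (-n) • ξ) : ℝ) : ℂ)) x).re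

theorem im_fourierInv_eq_zero {d : ℕ} {χ : EuclideanSpace ℝ (Fin d) → ℝ}
    (hχ : IsLittlewoodPaleyCutoff χ) (n : ℤ) (x : EuclideanSpace ℝ (Fin d)) :
    (𝓕⁻ (fun ξ : EuclideanSpace ℝ (Fin d) => ((χ ((2 : ℝ) ^ (-n) • ξ) : ℝ) : ℂ)) x).im = 0 := by
  rw [← Complex.conj_eq_iff_im, Real.fourierInv_eq', ← integral_conj, ← integral_neg_eq_self]
  refine integral_congr_ae (Filter.Eventually.of_forall fun ξ => ?_)
  simp [hχ.even, ← Complex.exp_conj, Complex.conj_ofNat]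

/-- The norm of the homogeneous Besov space `Ḃ⁰_{p,q}`, that is the `ℓ^q(ℤ)` norm of the sequence
`n ↦ ‖ψₙ * f‖_{L^p}` (a supremum over `n` when `q = ∞`). -/
def besovZeroNorm {d : ℕ} {V : Type*} [NormedAddCommGroup V] [NormedSpace ℝ V]
    (χ : EuclideanSpace ℝ (Fin d) → ℝ) (p q : ℝ≥0∞) (f : EuclideanSpace ℝ (Fin d) → V) : ℝ≥0∞ :=
  eLpNorm (fun n : ℤ =>
    eLpNorm (lpKernel χ n ⋆[ContinuousLinearMap.lsmul ℝ ℝ, volume] f) p volume) q Measure.count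

/-- `G` is the weak gradient of the locally integrable vector field `u`: the entry `G x (i, j)` is
the weak partial derivative `∂uᵢ/∂xⱼ`. The values of `G` carry the Euclidean norm. -/
def IsWeakGradient {d : ℕ} (u : EuclideanSpace ℝ (Fin d) → EuclideanSpace ℝ (Fin d))
    (G : EuclideanSpace ℝ (Fin d) → EuclideanSpace ℝ (Fin d × Fin d)) : Prop :=
  LocallyIntegrable u ∧ LocallyIntegrable G ∧
    ∀ (i j : Fin d) (η : EuclideanSpace ℝ (Fin d) → ℝ), ContDiff ℝ ∞ η → HasCompactSupport η →
      ∫ x, u x i * fderiv ℝ η x (EuclideanSpace.single j 1) = -∫ x, G x (i, j) * η x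

/-- `∇ · u = 0` in the sense of distributions. -/
def IsWeaklyDivergenceFree {d : ℕ} (u : EuclideanSpace ℝ (Fin d) → EuclideanSpace ℝ (Fin d)) :
    Prop :=
  ∀ η : EuclideanSpace ℝ (Fin d) → ℝ, ContDiff ℝ ∞ η → HasCompactSupport η →
    ∫ x, fderiv ℝ η x (u x) = 0

/-- The rescaled mollifier `φ_δ(x) = δ⁻ᵈ φ(x / δ)`. -/
def rescale {d : ℕ} (φ : EuclideanSpace ℝ (Fin d) → ℝ) (δ : ℝ) (x : EuclideanSpace ℝ (Fin d)) : ℝ :=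
  (δ ^ d)⁻¹ * φ (δ⁻¹ • x)

/-- The classical divergence `∑ᵢ ∂Fᵢ/∂xᵢ`. -/
def divergence {d : ℕ} (F : EuclideanSpace ℝ (Fin d) → EuclideanSpace ℝ (Fin d))
    (x : EuclideanSpace ℝ (Fin d)) : ℝ :=
  ∑ i, fderiv ℝ F x (EuclideanSpace.single i 1) i

/-- The commutator `R_δ(u, ρ) = u · ∇(ρ * φ_δ) - ∇ · ((u ρ) * φ_δ)`. -/
def diPernaLionsCommutator {d : ℕ} (φ : EuclideanSpace ℝ (Fin d) → ℝ)
    (u : EuclideanSpace ℝ (Fin d) → EuclideanSpace ℝ (Fin d)) (ρ : EuclideanSpace ℝ (Fin d) → ℝ)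
    (δ : ℝ) (x : EuclideanSpace ℝ (Fin d)) : ℝ :=
  fderiv ℝ (rescale φ δ ⋆[ContinuousLinearMap.lsmul ℝ ℝ, volume] ρ) x (u x) -
    divergence
      (rescale φ δ ⋆[ContinuousLinearMap.lsmul ℝ ℝ, volume] (fun y => ρ y • u y)) x

/-- The quantity `‖(1 + |x|²) ∇φ‖_{L¹} + ‖|x| ∇²φ‖_{L¹}`. -/
def mollifierNorm {d : ℕ} (φ : EuclideanSpace ℝ (Fin d) → ℝ) : ℝ≥0∞ :=
  eLpNorm (fun x => (1 + ‖x‖ ^ 2) • fderiv ℝ φ x) 1 volume +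
    eLpNorm (fun x => ‖x‖ • iteratedFDeriv ℝ 2 φ x) 1 volume

/-- The measure `dδ / δ` on `(0, ∞)`. -/
def scaleMeasure : Measure ℝ :=
  (volume.restrict (Ioi 0)).withDensity (fun δ => ENNReal.ofReal δ⁻¹)

end

/-!
Write `S` for the low-pass kernel with symbol `∑_{n ≤ 0} χ (2⁻ⁿ ξ)`, `S_n` for its dilate to
frequencies `|ξ| ≲ 2ⁿ` (`lowPass`), so that `ψ_n = S_n - S_{n-1}` (`bandPass`), and `G` for the
gradient `∇u`. Moving all derivatives to the mollifier `k = φ_δ` turns the commutator into the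
bilinear expression
`commForm k u ρ x = ∫ ρ(x - y) ∇k(y) · (u(x) - u(x - y)) dy` (`diPernaLionsCommutator_eq`).
Instead of a paraproduct decomposition, fix a scale `δ ∼ 2^{-N}`, put `v = S_N * u`, `σ = S_N * ρ`,
and split
`commForm k u ρ = commForm k (u - v) ρ + commForm k v (ρ - σ) + commForm k v σ`.

* In the first term `k` costs a factor `δ⁻¹ ∼ 2^N` (`eLpNorm_commForm_le_of_memLp`), and
  `‖u - v‖_p ≲ ∑_{n > N} 2⁻ⁿ ‖ψ_n * G‖_p`.
* In the second term write `ρ - σ` as a sum of `f_n - S_{n-3} * f_n` with `f_n = ψ_n * ρ`, `n > N`;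
  the subtracted term vanishes. The resulting differences of translates of `f_n` can be moved to the
  kernel `∇k(y) · (v(x) - v(x - y))`, whose `y`-derivative is controlled by `δ⁻¹` and `∇v`
  (`eLpNorm_commForm_sub_conv_le`). The first moment of `S_{n-3}` contributes `2⁻ⁿ`.
* In the third term subtract `σ(x) ∇k(y) · A y` with `A = (S_N * G)(x)` from the integrand. Its
  integral is a multiple of `∫ ∇k(y) · A y dy = - tr A ∫ k`, which is zero as `div u = 0`. What is
  left has a factor `|y|²` and differences of `S_N * G` and `S_N * ρ`, which are bounded by
  `∑_{n ≤ N} 2ⁿ ‖ψ_n * G‖_p` and its analogue for `ρ` (`eLpNorm_commForm_le_of_trace`).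

Hence `‖R_δ‖_r ≲ ∑_n 2^{-|n - N|} a_n` with `a_n = ‖ψ_n * G‖_p ‖ρ‖_{p'} + ‖G‖_p ‖ψ_n * ρ‖_{p'}`
(`eLpNorm_commForm_dilate_le`). Minkowski's inequality bounds the `ℓ^q` norm in `N` of the
right-hand side by that of `a`, and a dyadic interval of scales has mass at most one for `dδ / δ`
(`map_dyadicIndex_scaleMeasure_le`).

All convolutions make sense for functions that are integrable against a negative power of
`1 + |x|` (`IsTempered`). The weak gradient enters only through the identity
`u(x) - u(x - z) = ∫₀¹ G(x - t z) z dt` for almost every `x` (`HasSegmentGradient`), which implies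
that `u` is tempered and is preserved by convolutions.
-/

/-! ### Minkowski's integral inequality -/

section Minkowski

variable {α β : Type*} [MeasurableSpace α] [MeasurableSpace β]

/-- Jensen's inequality for the measure `c dν`. -/
theorem lintegral_mul_rpow_le {ν : Measure β} {c h : β → ℝ≥0∞} (hc : Measurable c)
    (hh : Measurable h) {s : ℝ} (hs : 1 < s) :
    (∫⁻ y, c y * h y ∂ν) ^ s ≤ (∫⁻ y, c y ∂ν) ^ (s - 1) * ∫⁻ y, c y * h y ^ s ∂ν := by
  have hconj := (Real.HolderConjugate.conjExponent hs).symm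
  have key := ENNReal.lintegral_mul_le_Lp_mul_Lq (ν.withDensity c) hconj
    (f := fun _ => 1) (g := h) aemeasurable_const hh.aemeasurable
  simp only [Pi.mul_apply, one_mul, ENNReal.one_rpow, lintegral_const,
    withDensity_apply _ MeasurableSet.univ, Measure.restrict_univ] at key
  rw [lintegral_withDensity_eq_lintegral_mul _ hc hh,
    lintegral_withDensity_eq_lintegral_mul _ hc (hh.pow_const s)] at key
  have hs0 : 0 < s := by linarith
  have := ENNReal.rpow_le_rpow key hs0.le
  rw [ENNReal.mul_rpow_of_nonneg _ _ hs0.le, ← ENNReal.rpow_mul, ← ENNReal.rpow_mul,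
    one_div_mul_cancel hs0.ne', ENNReal.rpow_one] at this
  convert! this using 3
  rw [Real.conjExponent]
  field_simp

theorem eLpNorm_lintegral_le_of_measurable {μ : Measure α} {ν : Measure β} [SFinite μ] [SFinite ν]
    {f : α → β → ℝ≥0∞} (hf : Measurable (Function.uncurry f)) {c : β → ℝ≥0∞} (hc : Measurable c)
    {r : ℝ≥0∞} (hr : 1 ≤ r) (hfc : ∀ᵐ y ∂ν, eLpNorm (fun x => f x y) r μ ≤ c y) :
    eLpNorm (fun x => ∫⁻ y, f x y ∂ν) r μ ≤ ∫⁻ y, c y ∂ν := by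
  rcases eq_or_ne (∫⁻ y, c y ∂ν) ⊤ with hI | hI
  · simp [hI]
  have hr0 : r ≠ 0 := (zero_lt_one.trans_le hr).ne'
  rcases eq_or_ne r ⊤ with rfl | hrt
  · have h1 : ∀ᵐ y ∂ν, ∀ᵐ x ∂μ, f x y ≤ c y := by
      filter_upwards [hfc] with y hy
      rw [eLpNorm_exponent_top] at hy
      filter_upwards [enorm_ae_le_eLpNormEssSup (fun x => f x y) μ] with x hx using hx.trans hy
    have h2 : ∀ᵐ x ∂μ, ∀ᵐ y ∂ν, f x y ≤ c y :=
      (Measure.ae_ae_comm (p := fun x y => f x y ≤ c y)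
        (measurableSet_le hf (hc.comp measurable_snd))).2 h1
    rw [eLpNorm_exponent_top]
    refine essSup_le_of_ae_le _ ?_
    filter_upwards [h2] with x hx
    exact lintegral_mono_ae hx
  have hfx : ∀ x, Measurable (f x) := fun x => hf.comp measurable_prodMk_left
  have hfy : ∀ y, Measurable (fun x => f x y) := fun y => hf.comp measurable_prodMk_right
  have hinner : Measurable fun x => ∫⁻ y, f x y ∂ν := hf.lintegral_prod_right
  rcases hr.eq_or_lt with rfl | hr1
  · rw [eLpNorm_one_eq_lintegral_enorm]
    simp only [enorm_eq_self]
    rw [lintegral_lintegral_swap hf.aemeasurable]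
    refine lintegral_mono_ae ?_
    filter_upwards [hfc] with y hy
    simpa [eLpNorm_one_eq_lintegral_enorm] using hy
  set s := r.toReal with hs
  have hs1 : 1 < s := by
    rw [hs, ← ENNReal.toReal_one]
    exact (ENNReal.toReal_lt_toReal ENNReal.one_ne_top hrt).2 hr1
  have hs0 : 0 < s := by linarith
  -- Jensen's inequality applies to `f = c * h`, as `‖h(·, y)‖_r ≤ 1` on the fibres with `c y ≠ 0`;
  -- on the other fibres both `f` and `c * h` vanish.
  set h : α → β → ℝ≥0∞ := fun x y => f x y / c y with hh
  have hhm : Measurable (Function.uncurry h) := hf.div (hc.comp measurable_snd)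
  have hpow : ∀ᵐ y ∂ν, ∫⁻ x, f x y ^ s ∂μ ≤ c y ^ s := by
    filter_upwards [hfc] with y hy
    rw [eLpNorm_eq_lintegral_rpow_enorm_toReal hr0 hrt] at hy
    simp only [enorm_eq_self] at hy
    rwa [← hs, one_div, ENNReal.rpow_inv_le_iff hs0] at hy
  have hct : ∀ᵐ y ∂ν, c y < ⊤ := ae_lt_top hc hI
  have hfh : ∀ᵐ x ∂μ, ∀ᵐ y ∂ν, f x y = c y * h x y := by
    refine (Measure.ae_ae_comm (p := fun x y => f x y = c y * h x y)
      (measurableSet_eq_fun hf ((hc.comp measurable_snd).mul hhm))).2 ?_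
    filter_upwards [hpow, hct] with y hy hcy
    rcases eq_or_ne (c y) 0 with h0 | h0
    · rw [h0, ENNReal.zero_rpow_of_pos hs0, nonpos_iff_eq_zero,
        lintegral_eq_zero_iff ((hfy y).pow_const s)] at hy
      filter_upwards [hy] with x hx
      simpa [h0, hs0, hs0.le, hs0.not_gt] using hx
    · exact Filter.Eventually.of_forall fun x => (ENNReal.mul_div_cancel h0 hcy.ne).symm
  have hh1 : ∀ᵐ y ∂ν, c y * ∫⁻ x, h x y ^ s ∂μ ≤ c y := by
    filter_upwards [hpow, hct] with y hy hcy
    rcases eq_or_ne (c y) 0 with h0 | h0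
    · simp [h0]
    · have : ∫⁻ x, h x y ^ s ∂μ ≤ 1 := by
        simp only [hh, ENNReal.div_rpow_of_nonneg _ _ hs0.le]
        simp only [div_eq_mul_inv]
        rw [lintegral_mul_const _ ((hfy y).pow_const s), ← div_eq_mul_inv]
        exact ENNReal.div_le_of_le_mul (by simpa using hy)
      exact mul_le_of_le_one_right' this
  rw [eLpNorm_eq_lintegral_rpow_enorm_toReal hr0 hrt]
  simp only [enorm_eq_self]
  rw [← hs, one_div, ENNReal.rpow_inv_le_iff hs0]
  calc ∫⁻ x, (∫⁻ y, f x y ∂ν) ^ s ∂μ = ∫⁻ x, (∫⁻ y, c y * h x y ∂ν) ^ s ∂μ := by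
        refine lintegral_congr_ae ?_
        filter_upwards [hfh] with x hx
        rw [lintegral_congr_ae hx]
    _ ≤ ∫⁻ x, (∫⁻ y, c y ∂ν) ^ (s - 1) * ∫⁻ y, c y * h x y ^ s ∂ν ∂μ :=
        lintegral_mono fun x => lintegral_mul_rpow_le hc (hhm.comp measurable_prodMk_left) hs1
    _ = (∫⁻ y, c y ∂ν) ^ (s - 1) * ∫⁻ y, c y * ∫⁻ x, h x y ^ s ∂μ ∂ν := by
        have hm : Measurable (Function.uncurry fun x y => c y * h x y ^ s) :=
          (hc.comp measurable_snd).mul (hhm.pow_const s)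
        rw [lintegral_const_mul _ hm.lintegral_prod_right,
          lintegral_lintegral_swap hm.aemeasurable]
        congr 1
        refine lintegral_congr fun y => ?_
        exact lintegral_const_mul _ ((hhm.comp measurable_prodMk_right).pow_const s)
    _ ≤ (∫⁻ y, c y ∂ν) ^ (s - 1) * ∫⁻ y, c y ∂ν := by
        gcongr 1
        exact lintegral_mono_ae hh1
    _ = (∫⁻ y, c y ∂ν) ^ s := by
        conv_rhs => rw [← sub_add_cancel s 1]
        rw [ENNReal.rpow_add_of_nonneg _ _ (by linarith) zero_le_one, ENNReal.rpow_one]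

/-- Minkowski's integral inequality, in terms of a bound `c y` for the norms of the fibres. -/
theorem eLpNorm_lintegral_le {μ : Measure α} {ν : Measure β} [SFinite μ] [SFinite ν]
    {f : α → β → ℝ≥0∞} (hf : AEMeasurable (Function.uncurry f) (μ.prod ν)) {c : β → ℝ≥0∞}
    (hc : AEMeasurable c ν) {r : ℝ≥0∞} (hr : 1 ≤ r)
    (hfc : ∀ᵐ y ∂ν, eLpNorm (fun x => f x y) r μ ≤ c y) :
    eLpNorm (fun x => ∫⁻ y, f x y ∂ν) r μ ≤ ∫⁻ y, c y ∂ν := by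
  have h1 : ∀ᵐ x ∂μ, ∀ᵐ y ∂ν, f x y = hf.mk _ (x, y) := Measure.ae_ae_of_ae_prod hf.ae_eq_mk
  have h2 : ∀ᵐ y ∂ν, ∀ᵐ x ∂μ, f x y = hf.mk _ (x, y) :=
    Measure.ae_ae_of_ae_prod (Measure.measurePreserving_swap.quasiMeasurePreserving.ae hf.ae_eq_mk)
  have e1 : (fun x => ∫⁻ y, f x y ∂ν) =ᵐ[μ] fun x => ∫⁻ y, hf.mk _ (x, y) ∂ν := by
    filter_upwards [h1] with x hx using lintegral_congr_ae hx
  rw [eLpNorm_congr_ae e1, lintegral_congr_ae hc.ae_eq_mk]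
  refine eLpNorm_lintegral_le_of_measurable (f := fun x y => hf.mk _ (x, y)) hf.measurable_mk
    hc.measurable_mk hr ?_
  filter_upwards [hfc, h2, hc.ae_eq_mk] with y hy h2y hcy
  rw [← hcy]
  exact (eLpNorm_congr_ae h2y).symm.trans_le hy

/-- Hölder's inequality for the product of the norms of two functions. -/
theorem eLpNorm_enorm_mul_enorm_le {V W : Type*} [NormedAddCommGroup V] [NormedAddCommGroup W]
    {μ : Measure α} {f : α → V} {g : α → W} (hf : AEStronglyMeasurable f μ)
    (hg : AEStronglyMeasurable g μ) {p q r : ℝ≥0∞} (hpqr : p⁻¹ + q⁻¹ = r⁻¹) :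
    eLpNorm (fun x => ‖f x‖ₑ * ‖g x‖ₑ) r μ ≤ eLpNorm f p μ * eLpNorm g q μ := by
  have : ENNReal.HolderTriple p q r := ⟨hpqr⟩
  have := eLpNorm_le_eLpNorm_mul_eLpNorm_of_nnnorm (p := p) (q := q) (r := r) hf hg
    (fun v w => ‖v‖ * ‖w‖) 1 (Filter.Eventually.of_forall fun x => by simp)
  rw [ENNReal.coe_one, one_mul] at this
  refine le_trans (eLpNorm_mono_enorm fun x => ?_) this
  simp

end Minkowski

section Translation

variable {E V : Type*} [NormedAddCommGroup E] [MeasurableSpace E] [BorelSpace E]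
  [NormedAddCommGroup V] {μ : Measure E} [μ.IsAddHaarMeasure]

theorem eLpNorm_comp_sub_right {f : E → V} (hf : AEStronglyMeasurable f μ) (p : ℝ≥0∞) (z : E) :
    eLpNorm (fun x => f (x - z)) p μ = eLpNorm f p μ :=
  eLpNorm_comp_measurePreserving hf (measurePreserving_sub_right μ z)

theorem MeasureTheory.AEStronglyMeasurable.comp_sub_right {f : E → V}
    (hf : AEStronglyMeasurable f μ) (z : E) :
    AEStronglyMeasurable (fun x => f (x - z)) μ :=
  hf.comp_measurePreserving (measurePreserving_sub_right μ z)

end Translation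

/-! ### Functions of tempered growth and their convolutions with Schwartz functions -/

theorem one_add_norm_le_mul {E : Type*} [NormedAddCommGroup E] (x y : E) :
    1 + ‖x‖ ≤ (1 + ‖x - y‖) * (1 + ‖y‖) := by
  have : ‖x‖ ≤ ‖x - y‖ + ‖y‖ := by simpa using norm_add_le (x - y) y
  nlinarith [norm_nonneg (x - y), norm_nonneg y, mul_nonneg (norm_nonneg (x - y)) (norm_nonneg y)]

theorem continuous_inv_one_add_norm_pow {E : Type*} [NormedAddCommGroup E] (m : ℕ) :
    Continuous fun y : E => ((1 + ‖y‖) ^ m)⁻¹ :=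
  ((continuous_const.add continuous_norm).pow m).inv₀ fun y =>
    (pow_pos (by positivity : (0 : ℝ) < 1 + ‖y‖) m).ne'

theorem SchwartzMap.exists_norm_le {E W : Type*} [NormedAddCommGroup E] [NormedSpace ℝ E]
    [NormedAddCommGroup W] [NormedSpace ℝ W] (k : SchwartzMap E W) (m : ℕ) :
    ∃ C, 0 ≤ C ∧ ∀ x, ‖k x‖ ≤ C * ((1 + ‖x‖) ^ m)⁻¹ := by
  have h := fun x => SchwartzMap.one_add_le_sup_seminorm_apply (𝕜 := ℝ) (m := (m, 0)) le_rfl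
    le_rfl k x
  simp only [norm_iteratedFDeriv_zero] at h
  refine ⟨_, le_trans (by positivity) (h 0), fun x => ?_⟩
  rw [← div_eq_mul_inv, le_div_iff₀ (by positivity), mul_comm]
  exact h x

section Tempered

variable {E V W V' : Type*} [NormedAddCommGroup E] [InnerProductSpace ℝ E] [FiniteDimensional ℝ E]
  [MeasurableSpace E] [BorelSpace E] [NormedAddCommGroup V] [NormedSpace ℝ V]
  [NormedAddCommGroup W] [NormedSpace ℝ W] [NormedAddCommGroup V'] [NormedSpace ℝ V']

/-- A function which becomes integrable after division by some power of `1 + ‖y‖`, so that it can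
be convolved with every Schwartz function. -/
def IsTempered (f : E → V) : Prop :=
  ∃ m : ℕ, Integrable (fun y => ((1 + ‖y‖) ^ m)⁻¹ • f y)

theorem integrable_inv_one_add_norm_pow :
    Integrable (fun y : E => ((1 + ‖y‖) ^ (Module.finrank ℝ E + 1))⁻¹) := by
  have := integrable_one_add_norm (E := E) (μ := volume) (r := (Module.finrank ℝ E + 1 : ℕ))
    (by push_cast; linarith)
  simpa only [Real.rpow_neg (add_nonneg zero_le_one (norm_nonneg _)), Real.rpow_natCast] using this

theorem IsTempered.aestronglyMeasurable {f : E → V} (hf : IsTempered f) :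
    AEStronglyMeasurable f := by
  obtain ⟨m, hm⟩ := hf
  have h := ((continuous_const.add continuous_norm).pow m :
    Continuous fun y : E => (1 + ‖y‖) ^ m).aestronglyMeasurable.smul hm.aestronglyMeasurable
  refine h.congr (Filter.Eventually.of_forall fun y => ?_)
  have : (1 + ‖y‖) ^ m ≠ 0 := by positivity
  simp [smul_smul, this]

theorem IsTempered.exists_le {f : E → V} (hf : IsTempered f) (m₀ : ℕ) :
    ∃ m, m₀ ≤ m ∧ Integrable (fun y => ((1 + ‖y‖) ^ m)⁻¹ • f y) := by
  have hfm := hf.aestronglyMeasurable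
  obtain ⟨m, hm⟩ := hf
  refine ⟨m + m₀, by omega, hm.mono
    ((continuous_inv_one_add_norm_pow _).aestronglyMeasurable.smul hfm)
    (Filter.Eventually.of_forall fun y => ?_)⟩
  simp only [norm_smul, norm_inv, norm_pow]
  rw [Real.norm_of_nonneg (show (0 : ℝ) ≤ 1 + ‖y‖ by positivity)]
  gcongr
  · linarith [norm_nonneg y]
  · omega

theorem IsTempered.add {f g : E → V} (hf : IsTempered f) (hg : IsTempered g) :
    IsTempered (fun x => f x + g x) := by
  obtain ⟨m, hm⟩ := id hf
  obtain ⟨n, hmn, hn⟩ := hg.exists_le m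
  refine ⟨n, ?_⟩
  have : Integrable (fun y => ((1 + ‖y‖) ^ n)⁻¹ • f y) := by
    refine hm.mono ((continuous_inv_one_add_norm_pow _).aestronglyMeasurable.smul
      hf.aestronglyMeasurable) (Filter.Eventually.of_forall fun y => ?_)
    simp only [norm_smul, norm_inv, norm_pow]
    rw [Real.norm_of_nonneg (show (0 : ℝ) ≤ 1 + ‖y‖ by positivity)]
    gcongr
    linarith [norm_nonneg y]
  refine (this.add hn).congr (Filter.Eventually.of_forall fun y => ?_)
  simp

theorem IsTempered.mono_growth {f : E → V} {g : E → W} (hf : IsTempered f)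
    (hg : AEStronglyMeasurable g) {C : ℝ} {n : ℕ} (h : ∀ x, ‖g x‖ ≤ C * (1 + ‖x‖) ^ n * ‖f x‖) :
    IsTempered g := by
  obtain ⟨m, hm⟩ := hf
  refine ⟨m + n, (hm.norm.const_mul C).mono'
    ((continuous_inv_one_add_norm_pow _).aestronglyMeasurable.smul hg)
    (Filter.Eventually.of_forall fun y => ?_)⟩
  have hy : (0 : ℝ) < 1 + ‖y‖ := by positivity
  rw [norm_smul, norm_smul, norm_inv, norm_inv, norm_pow, norm_pow, Real.norm_of_nonneg hy.le]
  calc ((1 + ‖y‖) ^ (m + n))⁻¹ * ‖g y‖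
      ≤ ((1 + ‖y‖) ^ (m + n))⁻¹ * (C * (1 + ‖y‖) ^ n * ‖f y‖) := by gcongr; exact h y
    _ = C * (((1 + ‖y‖) ^ m)⁻¹ * ‖f y‖) := by field_simp; ring

theorem isTempered_const (c : V) : IsTempered (fun _ : E => c) :=
  ⟨_, integrable_inv_one_add_norm_pow.smul_const c⟩

theorem isTempered_of_growth {f : E → V} (hf : AEStronglyMeasurable f) {C : ℝ} {n : ℕ}
    (h : ∀ x, ‖f x‖ ≤ C * (1 + ‖x‖) ^ n) : IsTempered f :=
  (isTempered_const (E := E) (1 : ℝ)).mono_growth hf (C := C) (n := n) (by simpa using h)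

/-- The exponent `dim E + 1` works for all `p`: for finite `p`, bound `‖f‖` by `1 + ‖f‖ ^ p`. -/
theorem MeasureTheory.MemLp.isTempered {f : E → V} {p : ℝ≥0∞} (hp : 1 ≤ p)
    (hf : MemLp f p) : IsTempered f := by
  have hm : AEStronglyMeasurable
      (fun y => ((1 + ‖y‖) ^ (Module.finrank ℝ E + 1))⁻¹ • f y) volume :=
    (continuous_inv_one_add_norm_pow _).aestronglyMeasurable.smul hf.1
  have hp0 : p ≠ 0 := (zero_lt_one.trans_le hp).ne'
  rcases eq_or_ne p ⊤ with rfl | hpt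
  · refine ⟨_, (integrable_inv_one_add_norm_pow.const_mul
      (eLpNorm f ⊤ volume).toReal).mono' hm ?_⟩
    filter_upwards [ae_le_eLpNormEssSup (f := f) (μ := volume)] with y hy
    rw [norm_smul, norm_inv, norm_pow, Real.norm_of_nonneg (by positivity), mul_comm]
    gcongr
    rw [eLpNorm_exponent_top, ← toReal_enorm]
    refine ENNReal.toReal_mono ?_ hy
    simpa [eLpNorm_exponent_top] using hf.2.ne
  · refine ⟨_, (integrable_inv_one_add_norm_pow.add
      (hf.integrable_norm_rpow hp0 hpt)).mono' hm (Filter.Eventually.of_forall fun y => ?_)⟩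
    have hp1 : 1 ≤ p.toReal := by
      rw [← ENNReal.toReal_one]; exact ENNReal.toReal_mono hpt hp
    have h0 : ((1 + ‖y‖) ^ (Module.finrank ℝ E + 1))⁻¹ ≤ 1 :=
      inv_le_one_of_one_le₀ (one_le_pow₀ (by linarith [norm_nonneg y]))
    have h1 : (0 : ℝ) ≤ ((1 + ‖y‖) ^ (Module.finrank ℝ E + 1))⁻¹ := by positivity
    rw [norm_smul, norm_inv, norm_pow, Real.norm_of_nonneg (show (0 : ℝ) ≤ 1 + ‖y‖ by positivity),
      Pi.add_apply]
    rcases le_total ‖f y‖ 1 with h | h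
    · have : (0 : ℝ) ≤ ‖f y‖ ^ p.toReal := by positivity
      nlinarith
    · have : ‖f y‖ ≤ ‖f y‖ ^ p.toReal := by
        simpa using Real.rpow_le_rpow_of_exponent_le h hp1
      nlinarith [norm_nonneg (f y)]

/-- The convolution of a Schwartz function and a tempered function has polynomial growth, even
with absolute values inside the integral. -/
theorem IsTempered.exists_lintegral_le (k : SchwartzMap E W) {f : E → V} (hf : IsTempered f) :
    ∃ (C : ℝ) (m : ℕ), 0 ≤ C ∧
      ∀ x, ∫⁻ y, ‖k y‖ₑ * ‖f (x - y)‖ₑ ≤ ENNReal.ofReal (C * (1 + ‖x‖) ^ m) := by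
  obtain ⟨m, hm⟩ := hf
  obtain ⟨K, hK0, hK⟩ := k.exists_norm_le m
  refine ⟨K * ∫ y, ‖((1 + ‖y‖) ^ m)⁻¹ • f y‖, m, by positivity, fun x => ?_⟩
  rw [← lintegral_sub_left_eq_self _ x]
  simp only [sub_sub_cancel]
  calc ∫⁻ y, ‖k (x - y)‖ₑ * ‖f y‖ₑ
      ≤ ∫⁻ y, ENNReal.ofReal (K * (1 + ‖x‖) ^ m) * ‖((1 + ‖y‖) ^ m)⁻¹ • f y‖ₑ := by
        refine lintegral_mono fun y => ?_
        simp only [← ofReal_norm]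
        rw [← ENNReal.ofReal_mul (by positivity), ← ENNReal.ofReal_mul (by positivity)]
        refine ENNReal.ofReal_le_ofReal ?_
        rw [norm_smul, norm_inv, norm_pow,
          Real.norm_of_nonneg (show (0 : ℝ) ≤ 1 + ‖y‖ by positivity), ← mul_assoc]
        gcongr
        refine (hK _).trans ?_
        rw [mul_assoc]
        gcongr
        rw [← div_eq_mul_inv, inv_le_comm₀ (by positivity) (by positivity), inv_div,
          div_le_iff₀ (by positivity), ← mul_pow]
        gcongr
        rw [norm_sub_rev]
        exact one_add_norm_le_mul y x
    _ = ENNReal.ofReal (K * (∫ y, ‖((1 + ‖y‖) ^ m)⁻¹ • f y‖) * (1 + ‖x‖) ^ m) := by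
        rw [lintegral_const_mul' _ _ ENNReal.ofReal_ne_top,
          ← ofReal_integral_norm_eq_lintegral_enorm hm, ← ENNReal.ofReal_mul (by positivity)]
        ring_nf

theorem IsTempered.integrable_conv (L : W →L[ℝ] V →L[ℝ] V') (k : SchwartzMap E W) {f : E → V}
    (hf : IsTempered f) (x : E) : Integrable (fun y => L (k y) (f (x - y))) := by
  obtain ⟨C, m, hC, h⟩ := hf.exists_lintegral_le k
  refine ⟨?_, ?_⟩
  · exact k.continuous.aestronglyMeasurable.convolution_integrand_snd L hf.aestronglyMeasurable x
  · rw [hasFiniteIntegral_iff_enorm]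
    calc ∫⁻ y, ‖L (k y) (f (x - y))‖ₑ ≤ ∫⁻ y, ‖L‖ₑ * (‖k y‖ₑ * ‖f (x - y)‖ₑ) := by
          refine lintegral_mono fun y => ?_
          simp only [← ofReal_norm]
          rw [← ENNReal.ofReal_mul (by positivity), ← ENNReal.ofReal_mul (by positivity),
            ← mul_assoc]
          exact ENNReal.ofReal_le_ofReal (L.le_opNorm₂ _ _)
      _ < ⊤ := by
          rw [lintegral_const_mul' _ _ enorm_ne_top]
          exact ENNReal.mul_lt_top enorm_lt_top ((h x).trans_lt ENNReal.ofReal_lt_top)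

theorem MeasureTheory.AEStronglyMeasurable.conv (L : W →L[ℝ] V →L[ℝ] V') {k : E → W} {f : E → V}
    (hk : AEStronglyMeasurable k) (hf : AEStronglyMeasurable f) :
    AEStronglyMeasurable (k ⋆[L, volume] f) :=
  (hk.convolution_integrand L hf).integral_prod_right'

theorem IsTempered.exists_norm_conv_le (k : SchwartzMap E ℝ) {f : E → V}
    (hf : IsTempered f) : ∃ (C : ℝ) (m : ℕ), 0 ≤ C ∧
      ∀ x, ‖((k : E → ℝ) ⋆[ContinuousLinearMap.lsmul ℝ ℝ, volume] f) x‖ ≤ C * (1 + ‖x‖) ^ m := by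
  obtain ⟨C, m, hC, h⟩ := hf.exists_lintegral_le k
  refine ⟨C, m, hC, fun x => ?_⟩
  rw [← ENNReal.ofReal_le_ofReal_iff (by positivity), ofReal_norm]
  refine le_trans (enorm_integral_le_lintegral_enorm _)
    (le_trans (lintegral_mono fun y => ?_) (h x))
  simp [enorm_smul]

theorem IsTempered.conv (k : SchwartzMap E ℝ) {f : E → V} (hf : IsTempered f) :
    IsTempered ((k : E → ℝ) ⋆[ContinuousLinearMap.lsmul ℝ ℝ, volume] f) := by
  obtain ⟨C, m, -, h⟩ := hf.exists_norm_conv_le k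
  exact isTempered_of_growth (AEStronglyMeasurable.conv _ k.continuous.aestronglyMeasurable
    hf.aestronglyMeasurable) h

theorem IsTempered.norm {f : E → V} (hf : IsTempered f) : IsTempered (fun x => ‖f x‖) :=
  hf.mono_growth hf.aestronglyMeasurable.norm (C := 1) (n := 0) (by simp)

theorem IsTempered.conv_assoc [CompleteSpace V] (k₁ k₂ : SchwartzMap E ℝ) {f : E → V}
    (hf : IsTempered f) :
    ((k₁ : E → ℝ) ⋆[ContinuousLinearMap.lsmul ℝ ℝ, volume] (k₂ : E → ℝ))
        ⋆[ContinuousLinearMap.lsmul ℝ ℝ, volume] f =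
      (k₁ : E → ℝ) ⋆[ContinuousLinearMap.lsmul ℝ ℝ, volume]
        ((k₂ : E → ℝ) ⋆[ContinuousLinearMap.lsmul ℝ ℝ, volume] f) := by
  funext x
  have hk (k : SchwartzMap E ℝ) : IsTempered (k : E → ℝ) :=
    k.memLp (1 : ℝ≥0∞) |>.isTempered le_rfl
  refine convolution_assoc (ContinuousLinearMap.lsmul ℝ ℝ) (ContinuousLinearMap.lsmul ℝ ℝ)
    (ContinuousLinearMap.lsmul ℝ ℝ) (ContinuousLinearMap.lsmul ℝ ℝ) ?_
    k₁.continuous.aestronglyMeasurable k₂.continuous.aestronglyMeasurable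
    hf.aestronglyMeasurable ?_ ?_ ?_
  · intro a b v; simp [smul_smul, mul_comm]
  · exact Filter.Eventually.of_forall fun y => (hk k₂).integrable_conv _ k₁ y
  · refine Filter.Eventually.of_forall fun y => ?_
    refine (hf.norm.integrable_conv (ContinuousLinearMap.mul ℝ ℝ) k₂ y).norm.congr
      (Filter.Eventually.of_forall fun z => by simp)
  · -- the convolution of the absolute values is again tempered
    have ht : IsTempered
        ((fun x => ‖k₂ x‖) ⋆[ContinuousLinearMap.mul ℝ ℝ, volume] fun x => ‖f x‖) := by
      obtain ⟨C, m, hC, h⟩ := hf.exists_lintegral_le k₂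
      refine isTempered_of_growth (C := C) (n := m) (AEStronglyMeasurable.conv _
        k₂.continuous.norm.aestronglyMeasurable hf.aestronglyMeasurable.norm) fun x => ?_
      rw [← ENNReal.ofReal_le_ofReal_iff (by positivity), ofReal_norm]
      refine le_trans (enorm_integral_le_lintegral_enorm _)
        (le_trans (lintegral_mono fun y => ?_) (h x))
      simp
    refine (ht.integrable_conv (ContinuousLinearMap.mul ℝ ℝ) k₁ x).norm.congr
      (Filter.Eventually.of_forall fun z => ?_)
    have : 0 ≤ ((fun x => ‖k₂ x‖) ⋆[ContinuousLinearMap.mul ℝ ℝ, volume] fun x => ‖f x‖) (x - z) :=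
      integral_nonneg fun y => by simp only [ContinuousLinearMap.mul_apply']; positivity
    simp only [ContinuousLinearMap.mul_apply', norm_mul, Real.norm_of_nonneg this]

/-- A convolution with a Schwartz function may be differentiated under the integral sign. -/
theorem IsTempered.hasFDerivAt_conv [CompleteSpace V] (k : SchwartzMap E ℝ) {f : E → V}
    (hf : IsTempered f) (x₀ : E) :
    HasFDerivAt ((k : E → ℝ) ⋆[ContinuousLinearMap.lsmul ℝ ℝ, volume] f)
      (∫ y, (fderiv ℝ k y).smulRight (f (x₀ - y))) x₀ := by
  set k' := SchwartzMap.fderivCLM ℝ E ℝ k with hk'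
  have hk'_apply : ∀ y, k' y = fderiv ℝ k y := fun y => rfl
  obtain ⟨m, hm⟩ := id hf
  obtain ⟨K, hK0, hK⟩ := k'.exists_norm_le m
  have e1 : ((k : E → ℝ) ⋆[ContinuousLinearMap.lsmul ℝ ℝ, volume] f) =
      fun x => ∫ y, k (x - y) • f y := by
    funext x; exact convolution_lsmul_swap
  have e2 : (∫ y, (fderiv ℝ k y).smulRight (f (x₀ - y))) =
      ∫ y, (fderiv ℝ k (x₀ - y)).smulRight (f y) := by
    rw [← integral_sub_left_eq_self _ _ x₀]
    simp only [sub_sub_cancel]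
  rw [e1, e2]
  have hint (x : E) : Integrable (fun y => k (x - y) • f y) := by
    simpa using (hf.integrable_conv (ContinuousLinearMap.lsmul ℝ ℝ) k x).comp_sub_left x
  refine hasFDerivAt_integral_of_dominated_of_fderiv_le (Metric.ball_mem_nhds x₀ one_pos)
    (F' := fun x y => (fderiv ℝ k (x - y)).smulRight (f y))
    (bound := fun y => K * (2 + ‖x₀‖) ^ m * ‖((1 + ‖y‖) ^ m)⁻¹ • f y‖)
    (Filter.Eventually.of_forall fun x => (hint x).aestronglyMeasurable) (hint x₀) ?_ ?_
    (hm.norm.const_mul _) ?_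
  · have hc : Continuous fun y => k' (x₀ - y) := k'.continuous.comp (by fun_prop)
    exact (ContinuousLinearMap.smulRightL ℝ E V).aestronglyMeasurable_comp₂
      hc.aestronglyMeasurable hf.aestronglyMeasurable
  · refine Filter.Eventually.of_forall fun y x hx => ?_
    have hx' : ‖x‖ ≤ 1 + ‖x₀‖ := by
      have h1 : ‖x - x₀‖ < 1 := by simpa [dist_eq_norm] using hx
      linarith [norm_sub_norm_le x x₀]
    rw [ContinuousLinearMap.norm_smulRight_apply, norm_smul, norm_inv, norm_pow,
      Real.norm_of_nonneg (show (0 : ℝ) ≤ 1 + ‖y‖ by positivity), ← mul_assoc]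
    gcongr
    rw [← hk'_apply]
    refine (hK _).trans ?_
    rw [mul_assoc]
    gcongr
    rw [← div_eq_mul_inv, inv_le_comm₀ (by positivity) (by positivity), inv_div,
      div_le_iff₀ (by positivity), ← mul_pow]
    gcongr
    have := one_add_norm_le_mul y x
    rw [norm_sub_rev] at this
    refine this.trans (mul_le_mul_of_nonneg_left ?_ (by positivity))
    linarith
  · refine Filter.Eventually.of_forall fun y x _ => ?_
    have h1 : HasFDerivAt k (fderiv ℝ k (x - y)) (x - y) :=
      (k.differentiable (x - y)).hasFDerivAt
    have h2 : HasFDerivAt (fun x => k (x - y)) (fderiv ℝ k (x - y)) x := by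
      have := h1.comp x ((hasFDerivAt_id x).sub_const y)
      rwa [ContinuousLinearMap.comp_id] at this
    exact h2.smul_const (f y)

theorem IsTempered.continuous_conv [CompleteSpace V] (k : SchwartzMap E ℝ) {f : E → V}
    (hf : IsTempered f) :
    Continuous ((k : E → ℝ) ⋆[ContinuousLinearMap.lsmul ℝ ℝ, volume] f) :=
  continuous_iff_continuousAt.2 fun x => (hf.hasFDerivAt_conv k x).continuousAt

/-- Young's inequality `‖k * f‖_p ≤ ‖k‖₁ ‖f‖_p`. -/
theorem eLpNorm_conv_le {k : E → ℝ} {f : E → V} (hk : AEStronglyMeasurable k)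
    (hf : AEStronglyMeasurable f) {p : ℝ≥0∞} (hp : 1 ≤ p) :
    eLpNorm (k ⋆[ContinuousLinearMap.lsmul ℝ ℝ, volume] f) p volume ≤
      (∫⁻ z, ‖k z‖ₑ) * eLpNorm f p volume := by
  have hm := (hk.convolution_integrand (ContinuousLinearMap.lsmul ℝ ℝ) hf (μ := volume)).enorm
  calc eLpNorm (k ⋆[ContinuousLinearMap.lsmul ℝ ℝ, volume] f) p volume
      ≤ eLpNorm (fun x => ∫⁻ z, ‖k z • f (x - z)‖ₑ) p volume :=
        eLpNorm_mono_enorm fun x => by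
          simpa [convolution_def] using enorm_integral_le_lintegral_enorm _
    _ ≤ ∫⁻ z, ‖k z‖ₑ * eLpNorm f p volume := by
        refine eLpNorm_lintegral_le (f := fun x z => ‖k z • f (x - z)‖ₑ) hm
          (hk.enorm.mul_const _) hp (Filter.Eventually.of_forall fun z => le_of_eq ?_)
        rw [← eLpNorm_comp_sub_right hf p z, ← eLpNorm_const_smul]
        exact eLpNorm_congr_enorm_ae (Filter.Eventually.of_forall fun x => by simp)
    _ = _ := lintegral_mul_const'' _ hk.enorm

/-- A convolution with a kernel of integral one is close to the identity on functions whose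
translates depend on the translation in a Lipschitz way. -/
theorem eLpNorm_sub_conv_le [CompleteSpace V] {k : E → ℝ} {f : E → V} (hk : Integrable k)
    (hk1 : ∫ z, k z = 1) (hf : AEStronglyMeasurable f) {p : ℝ≥0∞} (hp : 1 ≤ p)
    (hex : ConvolutionExists k f (ContinuousLinearMap.lsmul ℝ ℝ) volume) {A : ℝ≥0∞}
    (hA : ∀ z, eLpNorm (fun x => f x - f (x - z)) p volume ≤ ‖z‖ₑ * A) :
    eLpNorm (fun x => f x - (k ⋆[ContinuousLinearMap.lsmul ℝ ℝ, volume] f) x) p volume ≤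
      (∫⁻ z, ‖k z‖ₑ * ‖z‖ₑ) * A := by
  have hkz : AEMeasurable (fun z => ‖k z‖ₑ * ‖z‖ₑ) volume :=
    hk.1.enorm.mul continuous_id.enorm.measurable.aemeasurable
  have e (x : E) : f x - (k ⋆[ContinuousLinearMap.lsmul ℝ ℝ, volume] f) x =
      ∫ z, k z • (f x - f (x - z)) := by
    simp only [smul_sub]
    have h2 : Integrable (fun z => k z • f (x - z)) := hex x
    rw [integral_sub (hk.smul_const _) h2, integral_smul_const, hk1, one_smul]
    rfl
  have hm : AEStronglyMeasurable (fun q : E × E => k q.2 • (f q.1 - f (q.1 - q.2)))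
      (volume.prod volume) :=
    hk.1.comp_snd.smul (hf.comp_fst.sub
      (hf.comp_quasiMeasurePreserving (quasiMeasurePreserving_sub_of_right_invariant _ _)))
  calc _ ≤ eLpNorm (fun x => ∫⁻ z, ‖k z • (f x - f (x - z))‖ₑ) p volume :=
        eLpNorm_mono_enorm fun x => by
          rw [e x]; simpa using enorm_integral_le_lintegral_enorm _
    _ ≤ ∫⁻ z, ‖k z‖ₑ * ‖z‖ₑ * A := by
        refine eLpNorm_lintegral_le (f := fun x z => ‖k z • (f x - f (x - z))‖ₑ) hm.enorm
          (hkz.mul_const _) hp (Filter.Eventually.of_forall fun z => ?_)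
        rw [mul_assoc]
        refine le_trans (le_of_eq ?_) (mul_le_mul_right (hA z) ‖k z‖ₑ)
        rw [← eLpNorm_const_smul]
        exact eLpNorm_congr_enorm_ae (Filter.Eventually.of_forall fun x => by simp)
    _ = _ := lintegral_mul_const'' _ hkz

end Tempered

/-! ### Integrals along segments -/

/-- The uniform probability measure on the unit interval. -/
noncomputable abbrev unitMeasure : Measure ℝ := volume.restrict (Ioc 0 1)

instance : IsProbabilityMeasure unitMeasure := ⟨by simp⟩

section Segment

variable {E V : Type*} [NormedAddCommGroup E] [InnerProductSpace ℝ E] [FiniteDimensional ℝ E]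
  [MeasurableSpace E] [BorelSpace E] [NormedAddCommGroup V] [NormedSpace ℝ V]

/-- The mean value of `G` on the segment from `x` to `x - z`. -/
noncomputable def segmentMean (G : E → V) (z x : E) : V := ∫ t, G (x - t • z) ∂unitMeasure

theorem measurePreserving_shear (ν : Measure ℝ) [SFinite ν] (z : E) :
    MeasurePreserving (fun q : ℝ × E => (q.1, q.2 - q.1 • z)) (ν.prod volume) (ν.prod volume) := by
  refine (MeasurePreserving.id ν).skew_product (g := fun (t : ℝ) (x : E) => x - t • z)
    (by fun_prop) (Filter.Eventually.of_forall fun t => ?_)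
  exact (measurePreserving_sub_right volume (t • z)).map_eq

theorem MeasureTheory.AEStronglyMeasurable.comp_shear {F : Type*} [NormedAddCommGroup F]
    {G : E → F} (hG : AEStronglyMeasurable G) (z : E) (ν : Measure ℝ) [SFinite ν] :
    AEStronglyMeasurable (fun q : ℝ × E => G (q.2 - q.1 • z)) (ν.prod volume) :=
  (hG.comp_snd (μ := ν)).comp_measurePreserving (measurePreserving_shear ν z)

theorem MeasureTheory.AEStronglyMeasurable.segmentMean {G : E → V}
    (hG : AEStronglyMeasurable G) (z : E) :
    AEStronglyMeasurable (segmentMean G z) :=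
  (hG.comp_shear z unitMeasure).prod_swap.integral_prod_right'

/-- The mean over a segment does not increase the `L^p` norm. -/
theorem eLpNorm_segmentMean_le {G : E → V} (hG : AEStronglyMeasurable G) (z : E) {p : ℝ≥0∞}
    (hp : 1 ≤ p) : eLpNorm (segmentMean G z) p volume ≤ eLpNorm G p volume := by
  calc eLpNorm (segmentMean G z) p volume
      ≤ eLpNorm (fun x => ∫⁻ t, ‖G (x - t • z)‖ₑ ∂unitMeasure) p volume :=
        eLpNorm_mono_enorm fun x => by
          simpa [segmentMean] using enorm_integral_le_lintegral_enorm _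
    _ ≤ ∫⁻ _, eLpNorm G p volume ∂unitMeasure := by
        refine eLpNorm_lintegral_le (f := fun x t => ‖G (x - t • z)‖ₑ)
          (hG.comp_shear z unitMeasure).prod_swap.enorm aemeasurable_const hp
          (Filter.Eventually.of_forall fun t => le_of_eq ?_)
        rw [eLpNorm_enorm fun x => G (x - t • z)]
        exact eLpNorm_comp_sub_right hG p _
    _ = _ := by simp

/-- For a locally integrable `f`, the function `(t, x) ↦ θ x • f (x - t z)` is integrable when `θ`
is bounded and vanishes outside of a compact set. -/
theorem integrable_smul_comp_shear {f : E → V} (hf : LocallyIntegrable f) (z : E) {θ : E → ℝ}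
    (hθ : AEStronglyMeasurable θ) {C : ℝ} (hC : ∀ x, ‖θ x‖ ≤ C) {K : Set E} (hK : IsCompact K)
    (hθK : ∀ x ∉ K, θ x = 0) :
    Integrable (fun q : ℝ × E => θ q.2 • f (q.2 - q.1 • z)) (unitMeasure.prod volume) := by
  -- only the values of `f` on the compact set `K - [0, 1] z` matter
  set K' : Set E := (fun q : ℝ × E => q.2 - q.1 • z) '' (Icc 0 1 ×ˢ K)
  have hK' : IsCompact K' := (isCompact_Icc.prod hK).image (by fun_prop)
  have h1 : Integrable (K'.indicator f) :=
    (integrable_indicator_iff hK'.measurableSet).2 (hf.integrableOn_isCompact hK')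
  have h2 : Integrable (fun q : ℝ × E => K'.indicator f (q.2 - q.1 • z))
      (unitMeasure.prod volume) :=
    (measurePreserving_shear unitMeasure z).integrable_comp_of_integrable (h1.comp_snd unitMeasure)
  refine (h2.norm.const_mul C).mono'
    (hθ.comp_snd.smul (hf.aestronglyMeasurable.comp_shear z unitMeasure)) ?_
  have h3 : ∀ᵐ q : ℝ × E ∂unitMeasure.prod volume, q.1 ∈ Ioc (0 : ℝ) 1 :=
    Measure.quasiMeasurePreserving_fst.ae (ae_restrict_mem measurableSet_Ioc)
  filter_upwards [h3] with q hq
  by_cases hqK : q.2 ∈ K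
  · have hmem : q.2 - q.1 • z ∈ K' := ⟨q, ⟨⟨hq.1.le, hq.2⟩, hqK⟩, rfl⟩
    rw [indicator_of_mem hmem, norm_smul]
    gcongr
    exact hC _
  · rw [hθK _ hqK, zero_smul, norm_zero]
    have : 0 ≤ C := (norm_nonneg _).trans (hC q.2)
    positivity

theorem MeasureTheory.LocallyIntegrable.segmentMean {f : E → V} (hf : LocallyIntegrable f) (z : E) :
    LocallyIntegrable (segmentMean f z) := by
  refine locallyIntegrable_iff.2 fun K hK => ?_
  have h := (integrable_smul_comp_shear hf z (θ := K.indicator 1) (C := 1) (K := K)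
    (aestronglyMeasurable_const.indicator hK.measurableSet)
    (fun x => by by_cases hx : x ∈ K <;> simp [hx]) hK
    (fun x hx => by simp [hx])).integral_prod_right
  rw [← integrable_indicator_iff hK.measurableSet]
  refine h.congr (Filter.Eventually.of_forall fun x => ?_)
  by_cases hx : x ∈ K <;> simp [hx, _root_.segmentMean]

theorem IsTempered.integrable_conv_shear (k : SchwartzMap E ℝ) {f : E → V} (hf : IsTempered f)
    (z x : E) : Integrable (fun q : ℝ × E => k q.2 • f (x - q.2 - q.1 • z))
      (unitMeasure.prod volume) := by
  obtain ⟨C, m, hC, h⟩ := hf.exists_lintegral_le k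
  have hm : AEStronglyMeasurable (fun q : ℝ × E => k q.2 • f (x - q.2 - q.1 • z))
      (unitMeasure.prod volume) := by
    refine k.continuous.aestronglyMeasurable.comp_snd.smul ?_
    have h1 : MeasurePreserving (fun q : ℝ × E => (q.1, x - q.2)) (unitMeasure.prod volume)
      (unitMeasure.prod volume) :=
      (MeasurePreserving.id _).prod (Measure.measurePreserving_sub_left volume x)
    exact (hf.aestronglyMeasurable.comp_shear z unitMeasure).comp_measurePreserving h1
  refine ⟨hm, ?_⟩
  rw [hasFiniteIntegral_iff_enorm, lintegral_prod _ hm.enorm]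
  calc ∫⁻ t : ℝ, (∫⁻ y : E, ‖k y • f (x - y - t • z)‖ₑ) ∂unitMeasure
      ≤ ∫⁻ _, ENNReal.ofReal (C * (1 + ‖x‖ + ‖z‖) ^ m) ∂unitMeasure := by
        refine lintegral_mono_ae ?_
        filter_upwards [ae_restrict_mem measurableSet_Ioc] with t ht
        have h1 : ‖x - t • z‖ ≤ ‖x‖ + ‖z‖ := by
          refine (norm_sub_le _ _).trans ?_
          gcongr
          rw [norm_smul, Real.norm_of_nonneg ht.1.le]
          exact mul_le_of_le_one_left (norm_nonneg _) ht.2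
        calc ∫⁻ y, ‖k y • f (x - y - t • z)‖ₑ = ∫⁻ y, ‖k y‖ₑ * ‖f (x - t • z - y)‖ₑ := by
              simp only [enorm_smul, sub_right_comm]
          _ ≤ _ := h _
          _ ≤ _ := by
              gcongr ENNReal.ofReal (C * ?_ ^ m)
              linarith
    _ < ⊤ := by simp

theorem IsTempered.conv_segmentMean (k : SchwartzMap E ℝ) {f : E → V} (hf : IsTempered f)
    (z x : E) :
    ((k : E → ℝ) ⋆[ContinuousLinearMap.lsmul ℝ ℝ, volume] segmentMean f z) x =
      segmentMean ((k : E → ℝ) ⋆[ContinuousLinearMap.lsmul ℝ ℝ, volume] f) z x := by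
  have h := integral_integral_swap (f := fun (t : ℝ) (y : E) => k y • f (x - y - t • z))
    (hf.integrable_conv_shear k z x)
  simp only [convolution_def, ContinuousLinearMap.lsmul_apply, segmentMean, ← integral_smul]
  rw [← h]
  simp only [sub_right_comm]

theorem IsTempered.convolutionExists_segmentMean (k : SchwartzMap E ℝ) {f : E → V}
    (hf : IsTempered f) (z : E) :
    ConvolutionExists (k : E → ℝ) (segmentMean f z) (ContinuousLinearMap.lsmul ℝ ℝ) volume := by
  intro x
  refine (hf.integrable_conv_shear k z x).integral_prod_right.congr
    (Filter.Eventually.of_forall fun y => ?_)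
  simp [segmentMean, integral_smul]

end Segment

/-! ### The finite difference form of the weak gradient -/

/-- The action of the matrix `A` on the vector `z`, for matrices with the Frobenius norm. -/
noncomputable def matAct (d : ℕ) : EuclideanSpace ℝ (Fin d × Fin d) →L[ℝ]
    EuclideanSpace ℝ (Fin d) →L[ℝ] EuclideanSpace ℝ (Fin d) :=
  LinearMap.mkContinuous₂
    (LinearMap.mk₂ ℝ (fun A z => WithLp.toLp 2 fun i => ∑ j, A (i, j) * z j)
      (fun A B z => by ext i; simp [add_mul, Finset.sum_add_distrib])
      (fun c A z => by ext i; simp [mul_assoc, Finset.mul_sum])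
      (fun A z w => by ext i; simp [mul_add, Finset.sum_add_distrib])
      (fun c A z => by ext i; simp [mul_left_comm, Finset.mul_sum])) 1 (fun A z => by
    rw [one_mul, EuclideanSpace.norm_eq, EuclideanSpace.norm_eq, EuclideanSpace.norm_eq,
      ← Real.sqrt_mul (by positivity)]
    refine Real.sqrt_le_sqrt ?_
    simp only [LinearMap.mk₂_apply, Real.norm_eq_abs, sq_abs, Fintype.sum_prod_type]
    rw [Finset.sum_mul]
    exact Finset.sum_le_sum fun i _ => Finset.sum_mul_sq_le_sq_mul_sq _ _ _)

section FiniteDifference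

variable {d : ℕ}

local notation "𝔼" => EuclideanSpace ℝ (Fin d)
local notation "𝔾" => EuclideanSpace ℝ (Fin d × Fin d)

theorem matAct_apply (A : 𝔾) (z : 𝔼) (i : Fin d) : matAct d A z i = ∑ j, A (i, j) * z j := rfl

theorem norm_matAct_le (A : 𝔾) (z : 𝔼) : ‖matAct d A z‖ ≤ ‖A‖ * ‖z‖ := by
  have h := (matAct d).le_opNorm₂ A z
  have h1 : ‖matAct d‖ ≤ 1 := LinearMap.mkContinuous₂_norm_le _ zero_le_one _
  calc ‖matAct d A z‖ ≤ ‖matAct d‖ * ‖A‖ * ‖z‖ := h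
    _ ≤ 1 * ‖A‖ * ‖z‖ := by gcongr
    _ = _ := by rw [one_mul]

theorem enorm_matAct_le (A : 𝔾) (z : 𝔼) : ‖matAct d A z‖ₑ ≤ ‖A‖ₑ * ‖z‖ₑ := by
  simp only [← ofReal_norm]
  rw [← ENNReal.ofReal_mul (norm_nonneg _)]
  exact ENNReal.ofReal_le_ofReal (norm_matAct_le A z)

/-- `G` is a gradient of `u` in the sense that, for every `z`, the difference `u(x) - u(x - z)` is
the mean of `G z` along the segment from `x` to `x - z`, for almost every `x`. In contrast to the
weak gradient, this property is preserved by convolutions with Schwartz functions without any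
integration by parts. -/
def HasSegmentGradient (u : 𝔼 → 𝔼) (G : 𝔼 → 𝔾) : Prop :=
  ∀ z, ∀ᵐ x, u x - u (x - z) = matAct d (segmentMean G z x) z

theorem sum_smul_single (z : 𝔼) : ∑ j, z j • EuclideanSpace.single j (1 : ℝ) = z := by
  simpa using (EuclideanSpace.basisFun (Fin d) ℝ).sum_repr z

theorem apply_eq_sum_single {V : Type*} [NormedAddCommGroup V] [NormedSpace ℝ V] (L : 𝔼 →L[ℝ] V)
    (z : 𝔼) : L z = ∑ j, z j • L (EuclideanSpace.single j 1) := by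
  conv_lhs => rw [← sum_smul_single z]
  simp [map_sum]

theorem MeasureTheory.LocallyIntegrable.eval_piLp {ι : Type*} [Fintype ι]
    {f : 𝔼 → EuclideanSpace ℝ ι} (hf : LocallyIntegrable f) (i : ι) :
    LocallyIntegrable (fun x => f x i) :=
  fun x => by
    obtain ⟨s, hs, h⟩ := hf x
    exact ⟨s, hs, Integrable.eval_piLp h i⟩

/-- A test function along a line, by the fundamental theorem of calculus. -/
theorem sub_comp_add_eq_integral {η : 𝔼 → ℝ} (hη : ContDiff ℝ ∞ η) (z x : 𝔼) :
    η (x + z) - η x = ∫ t, fderiv ℝ η (x + t • z) z ∂unitMeasure := by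
  have hder : ∀ t ∈ uIcc (0 : ℝ) 1,
      HasDerivAt (fun t : ℝ => η (x + t • z)) (fderiv ℝ η (x + t • z) z) t := by
    intro t _
    have h1 : HasDerivAt (fun t : ℝ => x + t • z) z t := by
      simpa using ((hasDerivAt_id t).smul_const z).const_add x
    exact ((hη.differentiable (by simp)) (x + t • z)).hasFDerivAt.comp_hasDerivAt t h1
  have hc : Continuous fun t : ℝ => fderiv ℝ η (x + t • z) z :=
    ((hη.continuous_fderiv (by simp)).comp (by fun_prop)).clm_apply continuous_const
  have := intervalIntegral.integral_eq_sub_of_hasDerivAt hder (hc.intervalIntegrable _ _)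
  rw [intervalIntegral.integral_of_le zero_le_one] at this
  simpa using this.symm

theorem IsWeakGradient.integral_eval_mul_fderiv {u : 𝔼 → 𝔼} {G : 𝔼 → 𝔾}
    (h : IsWeakGradient u G) (i : Fin d) {η : 𝔼 → ℝ} (hη : ContDiff ℝ ∞ η)
    (hηc : HasCompactSupport η) (z : 𝔼) :
    ∫ x, u x i * fderiv ℝ η x z = -∫ x, matAct d (G x) z i * η x := by
  have hint1 (j : Fin d) :
      Integrable (fun x => z j • (u x i * fderiv ℝ η x (EuclideanSpace.single j 1))) := by
    refine Integrable.smul (z j) (f := fun x => u x i * fderiv ℝ η x _) ?_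
    have hc : Continuous fun x => fderiv ℝ η x (EuclideanSpace.single j 1) :=
      (hη.continuous_fderiv (by simp)).clm_apply continuous_const
    have hs : HasCompactSupport fun x => fderiv ℝ η x (EuclideanSpace.single j 1) :=
      (hηc.fderiv (𝕜 := ℝ)).comp_left (g := fun L : 𝔼 →L[ℝ] ℝ => L (EuclideanSpace.single j 1)) rfl
    exact (h.1.eval_piLp i).integrable_smul_right_of_hasCompactSupport hc hs
  have hint2 (j : Fin d) : Integrable (fun x => z j • (G x (i, j) * η x)) :=
    Integrable.smul (z j) (f := fun x => G x (i, j) * η x)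
      ((h.2.1.eval_piLp (i, j)).integrable_smul_right_of_hasCompactSupport hη.continuous hηc)
  calc ∫ x, u x i * fderiv ℝ η x z
      = ∫ x, ∑ j, z j • (u x i * fderiv ℝ η x (EuclideanSpace.single j 1)) := by
        congr 1 with x
        rw [apply_eq_sum_single, Finset.mul_sum]
        exact Finset.sum_congr rfl fun j _ => by simp; ring
    _ = ∑ j, z j • -∫ x, G x (i, j) * η x := by
        rw [integral_finsetSum _ fun j _ => hint1 j]
        exact Finset.sum_congr rfl fun j _ => by rw [integral_smul, h.2.2 i j η hη hηc]
    _ = -∫ x, ∑ j, z j • (G x (i, j) * η x) := by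
        rw [integral_finsetSum _ fun j _ => hint2 j, ← Finset.sum_neg_distrib]
        exact Finset.sum_congr rfl fun j _ => by rw [integral_smul, smul_neg]
    _ = -∫ x, matAct d (G x) z i * η x := by
        congr 2 with x
        rw [matAct_apply, Finset.sum_mul]
        exact Finset.sum_congr rfl fun j _ => by simp; ring

theorem matAct_segmentMean_apply {G : 𝔼 → 𝔾} {z x : 𝔼}
    (h : Integrable (fun t : ℝ => G (x - t • z)) unitMeasure) (i : Fin d) :
    matAct d (segmentMean G z x) z i = ∫ t, matAct d (G (x - t • z)) z i ∂unitMeasure := by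
  have h1 : matAct d (segmentMean G z x) z = ∫ t, matAct d (G (x - t • z)) z ∂unitMeasure :=
    (((matAct d).flip z).integral_comp_comm h).symm
  have h2 : Integrable (fun t : ℝ => matAct d (G (x - t • z)) z) unitMeasure :=
    ((matAct d).flip z).integrable_comp h
  rw [h1, eval_integral_piLp fun i => h2.eval_piLp i]

/-- Tested with `η`, the claim is the fundamental theorem of calculus for `η` along the segment,
combined with the definition of the weak gradient for the translates of `η` and Fubini's theorem. -/
theorem IsWeakGradient.hasSegmentGradient {u : 𝔼 → 𝔼} {G : 𝔼 → 𝔾} (h : IsWeakGradient u G) :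
    HasSegmentGradient u G := by
  intro z
  have hmp := measurePreserving_sub_right (volume : Measure 𝔼) z
  have hu := h.1
  have hG := h.2.1
  have hus : LocallyIntegrable fun x => u (x - z) := by
    refine locallyIntegrable_iff.2 fun K hK => ?_
    have hK' : IsCompact ((fun x => x - z) '' K) := hK.image (by fun_prop)
    have := (hmp.integrableOn_image (MeasurableEquiv.subRight z).measurableEmbedding
      (f := u) (s := K)).1 (hu.integrableOn_isCompact hK')
    exact this
  have hr : LocallyIntegrable fun x => matAct d (segmentMean G z x) z :=
    fun x => by
      obtain ⟨s, hs, h'⟩ := (LocallyIntegrable.segmentMean hG z) x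
      exact ⟨s, hs, ((matAct d).flip z).integrable_comp h'⟩
  refine ae_eq_of_integral_contDiff_smul_eq (hu.sub hus) hr fun η hη hηc => ?_
  obtain ⟨C, hC⟩ := hη.continuous.bounded_above_of_compact_support hηc
  have hη0 : ∀ x ∉ tsupport η, η x = 0 := fun x hx => image_eq_zero_of_notMem_tsupport hx
  have hDc : Continuous fun x => fderiv ℝ η x z :=
    (hη.continuous_fderiv (by simp)).clm_apply continuous_const
  have hDs : HasCompactSupport fun x => fderiv ℝ η x z :=
    (hηc.fderiv (𝕜 := ℝ)).comp_left (g := fun L : 𝔼 →L[ℝ] ℝ => L z) rfl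
  obtain ⟨C', hC'⟩ := hDc.bounded_above_of_compact_support hDs
  have hD0 : ∀ x ∉ tsupport (fun x => fderiv ℝ η x z), fderiv ℝ η x z = 0 :=
    fun x hx => image_eq_zero_of_notMem_tsupport (f := fun x => fderiv ℝ η x z) hx
  -- along almost every segment that meets the support of `η`, the function `G` is integrable
  have hseg : ∀ᵐ x, η x ≠ 0 → Integrable (fun t : ℝ => G (x - t • z)) unitMeasure := by
    filter_upwards [(integrable_smul_comp_shear hG z hη.continuous.aestronglyMeasurable hC hηc
      hη0).prod_left_ae] with x hx hx0
    exact (integrable_smul_iff hx0 _).1 hx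
  have hGz (i : Fin d) : LocallyIntegrable fun x => matAct d (G x) z i := by
    have : LocallyIntegrable fun x => matAct d (G x) z := fun x => by
      obtain ⟨s, hs, h'⟩ := hG x
      exact ⟨s, hs, ((matAct d).flip z).integrable_comp h'⟩
    exact this.eval_piLp i
  have i1 : Integrable fun x => η x • (u x - u (x - z)) :=
    (hu.sub hus).integrable_smul_left_of_hasCompactSupport hη.continuous hηc
  have i2 : Integrable fun x => η x • matAct d (segmentMean G z x) z :=
    hr.integrable_smul_left_of_hasCompactSupport hη.continuous hηc
  ext i
  have e1 : (∫ x, η x • (u x - u (x - z))) i = ∫ x, η x * (u x i - u (x - z) i) :=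
    eval_integral_piLp (fun i => i1.eval_piLp i) i
  have e2 : (∫ x, η x • matAct d (segmentMean G z x) z) i =
      ∫ x, η x * matAct d (segmentMean G z x) z i :=
    eval_integral_piLp (fun i => i2.eval_piLp i) i
  rw [e1, e2]
  have j1 : Integrable fun x => η x * u x i :=
    (hu.eval_piLp i).integrable_smul_left_of_hasCompactSupport hη.continuous hηc
  have j2 : Integrable fun x => η x * u (x - z) i :=
    (hus.eval_piLp i).integrable_smul_left_of_hasCompactSupport hη.continuous hηc
  have j3 : Integrable fun x => η (x + z) * u x i := by
    simpa using j2.comp_add_right z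
  have s1 : Integrable (fun q : ℝ × 𝔼 => fderiv ℝ η (q.2 + q.1 • z) z * u q.2 i)
      (unitMeasure.prod volume) := by
    have := (measurePreserving_shear unitMeasure (-z)).integrable_comp_of_integrable
      (integrable_smul_comp_shear (hu.eval_piLp i) z hDc.aestronglyMeasurable hC' hDs hD0)
    simpa [Function.comp_def] using this
  have s2 : Integrable (fun q : ℝ × 𝔼 => η q.2 * matAct d (G (q.2 - q.1 • z)) z i)
      (unitMeasure.prod volume) :=
    integrable_smul_comp_shear (hGz i) z hη.continuous.aestronglyMeasurable hC hηc hη0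
  have hηt (t : ℝ) : ∫ x, fderiv ℝ η (x + t • z) z * u x i =
      -∫ x, η x * matAct d (G (x - t • z)) z i := by
    have h1 := h.integral_eval_mul_fderiv i (η := fun x => η (x + t • z))
      (hη.comp (contDiff_id.add contDiff_const))
      (hηc.comp_homeomorph (Homeomorph.addRight (t • z))) z
    simp only [fderiv_comp_add_right] at h1
    simp only [mul_comm (fderiv ℝ η _ z), h1]
    rw [← integral_sub_right_eq_self _ (t • z)]
    simp [mul_comm]
  calc ∫ x, η x * (u x i - u (x - z) i)
      = (∫ x, η x * u x i) - ∫ x, η (x + z) * u x i := by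
        simp only [mul_sub]
        rw [integral_sub j1 j2]
        congr 1
        rw [← integral_add_right_eq_self _ z]
        simp
    _ = -∫ x, ∫ t, fderiv ℝ η (x + t • z) z * u x i ∂unitMeasure := by
        rw [← integral_sub j1 j3, ← integral_neg]
        congr 1 with x
        rw [integral_mul_const, ← sub_comp_add_eq_integral hη]
        ring
    _ = -∫ t, ∫ x, fderiv ℝ η (x + t • z) z * u x i ∂volume ∂unitMeasure := by
        rw [integral_integral_swap (f := fun (t : ℝ) x => fderiv ℝ η (x + t • z) z * u x i) s1]
    _ = ∫ t, ∫ x, η x * matAct d (G (x - t • z)) z i ∂volume ∂unitMeasure := by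
        simp only [hηt, integral_neg, neg_neg]
    _ = ∫ x, ∫ t, η x * matAct d (G (x - t • z)) z i ∂unitMeasure :=
        integral_integral_swap (f := fun (t : ℝ) x => η x * matAct d (G (x - t • z)) z i) s2
    _ = ∫ x, η x * matAct d (segmentMean G z x) z i := by
        refine integral_congr_ae ?_
        filter_upwards [hseg] with x hx
        rw [integral_const_mul]
        rcases eq_or_ne (η x) 0 with h0 | h0
        · simp [h0]
        · rw [matAct_segmentMean_apply (hx h0)]

/-- A weakly divergence-free vector field has a trace-free weak gradient. -/
theorem IsWeakGradient.ae_trace_eq_zero {u : 𝔼 → 𝔼} {G : 𝔼 → 𝔾} (h : IsWeakGradient u G)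
    (hu : IsWeaklyDivergenceFree u) : ∀ᵐ x, ∑ i, G x (i, i) = 0 := by
  have hG (i : Fin d) := h.2.1.eval_piLp (i, i)
  have hl : LocallyIntegrable fun x => ∑ i, G x (i, i) :=
    locallyIntegrable_finsetSum _ fun i _ => hG i
  refine ae_eq_zero_of_integral_contDiff_smul_eq_zero hl fun η hη hηc => ?_
  have hint1 (i : Fin d) :
      Integrable (fun x => u x i * fderiv ℝ η x (EuclideanSpace.single i 1)) := by
    have hc : Continuous fun x => fderiv ℝ η x (EuclideanSpace.single i 1) :=
      (hη.continuous_fderiv (by simp)).clm_apply continuous_const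
    have hs : HasCompactSupport fun x => fderiv ℝ η x (EuclideanSpace.single i 1) :=
      (hηc.fderiv (𝕜 := ℝ)).comp_left (g := fun L : 𝔼 →L[ℝ] ℝ => L (EuclideanSpace.single i 1)) rfl
    exact (h.1.eval_piLp i).integrable_smul_right_of_hasCompactSupport hc hs
  have hint2 (i : Fin d) : Integrable (fun x => G x (i, i) * η x) :=
    (hG i).integrable_smul_right_of_hasCompactSupport hη.continuous hηc
  calc ∫ x, η x • ∑ i, G x (i, i) = ∫ x, ∑ i, G x (i, i) * η x := by
        congr 1 with x
        rw [smul_eq_mul, mul_comm, Finset.sum_mul]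
    _ = -∑ i, ∫ x, u x i * fderiv ℝ η x (EuclideanSpace.single i 1) := by
        rw [integral_finsetSum _ fun i _ => hint2 i, ← Finset.sum_neg_distrib]
        exact Finset.sum_congr rfl fun i _ => by rw [h.2.2 i i η hη hηc, neg_neg]
    _ = -∫ x, fderiv ℝ η x (u x) := by
        rw [← integral_finsetSum _ fun i _ => hint1 i]
        congr 2 with x
        rw [apply_eq_sum_single]
        simp
    _ = 0 := by rw [hu η hη hηc, neg_zero]

theorem HasSegmentGradient.eLpNorm_sub_le {u : 𝔼 → 𝔼} {G : 𝔼 → 𝔾} (h : HasSegmentGradient u G)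
    (hG : AEStronglyMeasurable G) {p : ℝ≥0∞} (hp : 1 ≤ p) (z : 𝔼) :
    eLpNorm (fun x => u x - u (x - z)) p volume ≤ ‖z‖ₑ * eLpNorm G p volume := by
  calc eLpNorm (fun x => u x - u (x - z)) p volume
      = eLpNorm (fun x => matAct d (segmentMean G z x) z) p volume := eLpNorm_congr_ae (h z)
    _ ≤ ‖z‖ₑ * eLpNorm (segmentMean G z) p volume := by
        have := eLpNorm_le_nnreal_smul_eLpNorm_of_ae_le_mul (p := p) (c := ‖z‖₊)
          (f := fun x => matAct d (segmentMean G z x) z) (g := segmentMean G z) (μ := volume)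
          (Filter.Eventually.of_forall fun x => by
            rw [mul_comm]; exact norm_matAct_le (segmentMean G z x) z)
        simpa [ENNReal.smul_def, enorm_eq_nnnorm] using this
    _ ≤ _ := by gcongr; exact eLpNorm_segmentMean_le hG z hp

/-- Convolving with a Schwartz function turns the almost everywhere identity of
`HasSegmentGradient` into one that holds everywhere. -/
theorem HasSegmentGradient.conv_sub_conv {u : 𝔼 → 𝔼} {G : 𝔼 → 𝔾} (h : HasSegmentGradient u G)
    (hu : IsTempered u) (hG : IsTempered G) (k : SchwartzMap 𝔼 ℝ) (z x : 𝔼) :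
    ((k : 𝔼 → ℝ) ⋆[ContinuousLinearMap.lsmul ℝ ℝ, volume] u) x -
      ((k : 𝔼 → ℝ) ⋆[ContinuousLinearMap.lsmul ℝ ℝ, volume] u) (x - z) =
    matAct d (segmentMean ((k : 𝔼 → ℝ) ⋆[ContinuousLinearMap.lsmul ℝ ℝ, volume] G) z x) z := by
  have i1 (x : 𝔼) : Integrable fun y => k y • u (x - y) :=
    hu.integrable_conv (ContinuousLinearMap.lsmul ℝ ℝ) k x
  have i2 : Integrable fun y => k y • segmentMean G z (x - y) :=
    hG.convolutionExists_segmentMean k z x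
  rw [← hG.conv_segmentMean k z x]
  simp only [convolution_def, ContinuousLinearMap.lsmul_apply]
  rw [← integral_sub (i1 x) (i1 (x - z))]
  have e : matAct d (∫ y, k y • segmentMean G z (x - y)) z =
      ∫ y, matAct d (k y • segmentMean G z (x - y)) z :=
    (((matAct d).flip z).integral_comp_comm i2).symm
  rw [e]
  refine integral_congr_ae ?_
  have hq := (Measure.measurePreserving_sub_left volume x).quasiMeasurePreserving.ae (h z)
  filter_upwards [hq] with y hy
  rw [map_smul, smul_apply, ← hy, smul_sub, sub_right_comm]

theorem HasSegmentGradient.conv {u : 𝔼 → 𝔼} {G : 𝔼 → 𝔾} (h : HasSegmentGradient u G)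
    (hu : IsTempered u) (hG : IsTempered G) (k : SchwartzMap 𝔼 ℝ) :
    HasSegmentGradient ((k : 𝔼 → ℝ) ⋆[ContinuousLinearMap.lsmul ℝ ℝ, volume] u)
      ((k : 𝔼 → ℝ) ⋆[ContinuousLinearMap.lsmul ℝ ℝ, volume] G) :=
  fun z => Filter.Eventually.of_forall fun x => h.conv_sub_conv hu hG k z x

end FiniteDifference

/-! ### Growth of vector fields with a tempered gradient -/

section Growth

variable {d : ℕ}

local notation "𝔼" => EuclideanSpace ℝ (Fin d)
local notation "𝔾" => EuclideanSpace ℝ (Fin d × Fin d)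

/-- The integral of `|u|` over the ball of radius one around `-z` grows at most polynomially
in `z`. -/
theorem HasSegmentGradient.setLIntegral_le {u : 𝔼 → 𝔼} {G : 𝔼 → 𝔾} (h : HasSegmentGradient u G)
    (hu : AEStronglyMeasurable u) (hG : AEStronglyMeasurable G) (m : ℕ) (z : 𝔼) :
    ∫⁻ x in Metric.closedBall 0 1, ‖u (x - z)‖ₑ ≤
      (∫⁻ x in Metric.closedBall 0 1, ‖u x‖ₑ) +
        ‖z‖ₑ * (ENNReal.ofReal ((2 + ‖z‖) ^ m) * ∫⁻ y, ‖((1 + ‖y‖) ^ m)⁻¹ • G y‖ₑ) := by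
  set B : Set 𝔼 := Metric.closedBall 0 1
  set ν := volume.restrict B
  have hGm := (hG.comp_shear z unitMeasure).prod_swap.enorm
  have hGν : AEMeasurable (fun q : 𝔼 × ℝ => ‖G (q.1 - q.2 • z)‖ₑ) (ν.prod unitMeasure) :=
    hGm.mono_measure (Measure.prod_mono Measure.restrict_le_self le_rfl)
  have hwG : AEStronglyMeasurable fun y => ((1 + ‖y‖) ^ m)⁻¹ • G y :=
    (continuous_inv_one_add_norm_pow m).aestronglyMeasurable.smul hG
  have h1 : ∀ᵐ x ∂ν, ‖u (x - z)‖ₑ ≤ ‖u x‖ₑ + ‖z‖ₑ * ∫⁻ t, ‖G (x - t • z)‖ₑ ∂unitMeasure := by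
    filter_upwards [ae_restrict_of_ae (h z)] with x hx
    have e : u (x - z) = u x - matAct d (segmentMean G z x) z := by rw [← hx]; abel
    rw [e]
    refine (enorm_sub_le).trans ?_
    gcongr
    refine (enorm_matAct_le _ _).trans ?_
    rw [mul_comm]
    gcongr
    exact enorm_integral_le_lintegral_enorm _
  calc ∫⁻ x in B, ‖u (x - z)‖ₑ
      ≤ ∫⁻ x, ‖u x‖ₑ + ‖z‖ₑ * ∫⁻ t, ‖G (x - t • z)‖ₑ ∂unitMeasure ∂ν := lintegral_mono_ae h1
    _ = (∫⁻ x in B, ‖u x‖ₑ) + ‖z‖ₑ * ∫⁻ t, ∫⁻ x, ‖G (x - t • z)‖ₑ ∂ν ∂unitMeasure := by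
        rw [lintegral_add_left' hu.enorm.restrict, lintegral_const_mul' _ _ enorm_ne_top,
          lintegral_lintegral_swap hGν]
    _ ≤ (∫⁻ x in B, ‖u x‖ₑ) + ‖z‖ₑ * ∫⁻ _, (ENNReal.ofReal ((2 + ‖z‖) ^ m) *
          ∫⁻ y, ‖((1 + ‖y‖) ^ m)⁻¹ • G y‖ₑ) ∂unitMeasure := by
        gcongr 2
        refine lintegral_mono_ae ?_
        filter_upwards [ae_restrict_mem measurableSet_Ioc] with t ht
        calc ∫⁻ x, ‖G (x - t • z)‖ₑ ∂ν
            ≤ ∫⁻ x, ENNReal.ofReal ((2 + ‖z‖) ^ m) *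
                ‖((1 + ‖x - t • z‖) ^ m)⁻¹ • G (x - t • z)‖ₑ ∂ν := by
              refine lintegral_mono_ae ?_
              filter_upwards [ae_restrict_mem Metric.isClosed_closedBall.measurableSet] with x hx
              have hx1 : ‖x‖ ≤ 1 := by simpa [B] using hx
              have hxt : 1 + ‖x - t • z‖ ≤ 2 + ‖z‖ := by
                have h2 := norm_sub_le x (t • z)
                have h3 : ‖t • z‖ ≤ ‖z‖ := by
                  rw [norm_smul, Real.norm_of_nonneg ht.1.le]
                  exact mul_le_of_le_one_left (norm_nonneg _) ht.2
                linarith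
              simp only [← ofReal_norm]
              rw [← ENNReal.ofReal_mul (by positivity)]
              refine ENNReal.ofReal_le_ofReal ?_
              rw [norm_smul, norm_inv, norm_pow,
                Real.norm_of_nonneg (show (0 : ℝ) ≤ 1 + ‖x - t • z‖ by positivity), ← mul_assoc]
              refine le_mul_of_one_le_left (norm_nonneg _) ?_
              rw [← div_eq_mul_inv, one_le_div (by positivity)]
              gcongr
          _ ≤ ∫⁻ x, ENNReal.ofReal ((2 + ‖z‖) ^ m) *
                ‖((1 + ‖x - t • z‖) ^ m)⁻¹ • G (x - t • z)‖ₑ :=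
              lintegral_mono' Measure.restrict_le_self le_rfl
          _ = _ := by
              rw [lintegral_const_mul' _ _ ENNReal.ofReal_ne_top,
                lintegral_sub_right_eq_self (fun y => ‖((1 + ‖y‖) ^ m)⁻¹ • G y‖ₑ) (t • z)]
    _ = _ := by simp [ν]

/-- A locally integrable function with a tempered gradient is tempered: by Fubini's theorem,
`z ↦ u(x - z)` is integrable against a negative power of `1 + ‖z‖` for almost all `x` in the unit
ball, and one such `x` suffices. -/
theorem HasSegmentGradient.isTempered {u : 𝔼 → 𝔼} {G : 𝔼 → 𝔾} (h : HasSegmentGradient u G)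
    (hu : LocallyIntegrable u) (hG : IsTempered G) : IsTempered u := by
  have hGm := hG.aestronglyMeasurable
  have hum := hu.aestronglyMeasurable
  obtain ⟨m, hm⟩ := hG
  set B : Set 𝔼 := Metric.closedBall 0 1 with hB
  set N := Module.finrank ℝ 𝔼 + 1
  set M := m + 1 + N with hM
  set A := ∫⁻ x in B, ‖u x‖ₑ with hA
  set I := ∫⁻ y, ‖((1 + ‖y‖) ^ m)⁻¹ • G y‖ₑ with hI
  have hAt : A < ⊤ := (hu.integrableOn_isCompact (isCompact_closedBall 0 1)).2
  have hIt : I < ⊤ := hm.2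
  have hw (M : ℕ) : Continuous fun z : 𝔼 => ((1 + ‖z‖) ^ M)⁻¹ := continuous_inv_one_add_norm_pow M
  have hw0 (M : ℕ) (z : 𝔼) : (0 : ℝ) ≤ ((1 + ‖z‖) ^ M)⁻¹ := by positivity
  have h1 : ∫⁻ z, ∫⁻ x in B, ENNReal.ofReal ((1 + ‖z‖) ^ M)⁻¹ * ‖u (x - z)‖ₑ < ⊤ := by
    calc ∫⁻ z, ∫⁻ x in B, ENNReal.ofReal ((1 + ‖z‖) ^ M)⁻¹ * ‖u (x - z)‖ₑ
        ≤ ∫⁻ z, ENNReal.ofReal ((1 + ‖z‖) ^ N)⁻¹ * (A + ENNReal.ofReal (2 ^ m) * I) := by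
          refine lintegral_mono fun z => ?_
          rw [lintegral_const_mul' _ _ ENNReal.ofReal_ne_top]
          refine (mul_le_mul_right (h.setLIntegral_le hum hGm m z) _).trans ?_
          rw [mul_add, mul_add]
          have hz : (1 : ℝ) ≤ 1 + ‖z‖ := by linarith [norm_nonneg z]
          refine add_le_add ?_ ?_
          · gcongr
            omega
          · rw [← mul_assoc ‖z‖ₑ, ← mul_assoc, ← mul_assoc, ← mul_assoc, hI]
            refine mul_le_mul_left ?_ I
            rw [← ofReal_norm, mul_assoc, ← ENNReal.ofReal_mul (norm_nonneg _),
              ← ENNReal.ofReal_mul (by positivity), ← ENNReal.ofReal_mul (by positivity)]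
            refine ENNReal.ofReal_le_ofReal ?_
            have h2 : ‖z‖ * (2 + ‖z‖) ^ m ≤ (1 + ‖z‖) ^ (m + 1) * 2 ^ m := by
              rw [pow_succ, mul_right_comm, ← mul_pow, mul_comm]
              gcongr
              · linarith
              · linarith
            calc ((1 + ‖z‖) ^ M)⁻¹ * (‖z‖ * (2 + ‖z‖) ^ m)
                ≤ ((1 + ‖z‖) ^ M)⁻¹ * ((1 + ‖z‖) ^ (m + 1) * 2 ^ m) := by gcongr
              _ = ((1 + ‖z‖) ^ N)⁻¹ * 2 ^ m := by
                  rw [hM, pow_add _ (m + 1) N]; field_simp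
      _ < ⊤ := by
          rw [lintegral_mul_const _ (hw N).measurable.ennreal_ofReal]
          refine ENNReal.mul_lt_top ?_ ?_
          · have := (integrable_inv_one_add_norm_pow (E := 𝔼)).lintegral_lt_top
            exact this
          · exact ENNReal.add_lt_top.2 ⟨hAt, ENNReal.mul_lt_top ENNReal.ofReal_lt_top hIt⟩
  have hmeas : AEMeasurable (fun q : 𝔼 × 𝔼 => ENNReal.ofReal ((1 + ‖q.1‖) ^ M)⁻¹ *
      ‖u (q.2 - q.1)‖ₑ) (volume.prod (volume.restrict B)) := by
    have : AEStronglyMeasurable (fun q : 𝔼 × 𝔼 => u (q.1 - q.2)) (volume.prod volume) :=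
      hum.comp_quasiMeasurePreserving (quasiMeasurePreserving_sub_of_right_invariant _ _)
    refine AEMeasurable.mono_measure ?_ (Measure.prod_mono le_rfl Measure.restrict_le_self)
    exact ((hw M).measurable.ennreal_ofReal.comp measurable_fst).aemeasurable.mul
      this.prod_swap.enorm
  rw [lintegral_lintegral_swap hmeas] at h1
  have h2 := ae_lt_top' hmeas.prod_swap.lintegral_prod_right' h1.ne
  have hBpos : (volume.restrict B) ≠ 0 := by
    rw [Ne, Measure.restrict_eq_zero]
    exact (Metric.measure_closedBall_pos volume 0 one_pos).ne'
  have : (ae (volume.restrict B)).NeBot := ae_neBot.2 hBpos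
  obtain ⟨x, hx, hxB⟩ := (h2.and (ae_restrict_mem Metric.isClosed_closedBall.measurableSet)).exists
  have hx1 : ‖x‖ ≤ 1 := by simpa [B] using hxB
  refine ⟨M, (hw M).aestronglyMeasurable.smul hum, ?_⟩
  rw [hasFiniteIntegral_iff_enorm]
  calc ∫⁻ y, ‖((1 + ‖y‖) ^ M)⁻¹ • u y‖ₑ
      = ∫⁻ z, ‖((1 + ‖x - z‖) ^ M)⁻¹ • u (x - z)‖ₑ :=
        (lintegral_sub_left_eq_self (fun y => ‖((1 + ‖y‖) ^ M)⁻¹ • u y‖ₑ) x).symm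
    _ ≤ ∫⁻ z, ENNReal.ofReal (2 ^ M) *
          (ENNReal.ofReal ((1 + ‖z‖) ^ M)⁻¹ * ‖u (x - z)‖ₑ) := by
        refine lintegral_mono fun z => ?_
        rw [enorm_smul, ← mul_assoc, ← ENNReal.ofReal_mul (by positivity), ← ofReal_norm,
          Real.norm_of_nonneg (hw0 M _)]
        gcongr
        rw [← div_eq_mul_inv, inv_le_comm₀ (by positivity) (by positivity), inv_div,
          div_le_iff₀ (by positivity), ← mul_pow]
        gcongr
        have h3 := one_add_norm_le_mul z x
        rw [norm_sub_rev] at h3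
        refine h3.trans ?_
        gcongr
        linarith
    _ < ⊤ := by
        rw [lintegral_const_mul' _ _ ENNReal.ofReal_ne_top]
        exact ENNReal.mul_lt_top ENNReal.ofReal_lt_top hx

theorem SchwartzMap.lintegral_enorm_mul_norm_lt_top {W : Type*} [NormedAddCommGroup W]
    [NormedSpace ℝ W] (k : SchwartzMap 𝔼 W) (j : ℕ) : ∫⁻ z, ‖k z‖ₑ * ‖z‖ₑ ^ j < ⊤ := by
  have := (k.integrable_pow_mul volume j).2
  rw [hasFiniteIntegral_iff_enorm] at this
  simpa [enorm_mul, mul_comm] using this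

theorem HasSegmentGradient.eLpNorm_sub_conv_le {u : 𝔼 → 𝔼} {G : 𝔼 → 𝔾}
    (h : HasSegmentGradient u G) (hu : IsTempered u) (hG : AEStronglyMeasurable G)
    {p : ℝ≥0∞} (hp : 1 ≤ p) (k : SchwartzMap 𝔼 ℝ) (hk : ∫ z, k z = 1) :
    eLpNorm (fun x => u x - ((k : 𝔼 → ℝ) ⋆[ContinuousLinearMap.lsmul ℝ ℝ, volume] u) x) p volume ≤
      (∫⁻ z, ‖k z‖ₑ * ‖z‖ₑ) * eLpNorm G p volume :=
  _root_.eLpNorm_sub_conv_le k.integrable hk hu.aestronglyMeasurable hp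
    (fun x => hu.integrable_conv _ k x) fun z => h.eLpNorm_sub_le hG hp z

/-- The product of `ρ ∈ L^{p'}` and a vector field with gradient in `L^p` is tempered: the vector
field is the sum of a function in `L^p` and a function of polynomial growth. -/
theorem HasSegmentGradient.isTempered_smul {u : 𝔼 → 𝔼} {G : 𝔼 → 𝔾}
    (h : HasSegmentGradient u G) (hu : IsTempered u) {p p' r : ℝ≥0∞} (hp : 1 ≤ p) (hp' : 1 ≤ p')
    (hr : 1 ≤ r) (hpr : p⁻¹ + p'⁻¹ = r⁻¹) (hG : MemLp G p) {ρ : 𝔼 → ℝ} (hρ : MemLp ρ p')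
    (k : SchwartzMap 𝔼 ℝ) (hk : ∫ z, k z = 1) : IsTempered (fun x => ρ x • u x) := by
  set v := (k : 𝔼 → ℝ) ⋆[ContinuousLinearMap.lsmul ℝ ℝ, volume] u with hv
  have hvm : AEStronglyMeasurable v := (hu.conv k).aestronglyMeasurable
  have hw : MemLp (fun x => u x - v x) p := by
    refine ⟨hu.aestronglyMeasurable.sub hvm,
      (h.eLpNorm_sub_conv_le hu hG.1 hp k hk).trans_lt (ENNReal.mul_lt_top ?_ hG.2)⟩
    simpa using k.lintegral_enorm_mul_norm_lt_top 1
  have : ENNReal.HolderTriple p' p r := ⟨by rw [add_comm]; exact hpr⟩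
  have h1 : IsTempered (fun x => ρ x • (u x - v x)) := (hw.smul hρ).isTempered hr
  obtain ⟨C, m, hC, hCm⟩ := hu.exists_norm_conv_le k
  have h2 : IsTempered (fun x => ρ x • v x) := by
    refine (hρ.isTempered hp').mono_growth (hρ.1.smul hvm) (C := C) (n := m) fun x => ?_
    rw [norm_smul, mul_comm]
    gcongr
    exact hCm x
  simpa [smul_sub] using h1.add h2

end Growth

/-! ### The low-pass kernel of a Littlewood-Paley decomposition -/

section LowPass

variable {d : ℕ}

local notation "𝔼" => EuclideanSpace ℝ (Fin d)

/-- `rescale φ δ` as a Schwartz function. -/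
noncomputable def SchwartzMap.dilate (φ : SchwartzMap 𝔼 ℝ) {δ : ℝ} (hδ : 0 < δ) :
    SchwartzMap 𝔼 ℝ :=
  (δ ^ d)⁻¹ • SchwartzMap.compCLMOfContinuousLinearEquiv ℝ
    (ContinuousLinearEquiv.smulLeft (Units.mk0 δ⁻¹ (inv_ne_zero hδ.ne'))) φ

theorem SchwartzMap.coe_dilate (φ : SchwartzMap 𝔼 ℝ) {δ : ℝ} (hδ : 0 < δ) :
    (φ.dilate hδ : 𝔼 → ℝ) = rescale φ δ := by
  funext x
  simp [SchwartzMap.dilate, rescale, Units.smul_def]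

theorem SchwartzMap.dilate_apply (φ : SchwartzMap 𝔼 ℝ) {δ : ℝ} (hδ : 0 < δ) (x : 𝔼) :
    φ.dilate hδ x = (δ ^ d)⁻¹ * φ (δ⁻¹ • x) := congrFun (φ.coe_dilate hδ) x

/-- Scaling of moments. The hypothesis holds when `f` and `g` are the `i`-th derivatives of a
function and of its dilate. -/
theorem lintegral_dilate {W : Type*} [NormedAddCommGroup W] (f : 𝔼 → W) {δ : ℝ} (hδ : 0 < δ)
    (i j : ℕ) (g : 𝔼 → W) (hg : ∀ x, ‖g x‖ₑ = ENNReal.ofReal ((δ ^ d)⁻¹ * (δ⁻¹) ^ i) *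
      ‖f (δ⁻¹ • x)‖ₑ) :
    ∫⁻ x, ‖g x‖ₑ * ‖x‖ₑ ^ j =
      ENNReal.ofReal (δ ^ j * (δ⁻¹) ^ i) * ∫⁻ x, ‖f x‖ₑ * ‖x‖ₑ ^ j := by
  have hδ' : δ⁻¹ ≠ 0 := inv_ne_zero hδ.ne'
  have e : ∀ x : 𝔼, ‖g x‖ₑ * ‖x‖ₑ ^ j = ENNReal.ofReal ((δ ^ d)⁻¹ * (δ⁻¹) ^ i * δ ^ j) *
      (‖f (δ⁻¹ • x)‖ₑ * ‖δ⁻¹ • x‖ₑ ^ j) := by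
    intro x
    have h1 : ‖x‖ₑ ^ j = ENNReal.ofReal (δ ^ j) * ‖δ⁻¹ • x‖ₑ ^ j := by
      rw [enorm_smul, mul_pow, ← mul_assoc, Real.enorm_eq_ofReal (inv_nonneg.2 hδ.le),
        ← ENNReal.ofReal_pow (inv_nonneg.2 hδ.le), ← ENNReal.ofReal_mul (by positivity), ← mul_pow,
        mul_inv_cancel₀ hδ.ne']
      simp
    rw [hg, h1, ENNReal.ofReal_mul (p := _ * _) (by positivity)]
    ring
  simp only [e]
  rw [lintegral_const_mul' _ _ ENNReal.ofReal_ne_top]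
  have h2 := (measurableEmbedding_const_smul₀ (α := 𝔼) hδ').lintegral_map (μ := volume)
    (fun x => ‖f x‖ₑ * ‖x‖ₑ ^ j)
  rw [← h2, Measure.map_addHaar_smul volume hδ', lintegral_smul_measure, smul_eq_mul, ← mul_assoc,
    ← ENNReal.ofReal_mul (by positivity), abs_of_nonneg (by positivity), finrank_euclideanSpace_fin]
  congr 2
  simp only [inv_pow, inv_inv]
  field_simp

theorem SchwartzMap.integral_dilate (φ : SchwartzMap 𝔼 ℝ) {δ : ℝ} (hδ : 0 < δ) :
    ∫ x, φ.dilate hδ x = ∫ x, φ x := by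
  simp only [SchwartzMap.dilate_apply]
  rw [integral_const_mul, Measure.integral_comp_smul_of_nonneg volume φ δ⁻¹
    (hR := (inv_nonneg.2 hδ.le))]
  simp [hδ.ne']

variable {χ : EuclideanSpace ℝ (Fin d) → ℝ}

theorem IsLittlewoodPaleyCutoff.eq_zero_of_le (hχ : IsLittlewoodPaleyCutoff χ) {ξ : 𝔼}
    (hξ : ‖ξ‖ ≤ 1 / 2) : χ ξ = 0 := by
  have hc : Continuous fun t : ℝ => χ (t • ξ) := hχ.smooth.continuous.comp (by fun_prop)
  have h1 : Ioo (0 : ℝ) 1 ⊆ {t | χ (t • ξ) = 0} := by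
    intro t ht
    refine image_eq_zero_of_notMem_tsupport ?_
    rw [hχ.tsupport_eq]
    intro h
    have := h.1
    rw [norm_smul, Real.norm_of_nonneg ht.1.le] at this
    nlinarith [ht.2, ht.1, norm_nonneg ξ]
  have h2 := closure_minimal h1 (isClosed_eq hc continuous_const)
  rw [closure_Ioo zero_ne_one] at h2
  simpa using h2 (right_mem_Icc.2 zero_le_one)

theorem IsLittlewoodPaleyCutoff.eq_zero_of_ge (hχ : IsLittlewoodPaleyCutoff χ) {ξ : 𝔼}
    (hξ : 2 ≤ ‖ξ‖) : χ ξ = 0 := by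
  have hc : Continuous fun t : ℝ => χ (t • ξ) := hχ.smooth.continuous.comp (by fun_prop)
  have h1 : Ioi (1 : ℝ) ⊆ {t | χ (t • ξ) = 0} := by
    intro t ht
    have ht' : 1 < t := ht
    refine image_eq_zero_of_notMem_tsupport ?_
    rw [hχ.tsupport_eq]
    intro h
    have := h.2
    rw [norm_smul, Real.norm_of_nonneg (by linarith)] at this
    nlinarith
  have h2 := closure_minimal h1 (isClosed_eq hc continuous_const)
  rw [closure_Ioi] at h2
  simpa using h2 (self_mem_Ici (a := (1 : ℝ)))

/-- On the ball of radius one only two terms of the dyadic partition of unity survive near the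
unit sphere. -/
theorem IsLittlewoodPaleyCutoff.add_eq_one (hχ : IsLittlewoodPaleyCutoff χ) {ξ : 𝔼}
    (h1 : 1 / 2 ≤ ‖ξ‖) (h2 : ‖ξ‖ ≤ 1) : χ ξ + χ ((2 : ℝ) • ξ) = 1 := by
  have hξ : ξ ≠ 0 := by
    rintro rfl
    norm_num at h1
  have hs := hχ.hasSum_one ξ hξ
  have hs' : HasSum (fun n : ℤ => χ ((2 : ℝ) ^ (-n) • ξ))
      (∑ n ∈ ({0, -1} : Finset ℤ), χ ((2 : ℝ) ^ (-n) • ξ)) := by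
    refine hasSum_sum_of_ne_finset_zero fun n hn => ?_
    simp only [Finset.mem_insert, Finset.mem_singleton, not_or] at hn
    rcases lt_or_ge 0 n with h | h
    · refine hχ.eq_zero_of_le ?_
      rw [norm_smul, Real.norm_of_nonneg (by positivity)]
      have : (2 : ℝ) ^ (-n) ≤ 2 ^ (-1 : ℤ) := zpow_le_zpow_right₀ (by norm_num) (by omega)
      calc (2 : ℝ) ^ (-n) * ‖ξ‖ ≤ 2 ^ (-1 : ℤ) * 1 := by gcongr
        _ = 1 / 2 := by norm_num
    · refine hχ.eq_zero_of_ge ?_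
      rw [norm_smul, Real.norm_of_nonneg (by positivity)]
      have : (2 : ℝ) ^ (2 : ℤ) ≤ 2 ^ (-n) := zpow_le_zpow_right₀ (by norm_num) (by omega)
      calc (2 : ℝ) = 2 ^ (2 : ℤ) * (1 / 2) := by norm_num
        _ ≤ (2 : ℝ) ^ (-n) * ‖ξ‖ := by gcongr
  have := hs'.unique hs
  simpa using this

open Classical in
/-- The symbol of the low-pass filter: the sum of the `χ (2⁻ⁿ ξ)` over `n ≤ 0`, completed by the
value `1` at the origin. -/
noncomputable def lowPassSymbol (χ : 𝔼 → ℝ) (ξ : 𝔼) : ℝ := if ‖ξ‖ < 1 then 1 else χ ξ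

theorem IsLittlewoodPaleyCutoff.lowPassSymbol_eq_add (hχ : IsLittlewoodPaleyCutoff χ) {ξ : 𝔼}
    (hξ : 1 / 2 ≤ ‖ξ‖) : lowPassSymbol χ ξ = χ ξ + χ ((2 : ℝ) • ξ) := by
  rw [lowPassSymbol]
  split_ifs with h
  · exact (hχ.add_eq_one hξ h.le).symm
  · rw [hχ.eq_zero_of_ge (ξ := (2 : ℝ) • ξ) (by rw [norm_smul]; norm_num; linarith), add_zero]

theorem IsLittlewoodPaleyCutoff.lowPassSymbol_sub (hχ : IsLittlewoodPaleyCutoff χ) (ξ : 𝔼) :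
    lowPassSymbol χ ξ - lowPassSymbol χ ((2 : ℝ) • ξ) = χ ξ := by
  have h2 : ‖(2 : ℝ) • ξ‖ = 2 * ‖ξ‖ := by rw [norm_smul]; norm_num
  rcases lt_or_ge ‖ξ‖ (1 / 2) with h | h
  · rw [lowPassSymbol, lowPassSymbol, if_pos (by linarith), if_pos (by linarith),
      hχ.eq_zero_of_le h.le, sub_self]
  · rw [hχ.lowPassSymbol_eq_add h, lowPassSymbol, if_neg (by linarith), add_sub_cancel_right]

theorem IsLittlewoodPaleyCutoff.contDiff_lowPassSymbol (hχ : IsLittlewoodPaleyCutoff χ) :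
    ContDiff ℝ ∞ (lowPassSymbol χ) := by
  refine contDiff_iff_contDiffAt.2 fun ξ => ?_
  rcases lt_or_ge ‖ξ‖ 1 with h | h
  · refine (contDiffAt_const (c := (1 : ℝ))).congr_of_eventuallyEq ?_
    filter_upwards [continuous_norm.continuousAt.eventually_lt continuousAt_const h] with η hη
    rw [lowPassSymbol, if_pos hη]
  · have h1 : ContDiff ℝ ∞ fun ξ => χ ξ + χ ((2 : ℝ) • ξ) :=
      hχ.smooth.add (hχ.smooth.comp (contDiff_const_smul 2))
    refine h1.contDiffAt.congr_of_eventuallyEq ?_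
    have h' : 1 / 2 < ‖ξ‖ := by linarith
    filter_upwards [continuousAt_const.eventually_lt continuous_norm.continuousAt h'] with η hη
    exact hχ.lowPassSymbol_eq_add hη.le

theorem IsLittlewoodPaleyCutoff.lowPassSymbol_eq_zero (hχ : IsLittlewoodPaleyCutoff χ) {ξ : 𝔼}
    (hξ : 2 ≤ ‖ξ‖) : lowPassSymbol χ ξ = 0 := by
  rw [lowPassSymbol, if_neg (by linarith), hχ.eq_zero_of_ge hξ]

theorem IsLittlewoodPaleyCutoff.lowPassSymbol_neg (hχ : IsLittlewoodPaleyCutoff χ) (ξ : 𝔼) :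
    lowPassSymbol χ (-ξ) = lowPassSymbol χ ξ := by
  simp only [lowPassSymbol, norm_neg, hχ.even]

theorem IsLittlewoodPaleyCutoff.hasCompactSupport_lowPassSymbol (hχ : IsLittlewoodPaleyCutoff χ) :
    HasCompactSupport (lowPassSymbol χ) :=
  HasCompactSupport.intro (isCompact_closedBall 0 2) fun ξ hξ => by
    refine hχ.lowPassSymbol_eq_zero ?_
    simp only [Metric.mem_closedBall, dist_zero_right, not_le] at hξ
    exact hξ.le

/-- The complex low-pass symbol at scale `a`, as a Schwartz function. -/
noncomputable def lowPassSchwartz (hχ : IsLittlewoodPaleyCutoff χ) {a : ℝ} (ha : 0 < a) :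
    SchwartzMap 𝔼 ℂ :=
  SchwartzMap.compCLMOfContinuousLinearEquiv ℝ
    (ContinuousLinearEquiv.smulLeft (Units.mk0 a ha.ne'))
    (HasCompactSupport.toSchwartzMap (f := fun ξ => ((lowPassSymbol χ ξ : ℝ) : ℂ))
      (hχ.hasCompactSupport_lowPassSymbol.comp_left Complex.ofReal_zero)
      (Complex.ofRealCLM.contDiff.comp hχ.contDiff_lowPassSymbol))

theorem lowPassSchwartz_apply (hχ : IsLittlewoodPaleyCutoff χ) {a : ℝ} (ha : 0 < a) (ξ : 𝔼) :
    lowPassSchwartz hχ ha ξ = ((lowPassSymbol χ (a • ξ) : ℝ) : ℂ) := by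
  simp only [lowPassSchwartz, SchwartzMap.compCLMOfContinuousLinearEquiv_apply, Function.comp_apply]
  rfl

theorem fourierInv_lowPassSchwartz_im (hχ : IsLittlewoodPaleyCutoff χ) {a : ℝ} (ha : 0 < a)
    (x : 𝔼) : (𝓕⁻ (lowPassSchwartz hχ ha) x).im = 0 := by
  rw [SchwartzMap.fourierInv_coe, ← Complex.conj_eq_iff_im, Real.fourierInv_eq', ← integral_conj,
    ← integral_neg_eq_self]
  refine integral_congr_ae (Filter.Eventually.of_forall fun ξ => ?_)
  simp [lowPassSchwartz_apply, hχ.lowPassSymbol_neg, ← Complex.exp_conj, Complex.conj_ofNat]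

/-- The low-pass kernel `S`, with Fourier transform `lowPassSymbol χ`. -/
noncomputable def lowPassKernel (hχ : IsLittlewoodPaleyCutoff χ) : SchwartzMap 𝔼 ℝ :=
  SchwartzMap.postcompCLM Complex.reCLM (𝓕⁻ (lowPassSchwartz hχ one_pos))

theorem ofReal_rescale_lowPassKernel (hχ : IsLittlewoodPaleyCutoff χ) {a : ℝ} (ha : 0 < a)
    (x : 𝔼) : ((rescale (lowPassKernel hχ) a x : ℝ) : ℂ) = 𝓕⁻ (lowPassSchwartz hχ ha) x := by
  have h1 (y : 𝔼) : ((lowPassKernel hχ y : ℝ) : ℂ) = 𝓕⁻ (lowPassSchwartz hχ one_pos) y := by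
    apply Complex.ext
    · simp [lowPassKernel]
    · simpa using (fourierInv_lowPassSchwartz_im hχ one_pos y).symm
  rw [rescale, Complex.ofReal_mul, h1, SchwartzMap.fourierInv_coe, SchwartzMap.fourierInv_coe,
    Real.fourierInv_eq', Real.fourierInv_eq']
  have h2 := Measure.integral_comp_smul_of_nonneg (volume : Measure 𝔼) (fun ξ =>
    Complex.exp (↑(2 * Real.pi * inner ℝ ξ (a⁻¹ • x)) * Complex.I) • lowPassSchwartz hχ one_pos ξ)
    a (hR := ha.le)
  rw [finrank_euclideanSpace_fin] at h2
  have h3 : ∀ y : ℂ, ((((a ^ d)⁻¹ : ℝ)) : ℂ) * y = (a ^ d)⁻¹ • y := fun y => by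
    rw [Complex.real_smul]
  rw [h3, ← h2]
  congr 1 with ξ
  rw [lowPassSchwartz_apply, lowPassSchwartz_apply, one_smul, inner_smul_left, inner_smul_right]
  congr 5
  simp [ha.ne']

theorem integral_lowPassKernel (hχ : IsLittlewoodPaleyCutoff χ) :
    ∫ x, lowPassKernel hχ x = 1 := by
  have h1 : ∫ x, (𝓕⁻ (lowPassSchwartz hχ one_pos)) x = 1 := by
    have : 𝓕 (𝓕⁻ (lowPassSchwartz hχ one_pos)) 0 = 1 := by
      rw [FourierTransform.fourier_fourierInv_eq, lowPassSchwartz_apply]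
      simp [lowPassSymbol]
    rw [SchwartzMap.fourier_coe, Real.fourier_eq'] at this
    simpa using this
  have h2 : ∫ x, ((lowPassKernel hχ x : ℝ) : ℂ) = 1 := by
    rw [← h1]
    congr 1 with x
    rw [← ofReal_rescale_lowPassKernel hχ one_pos]
    simp [rescale]
  rw [integral_complex_ofReal] at h2
  exact_mod_cast h2

theorem lpKernel_eq_sub (hχ : IsLittlewoodPaleyCutoff χ) (n : ℤ) (x : 𝔼) :
    lpKernel χ n x = rescale (lowPassKernel hχ) (2 ^ (-n)) x -
      rescale (lowPassKernel hχ) (2 ^ (-(n - 1))) x := by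
  have ha : (0 : ℝ) < 2 ^ (-n) := by positivity
  have hb : (0 : ℝ) < 2 ^ (-(n - 1)) := by positivity
  have h1 : (fun ξ : 𝔼 => ((χ ((2 : ℝ) ^ (-n) • ξ) : ℝ) : ℂ)) =
      (lowPassSchwartz hχ ha - lowPassSchwartz hχ hb : SchwartzMap 𝔼 ℂ) := by
    funext ξ
    rw [sub_apply, lowPassSchwartz_apply, lowPassSchwartz_apply,
      ← hχ.lowPassSymbol_sub, smul_smul, show -(n - 1) = 1 + -n by ring,
      zpow_one_add₀ two_ne_zero]
    push_cast
    rfl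
  have h2 : 𝓕⁻ (lowPassSchwartz hχ ha - lowPassSchwartz hχ hb) =
      𝓕⁻ (lowPassSchwartz hχ ha) - 𝓕⁻ (lowPassSchwartz hχ hb) :=
    map_sub (FourierTransform.fourierInvCLM ℂ (SchwartzMap 𝔼 ℂ)) _ _
  rw [lpKernel, h1, ← SchwartzMap.fourierInv_coe, h2, sub_apply, Complex.sub_re,
    ← ofReal_rescale_lowPassKernel hχ ha,
    ← ofReal_rescale_lowPassKernel hχ hb, Complex.ofReal_re, Complex.ofReal_re]

/-- A low-pass filter at a finer scale `a ≤ b / 4` leaves the low-pass kernel at scale `b`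
unchanged. -/
theorem conv_lowPassKernel (hχ : IsLittlewoodPaleyCutoff χ) {a b : ℝ} (ha : 0 < a) (hb : 0 < b)
    (hab : 4 * a ≤ b) :
    rescale (lowPassKernel hχ) a ⋆[ContinuousLinearMap.lsmul ℝ ℝ, volume]
      rescale (lowPassKernel hχ) b = rescale (lowPassKernel hχ) b := by
  have h1 : SchwartzMap.convolution (ContinuousLinearMap.mul ℂ ℂ) (𝓕⁻ (lowPassSchwartz hχ ha))
      (𝓕⁻ (lowPassSchwartz hχ hb)) = 𝓕⁻ (lowPassSchwartz hχ hb) := by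
    have h2 : SchwartzMap.pairing (ContinuousLinearMap.mul ℂ ℂ) (lowPassSchwartz hχ ha)
        (lowPassSchwartz hχ hb) = lowPassSchwartz hχ hb := by
      ext ξ
      rw [SchwartzMap.pairing_apply_apply, ContinuousLinearMap.mul_apply', lowPassSchwartz_apply,
        lowPassSchwartz_apply]
      rcases le_or_gt 2 ‖b • ξ‖ with h | h
      · rw [hχ.lowPassSymbol_eq_zero h]; simp
      · have : ‖a • ξ‖ < 1 := by
          rw [norm_smul, Real.norm_of_nonneg ha.le]
          rw [norm_smul, Real.norm_of_nonneg hb.le] at h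
          nlinarith [norm_nonneg ξ]
        have h3 : lowPassSymbol χ (a • ξ) = 1 := by rw [lowPassSymbol, if_pos this]
        rw [h3]; simp
    simp [SchwartzMap.convolution, h2]
  funext x
  have h3 := SchwartzMap.convolution_apply (ContinuousLinearMap.mul ℂ ℂ)
    (𝓕⁻ (lowPassSchwartz hχ ha)) (𝓕⁻ (lowPassSchwartz hχ hb)) x
  rw [h1, ← ofReal_rescale_lowPassKernel hχ hb, convolution_def] at h3
  simp only [← ofReal_rescale_lowPassKernel hχ, ContinuousLinearMap.mul_apply',
    ← Complex.ofReal_mul] at h3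
  rw [integral_complex_ofReal] at h3
  exact_mod_cast h3.symm

end LowPass

/-! ### The commutator as a bilinear form -/

section Commutator

variable {d : ℕ}

local notation "𝔼" => EuclideanSpace ℝ (Fin d)
local notation "𝔾" => EuclideanSpace ℝ (Fin d × Fin d)

/-- The integral form of the commutator `u · ∇(k * f) - ∇ · (k * (f u))`: all derivatives fall on
the kernel `k`. -/
noncomputable def commForm (k : 𝔼 → ℝ) (u : 𝔼 → 𝔼) (f : 𝔼 → ℝ) (x : 𝔼) : ℝ :=
  ∫ y, f (x - y) * fderiv ℝ k y (u x - u (x - y))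

/-- The derivative of a Schwartz function, as a Schwartz function. -/
noncomputable abbrev SchwartzMap.grad (k : SchwartzMap 𝔼 ℝ) : SchwartzMap 𝔼 (𝔼 →L[ℝ] ℝ) :=
  SchwartzMap.fderivCLM ℝ 𝔼 ℝ k

theorem SchwartzMap.integrable_grad_apply (k : SchwartzMap 𝔼 ℝ) {w : 𝔼 → 𝔼} (hw : IsTempered w)
    (x : 𝔼) : Integrable fun y => fderiv ℝ k y (w (x - y)) :=
  hw.integrable_conv (ContinuousLinearMap.id ℝ (𝔼 →L[ℝ] ℝ)) k.grad x

theorem IsTempered.smul_const {f : 𝔼 → ℝ} (hf : IsTempered f) (c : 𝔼) :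
    IsTempered fun y => f y • c :=
  hf.mono_growth (hf.aestronglyMeasurable.smul_const c) (C := ‖c‖) (n := 0) fun x => by
    rw [norm_smul, pow_zero, mul_one, mul_comm]

theorem integrable_commForm (k : SchwartzMap 𝔼 ℝ) {u : 𝔼 → 𝔼} {f : 𝔼 → ℝ} (hf : IsTempered f)
    (hfu : IsTempered fun y => f y • u y) (x : 𝔼) :
    Integrable fun y => f (x - y) * fderiv ℝ k y (u x - u (x - y)) := by
  refine ((k.integrable_grad_apply (hf.smul_const (u x)) x).sub
    (k.integrable_grad_apply hfu x)).congr (Filter.Eventually.of_forall fun y => ?_)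
  simp [mul_sub]

theorem commForm_eq_sub (k : SchwartzMap 𝔼 ℝ) {u : 𝔼 → 𝔼} {f : 𝔼 → ℝ} (hf : IsTempered f)
    (hfu : IsTempered fun y => f y • u y) (x : 𝔼) :
    commForm k u f x = (∫ y, fderiv ℝ k y (f (x - y) • u x)) -
      ∫ y, fderiv ℝ k y (f (x - y) • u (x - y)) := by
  rw [← integral_sub (k.integrable_grad_apply (hf.smul_const (u x)) x)
    (k.integrable_grad_apply hfu x), commForm]
  refine integral_congr_ae (Filter.Eventually.of_forall fun y => ?_)
  simp [mul_sub]

theorem fderiv_conv_apply (k : SchwartzMap 𝔼 ℝ) {V : Type*} [NormedAddCommGroup V]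
    [NormedSpace ℝ V] [CompleteSpace V] {f : 𝔼 → V} (hf : IsTempered f)
    {W : Type*} [NormedAddCommGroup W] [NormedSpace ℝ W] [CompleteSpace W]
    (L : (𝔼 →L[ℝ] V) →L[ℝ] W) (x : 𝔼) :
    L (fderiv ℝ ((k : 𝔼 → ℝ) ⋆[ContinuousLinearMap.lsmul ℝ ℝ, volume] f) x) =
      ∫ y, L ((fderiv ℝ k y).smulRight (f (x - y))) := by
  rw [(hf.hasFDerivAt_conv k x).fderiv]
  exact (L.integral_comp_comm
    (hf.integrable_conv (ContinuousLinearMap.smulRightL ℝ 𝔼 V) k.grad x)).symm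

/-- The DiPerna-Lions commutator in integral form. -/
theorem diPernaLionsCommutator_eq (φ : SchwartzMap 𝔼 ℝ) {u : 𝔼 → 𝔼} {ρ : 𝔼 → ℝ}
    (hρ : IsTempered ρ) (hρu : IsTempered fun y => ρ y • u y) {δ : ℝ} (hδ : 0 < δ) (x : 𝔼) :
    diPernaLionsCommutator φ u ρ δ x = commForm (φ.dilate hδ) u ρ x := by
  rw [diPernaLionsCommutator, ← φ.coe_dilate hδ, commForm_eq_sub _ hρ hρu]
  congr 1
  · rw [← ContinuousLinearMap.apply_apply (u x), fderiv_conv_apply _ hρ]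
    congr 1 with y
    simp [mul_comm]
  · rw [divergence]
    have h := fderiv_conv_apply (φ.dilate hδ) hρu (∑ i : Fin d, (EuclideanSpace.proj i).comp
      (ContinuousLinearMap.apply ℝ 𝔼 (EuclideanSpace.single i (1 : ℝ)))) x
    simp only [sum_apply, ContinuousLinearMap.comp_apply,
      ContinuousLinearMap.apply_apply,
      ContinuousLinearMap.smulRight_apply] at h
    refine h.trans ?_
    congr 1 with y
    rw [apply_eq_sum_single (fderiv ℝ (φ.dilate hδ) y)]
    exact Finset.sum_congr rfl fun i _ => by simp; ring

theorem aestronglyMeasurable_comp_sub {V : Type*} [NormedAddCommGroup V] {f : 𝔼 → V}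
    (hf : AEStronglyMeasurable f) :
    AEStronglyMeasurable (fun q : 𝔼 × 𝔼 => f (q.1 - q.2)) (volume.prod volume) :=
  hf.comp_quasiMeasurePreserving (quasiMeasurePreserving_sub_of_right_invariant _ _)

theorem aestronglyMeasurable_commForm (k : SchwartzMap 𝔼 ℝ) {u : 𝔼 → 𝔼} {f : 𝔼 → ℝ}
    (hf : AEStronglyMeasurable f) (hu : AEStronglyMeasurable u) :
    AEStronglyMeasurable (commForm k u f) := by
  refine AEStronglyMeasurable.integral_prod_right'
    (f := fun q : 𝔼 × 𝔼 => f (q.1 - q.2) * fderiv ℝ k q.2 (u q.1 - u (q.1 - q.2))) ?_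
  refine (aestronglyMeasurable_comp_sub hf).mul ?_
  exact (ContinuousLinearMap.id ℝ (𝔼 →L[ℝ] ℝ)).aestronglyMeasurable_comp₂
    k.grad.continuous.aestronglyMeasurable.comp_snd
    (hu.comp_fst.sub (aestronglyMeasurable_comp_sub hu))

theorem commForm_sub_right (k : SchwartzMap 𝔼 ℝ) {u : 𝔼 → 𝔼} {f g : 𝔼 → ℝ} (hf : IsTempered f)
    (hfu : IsTempered fun y => f y • u y) (hg : IsTempered g)
    (hgu : IsTempered fun y => g y • u y) (x : 𝔼) :
    commForm k u (fun y => f y - g y) x = commForm k u f x - commForm k u g x := by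
  rw [commForm, commForm, commForm, ← integral_sub (integrable_commForm k hf hfu x)
    (integrable_commForm k hg hgu x)]
  congr 1 with y
  ring

theorem commForm_sub_left (k : SchwartzMap 𝔼 ℝ) {u v : 𝔼 → 𝔼} {f : 𝔼 → ℝ} (hf : IsTempered f)
    (hfu : IsTempered fun y => f y • u y) (hfv : IsTempered fun y => f y • v y) (x : 𝔼) :
    commForm k (fun y => u y - v y) f x = commForm k u f x - commForm k v f x := by
  rw [commForm, commForm, commForm, ← integral_sub (integrable_commForm k hf hfu x)
    (integrable_commForm k hf hfv x)]
  congr 1 with y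
  rw [sub_sub_sub_comm, map_sub]
  ring

theorem commForm_enorm_le (k : 𝔼 → ℝ) (u : 𝔼 → 𝔼) (f : 𝔼 → ℝ) (x : 𝔼) :
    ‖commForm k u f x‖ₑ ≤ ∫⁻ y, ‖fderiv ℝ k y‖ₑ * (‖f (x - y)‖ₑ * ‖u x - u (x - y)‖ₑ) := by
  refine (enorm_integral_le_lintegral_enorm _).trans (lintegral_mono fun y => ?_)
  rw [enorm_mul, mul_left_comm]
  gcongr
  exact ContinuousLinearMap.le_opENorm _ _

/-- The estimate of the commutator for a vector field in `L^p`, without using any cancellation. -/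
theorem eLpNorm_commForm_le_of_memLp (k : SchwartzMap 𝔼 ℝ) {w : 𝔼 → 𝔼} {f : 𝔼 → ℝ}
    (hf : AEStronglyMeasurable f) (hw : AEStronglyMeasurable w) {p p' r : ℝ≥0∞} (hr : 1 ≤ r)
    (hpr : p⁻¹ + p'⁻¹ = r⁻¹) :
    eLpNorm (commForm k w f) r volume ≤ (∫⁻ y, ‖fderiv ℝ k y‖ₑ) *
      (2 * (eLpNorm w p volume * eLpNorm f p' volume)) := by
  have hk : Measurable fun y => ‖fderiv ℝ k y‖ₑ := k.grad.continuous.enorm.measurable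
  have hm : AEMeasurable (fun q : 𝔼 × 𝔼 => ‖fderiv ℝ k q.2‖ₑ *
      (‖f (q.1 - q.2)‖ₑ * ‖w q.1 - w (q.1 - q.2)‖ₑ)) (volume.prod volume) :=
    (hk.comp measurable_snd).aemeasurable.mul ((aestronglyMeasurable_comp_sub hf).enorm.mul
      (hw.comp_fst.sub (aestronglyMeasurable_comp_sub hw)).enorm)
  calc eLpNorm (commForm k w f) r volume
      ≤ eLpNorm (fun x => ∫⁻ y, ‖fderiv ℝ k y‖ₑ * (‖f (x - y)‖ₑ * ‖w x - w (x - y)‖ₑ)) r volume :=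
        eLpNorm_mono_enorm fun x => by simpa using commForm_enorm_le k w f x
    _ ≤ ∫⁻ y, ‖fderiv ℝ k y‖ₑ * (2 * (eLpNorm w p volume * eLpNorm f p' volume)) := by
        refine eLpNorm_lintegral_le
          (f := fun x y => ‖fderiv ℝ k y‖ₑ * (‖f (x - y)‖ₑ * ‖w x - w (x - y)‖ₑ)) hm
          (hk.mul_const _).aemeasurable hr (Filter.Eventually.of_forall fun y => ?_)
        have hfy := hf.comp_sub_right y
        have hwy := hw.comp_sub_right y
        have h1 : eLpNorm (fun x => ‖f (x - y)‖ₑ * ‖w x‖ₑ + ‖f (x - y)‖ₑ * ‖w (x - y)‖ₑ) r volume ≤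
            2 * (eLpNorm w p volume * eLpNorm f p' volume) := by
          refine (eLpNorm_add_le (f := fun x => ‖f (x - y)‖ₑ * ‖w x‖ₑ)
            (hfy.enorm.mul hw.enorm).aestronglyMeasurable
            (hfy.enorm.mul hwy.enorm).aestronglyMeasurable hr).trans ?_
          rw [two_mul]
          rw [add_comm] at hpr
          refine add_le_add ((eLpNorm_enorm_mul_enorm_le hfy hw hpr).trans (le_of_eq ?_))
            ((eLpNorm_enorm_mul_enorm_le hfy hwy hpr).trans (le_of_eq ?_))
          · rw [eLpNorm_comp_sub_right hf, mul_comm]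
          · rw [eLpNorm_comp_sub_right hf, eLpNorm_comp_sub_right hw, mul_comm]
        refine le_trans ?_ (mul_le_mul_right h1 _)
        refine eLpNorm_le_mul_eLpNorm_of_ae_le_mul' (c := ‖fderiv ℝ k y‖₊)
          (Filter.Eventually.of_forall fun x => ?_) r
        simp only [enorm_eq_self, ← mul_add]
        exact mul_le_mul_right (mul_le_mul_right enorm_sub_le _) _
    _ = _ := lintegral_mul_const'' _ hk.aemeasurable

end Commutator

/-- Minkowski's inequality for an average with weight `A`. -/
theorem eLpNorm_lintegral_mul_le {α β : Type*} [MeasurableSpace α] [MeasurableSpace β]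
    {μ : Measure α} {ν : Measure β} [SFinite μ] [SFinite ν] {A : β → ℝ≥0∞} (hA : Measurable A)
    {H : α → β → ℝ≥0∞} (hH : Measurable (Function.uncurry H)) {r c : ℝ≥0∞} (hr : 1 ≤ r)
    (h : ∀ y, eLpNorm (fun x => H x y) r μ ≤ c) :
    eLpNorm (fun x => ∫⁻ y, A y * H x y ∂ν) r μ ≤ (∫⁻ y, A y ∂ν) * c := by
  rw [← lintegral_mul_const _ hA]
  refine eLpNorm_lintegral_le ((hA.comp measurable_snd).mul hH).aemeasurable
    (hA.mul_const _).aemeasurable hr (Filter.Eventually.of_forall fun y => ?_)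
  refine le_trans ?_ (mul_le_mul_right (h y) (A y))
  exact eLpNorm_le_mul_eLpNorm_of_ae_le_mul'' r
    (hH.comp measurable_prodMk_right).aestronglyMeasurable
    (Filter.Eventually.of_forall fun x => by simp)

section Estimates

variable {d : ℕ}

local notation "𝔼" => EuclideanSpace ℝ (Fin d)
local notation "𝔾" => EuclideanSpace ℝ (Fin d × Fin d)

/-! ### The commutator with a high-frequency density -/

theorem IsTempered.comp_sub_right {V : Type*} [NormedAddCommGroup V] [NormedSpace ℝ V]
    {f : 𝔼 → V} (hf : IsTempered f) (z : 𝔼) : IsTempered fun x => f (x - z) := by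
  have hfm := hf.aestronglyMeasurable
  obtain ⟨m, hm⟩ := hf
  refine ⟨m, ((hm.comp_sub_right z).norm.const_mul ((1 + ‖z‖) ^ m)).mono'
    ((continuous_inv_one_add_norm_pow m).aestronglyMeasurable.smul (hfm.comp_sub_right z))
    (Filter.Eventually.of_forall fun y => ?_)⟩
  rw [norm_smul, norm_smul, norm_inv, norm_inv, norm_pow, norm_pow,
    Real.norm_of_nonneg (show (0 : ℝ) ≤ 1 + ‖y‖ by positivity),
    Real.norm_of_nonneg (show (0 : ℝ) ≤ 1 + ‖y - z‖ by positivity), ← mul_assoc]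
  gcongr
  rw [← div_eq_mul_inv, inv_le_comm₀ (by positivity) (by positivity), inv_div,
    div_le_iff₀ (by positivity), ← mul_pow]
  gcongr
  have := one_add_norm_le_mul (y - z) (-z)
  simpa [sub_neg_eq_add] using this

/-- The differentiability along lines of a vector field with a continuous segment gradient. -/
theorem hasDerivAt_of_segmentMean {v : 𝔼 → 𝔼} {g : 𝔼 → 𝔾} (hg : Continuous g)
    (hv : ∀ z x, v x - v (x - z) = matAct d (segmentMean g z x) z) (a z : 𝔼) (s : ℝ) :
    HasDerivAt (fun s : ℝ => v (a + s • z)) (matAct d (g (a + s • z)) z) s := by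
  have hgc : Continuous fun τ : ℝ => g (a + τ • z) := by fun_prop
  have e : (fun s : ℝ => v (a + s • z)) =
      fun s : ℝ => v a + matAct d (∫ τ in (0 : ℝ)..s, g (a + τ • z)) z := by
    funext s
    have h1 := hv (-(s • z)) a
    have h2 : s • segmentMean g (-(s • z)) a = ∫ τ in (0 : ℝ)..s, g (a + τ • z) := by
      have h3 := intervalIntegral.smul_integral_comp_mul_left (a := 0) (b := 1)
        (fun τ : ℝ => g (a + τ • z)) s
      rw [mul_zero, mul_one] at h3
      rw [← h3, intervalIntegral.integral_of_le zero_le_one, segmentMean]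
      congr 2 with t
      rw [smul_neg, sub_neg_eq_add, smul_smul, mul_comm]
    rw [sub_neg_eq_add, map_neg, map_smul] at h1
    rw [← h2, map_smul, smul_apply, ← sub_eq_iff_eq_add', ← neg_sub, h1, neg_neg]
  rw [e]
  exact (((matAct d).flip z).hasFDerivAt.comp_hasDerivAt s
    (hgc.integral_hasStrictDerivAt 0 s).hasDerivAt).const_add _

theorem measurable_segmentMean {g : 𝔼 → 𝔾} (hg : Continuous g) :
    Measurable fun q : 𝔼 × 𝔼 => segmentMean g q.2 q.1 := by
  have h : StronglyMeasurable fun q : (𝔼 × 𝔼) × ℝ => g (q.1.1 - q.2 • q.1.2) :=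
    (hg.comp (by fun_prop)).stronglyMeasurable
  exact h.integral_prod_right'.measurable

theorem enorm_sub_le_of_segmentMean {v : 𝔼 → 𝔼} {g : 𝔼 → 𝔾}
    (hv : ∀ z x, v x - v (x - z) = matAct d (segmentMean g z x) z) (x y : 𝔼) :
    ‖v x - v (x - y)‖ₑ ≤ ‖y‖ₑ * ‖segmentMean g y x‖ₑ := by
  rw [hv, mul_comm]
  exact enorm_matAct_le _ _

/-- A majorant for the derivative in `y` of `fderiv k y (v x - v (x - y))`. -/
noncomputable def commKernelBound (k : 𝔼 → ℝ) (g : 𝔼 → 𝔾) (x y : 𝔼) : ℝ≥0∞ :=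
  ‖fderiv ℝ (fderiv ℝ k) y‖ₑ * ‖y‖ₑ * ‖segmentMean g y x‖ₑ + ‖fderiv ℝ k y‖ₑ * ‖g (x - y)‖ₑ

theorem SchwartzMap.continuous_fderiv_fderiv (k : SchwartzMap 𝔼 ℝ) :
    Continuous (fderiv ℝ (fderiv ℝ k)) :=
  (SchwartzMap.fderivCLM ℝ 𝔼 (𝔼 →L[ℝ] ℝ) k.grad).continuous

theorem SchwartzMap.measurable_enorm_fderiv_fderiv (k : SchwartzMap 𝔼 ℝ) :
    Measurable fun y : 𝔼 => ‖fderiv ℝ (fderiv ℝ k) y‖ₑ :=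
  (ENNReal.continuous_coe.comp k.continuous_fderiv_fderiv.nnnorm).measurable

theorem measurable_commKernelBound (k : SchwartzMap 𝔼 ℝ) {g : 𝔼 → 𝔾} (hg : Continuous g) :
    Measurable fun q : 𝔼 × 𝔼 => commKernelBound k g q.1 q.2 := by
  have h1 : Measurable fun y : 𝔼 => ‖fderiv ℝ (fderiv ℝ k) y‖ₑ * ‖y‖ₑ :=
    k.measurable_enorm_fderiv_fderiv.mul measurable_enorm
  have h2 : Measurable fun y : 𝔼 => ‖fderiv ℝ k y‖ₑ := k.grad.continuous.enorm.measurable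
  have h3 : Measurable fun q : 𝔼 × 𝔼 => ‖g (q.1 - q.2)‖ₑ :=
    (hg.comp (by fun_prop)).enorm.measurable
  exact ((h1.comp measurable_snd).mul (measurable_segmentMean hg).enorm).add
    ((h2.comp measurable_snd).mul h3)

/-- The fundamental theorem of calculus for the kernel `fderiv k y (v x - v (x - y))` of the
commutator, along the segment from `y` to `y - z`. -/
theorem enorm_commKernel_sub_le (k : SchwartzMap 𝔼 ℝ) {v : 𝔼 → 𝔼} {g : 𝔼 → 𝔾}
    (hg : Continuous g) (hv : ∀ z x, v x - v (x - z) = matAct d (segmentMean g z x) z)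
    (x y z : 𝔼) :
    ‖fderiv ℝ k y (v x - v (x - y)) - fderiv ℝ k (y - z) (v x - v (x - (y - z)))‖ₑ ≤
      ∫⁻ s : ℝ, ‖z‖ₑ * commKernelBound k g x (y - s • z) ∂unitMeasure := by
  set F : ℝ → ℝ := fun s => fderiv ℝ k (y - s • z) (v x - v (x - (y - s • z))) with hF
  set F' : ℝ → ℝ := fun s =>
    fderiv ℝ (fderiv ℝ k) (y - s • z) (-z) (v x - v (x - (y - s • z))) +
      fderiv ℝ k (y - s • z) (-matAct d (g (x - (y - s • z))) z) with hF'
  have e (s : ℝ) : x - (y - s • z) = (x - y) + s • z := by abel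
  have hvc : Continuous fun s : ℝ => v (x - (y - s • z)) := by
    simp only [e]
    exact continuous_iff_continuousAt.2 fun s =>
      (hasDerivAt_of_segmentMean hg hv (x - y) z s).continuousAt
  have hder : ∀ s ∈ uIcc (0 : ℝ) 1, HasDerivAt F (F' s) s := by
    intro s _
    have h1 : HasDerivAt (fun s : ℝ => y - s • z) (-z) s := by
      simpa using ((hasDerivAt_id s).smul_const z).const_sub y
    have h2 : HasDerivAt (fun s : ℝ => fderiv ℝ k (y - s • z))
        (fderiv ℝ (fderiv ℝ k) (y - s • z) (-z)) s :=
      (k.grad.differentiable (y - s • z)).hasFDerivAt.comp_hasDerivAt s h1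
    have h3 : HasDerivAt (fun s : ℝ => v x - v (x - (y - s • z)))
        (-matAct d (g (x - (y - s • z))) z) s := by
      simp only [e]
      exact (hasDerivAt_of_segmentMean hg hv (x - y) z s).const_sub _
    exact h2.clm_apply h3
  have hc : Continuous F' := by
    have c1 : Continuous fun s : ℝ => fderiv ℝ (fderiv ℝ k) (y - s • z) (-z) :=
      (k.continuous_fderiv_fderiv.comp (by fun_prop)).clm_apply continuous_const
    have c2 : Continuous fun s : ℝ => fderiv ℝ k (y - s • z) :=
      k.grad.continuous.comp (by fun_prop)
    have c3 : Continuous fun s : ℝ => matAct d (g (x - (y - s • z))) z :=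
      ((matAct d).continuous.comp (hg.comp (by fun_prop))).clm_apply continuous_const
    exact (c1.clm_apply (continuous_const.sub hvc)).add (c2.clm_apply c3.neg)
  have hint := intervalIntegral.integral_eq_sub_of_hasDerivAt hder (hc.intervalIntegrable _ _)
  rw [intervalIntegral.integral_of_le zero_le_one] at hint
  have h01 : fderiv ℝ k y (v x - v (x - y)) - fderiv ℝ k (y - z) (v x - v (x - (y - z))) =
      -(F 1 - F 0) := by simp [hF]
  rw [h01, enorm_neg, ← hint]
  refine (enorm_integral_le_lintegral_enorm _).trans (lintegral_mono fun s => ?_)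
  simp only [hF', commKernelBound, mul_add]
  refine (enorm_add_le _ _).trans (add_le_add ?_ ?_)
  · refine (ContinuousLinearMap.le_opENorm _ _).trans ?_
    calc ‖fderiv ℝ (fderiv ℝ k) (y - s • z) (-z)‖ₑ * ‖v x - v (x - (y - s • z))‖ₑ
        ≤ (‖fderiv ℝ (fderiv ℝ k) (y - s • z)‖ₑ * ‖z‖ₑ) *
            (‖y - s • z‖ₑ * ‖segmentMean g (y - s • z) x‖ₑ) := by
          gcongr
          · simpa using ContinuousLinearMap.le_opENorm (fderiv ℝ (fderiv ℝ k) (y - s • z)) (-z)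
          · exact enorm_sub_le_of_segmentMean hv _ _
      _ = _ := by ring
  · refine (ContinuousLinearMap.le_opENorm _ _).trans ?_
    rw [enorm_neg, mul_left_comm, mul_comm ‖z‖ₑ]
    gcongr
    exact enorm_matAct_le _ _

/-- The derivative of the kernel of the commutator, integrated against a translate of `f`. -/
theorem eLpNorm_lintegral_commKernelBound_le (k : SchwartzMap 𝔼 ℝ) {g : 𝔼 → 𝔾}
    (hg : Continuous g) {f : 𝔼 → ℝ} (hf : Measurable f) {p p' r : ℝ≥0∞} (hp : 1 ≤ p)
    (hr : 1 ≤ r) (hpr : p⁻¹ + p'⁻¹ = r⁻¹) (w : 𝔼) :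
    eLpNorm (fun x => ∫⁻ y, ‖f (x - y - w)‖ₑ * commKernelBound k g x y) r volume ≤
      ((∫⁻ y, ‖fderiv ℝ k y‖ₑ) + ∫⁻ y, ‖fderiv ℝ (fderiv ℝ k) y‖ₑ * ‖y‖ₑ) *
        (eLpNorm g p volume * eLpNorm f p' volume) := by
  have hfm : AEStronglyMeasurable f := hf.aestronglyMeasurable
  have hgm : AEStronglyMeasurable g := hg.aestronglyMeasurable
  have h1 : Measurable fun y : 𝔼 => ‖fderiv ℝ (fderiv ℝ k) y‖ₑ * ‖y‖ₑ :=
    k.measurable_enorm_fderiv_fderiv.mul measurable_enorm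
  have h2 : Measurable fun y : 𝔼 => ‖fderiv ℝ k y‖ₑ := k.grad.continuous.enorm.measurable
  have h3 : Measurable fun q : 𝔼 × 𝔼 => ‖f (q.1 - q.2 - w)‖ₑ := by fun_prop
  have m1 : Measurable fun q : 𝔼 × 𝔼 => ‖segmentMean g q.2 q.1‖ₑ * ‖f (q.1 - q.2 - w)‖ₑ :=
    (measurable_segmentMean hg).enorm.mul h3
  have m2 : Measurable fun q : 𝔼 × 𝔼 => ‖g (q.1 - q.2)‖ₑ * ‖f (q.1 - q.2 - w)‖ₑ :=
    (hg.comp (by fun_prop)).enorm.measurable.mul h3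
  have m2x (x : 𝔼) : Measurable fun y : 𝔼 => ‖g (x - y)‖ₑ * ‖f (x - y - w)‖ₑ :=
    (hg.comp (by fun_prop)).enorm.measurable.mul (by fun_prop)
  have n1 : Measurable fun q : 𝔼 × 𝔼 => (‖fderiv ℝ (fderiv ℝ k) q.2‖ₑ * ‖q.2‖ₑ) *
      (‖segmentMean g q.2 q.1‖ₑ * ‖f (q.1 - q.2 - w)‖ₑ) := (h1.comp measurable_snd).mul m1
  have n2 : Measurable fun q : 𝔼 × 𝔼 => ‖fderiv ℝ k q.2‖ₑ *
      (‖g (q.1 - q.2)‖ₑ * ‖f (q.1 - q.2 - w)‖ₑ) := (h2.comp measurable_snd).mul m2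
  have hfy (y : 𝔼) : AEStronglyMeasurable fun x => f (x - y - w) :=
    (hfm.comp_sub_right w).comp_sub_right y
  have hfe (y : 𝔼) : eLpNorm (fun x => f (x - y - w)) p' volume = eLpNorm f p' volume := by
    rw [eLpNorm_comp_sub_right (hfm.comp_sub_right w), eLpNorm_comp_sub_right hfm]
  have e : (fun x => ∫⁻ y, ‖f (x - y - w)‖ₑ * commKernelBound k g x y) =
      (fun x => ∫⁻ y, ‖fderiv ℝ k y‖ₑ * (‖g (x - y)‖ₑ * ‖f (x - y - w)‖ₑ)) +
        fun x => ∫⁻ y, (‖fderiv ℝ (fderiv ℝ k) y‖ₑ * ‖y‖ₑ) *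
          (‖segmentMean g y x‖ₑ * ‖f (x - y - w)‖ₑ) := by
    funext x
    rw [Pi.add_apply, ← lintegral_add_left]
    · refine lintegral_congr fun y => ?_
      rw [commKernelBound]
      ring
    · exact h2.mul (m2x x)
  rw [e, add_mul]
  refine (eLpNorm_add_le n2.lintegral_prod_right'.aestronglyMeasurable
    n1.lintegral_prod_right'.aestronglyMeasurable hr).trans (add_le_add ?_ ?_)
  · refine eLpNorm_lintegral_mul_le h2 (H := fun x y => ‖g (x - y)‖ₑ * ‖f (x - y - w)‖ₑ) m2 hr
      fun y => ?_
    refine (eLpNorm_enorm_mul_enorm_le (hgm.comp_sub_right y) (hfy y) hpr).trans (le_of_eq ?_)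
    rw [hfe, eLpNorm_comp_sub_right hgm]
  · refine eLpNorm_lintegral_mul_le h1
      (H := fun x y => ‖segmentMean g y x‖ₑ * ‖f (x - y - w)‖ₑ) m1 hr fun y => ?_
    refine (eLpNorm_enorm_mul_enorm_le (hgm.segmentMean y) (hfy y) hpr).trans ?_
    rw [hfe]
    gcongr
    exact eLpNorm_segmentMean_le hgm y hp

theorem IsTempered.smul_of_growth {v : 𝔼 → 𝔼} {f : 𝔼 → ℝ} (hf : IsTempered f)
    (hv : AEStronglyMeasurable v) {C : ℝ} {m : ℕ} (h : ∀ x, ‖v x‖ ≤ C * (1 + ‖x‖) ^ m) :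
    IsTempered fun x => f x • v x :=
  hf.mono_growth (hf.aestronglyMeasurable.smul hv) (C := C) (n := m) fun x => by
    rw [norm_smul, mul_comm]
    gcongr
    exact h x

/-- The commutator with `f - S * f` is an average of commutators with differences of translates
of `f`. -/
theorem commForm_sub_conv_eq (k S : SchwartzMap 𝔼 ℝ) (hS : ∫ z, S z = 1) {v : 𝔼 → 𝔼}
    (hvc : Continuous v) {C : ℝ} {m : ℕ} (hvm : ∀ x, ‖v x‖ ≤ C * (1 + ‖x‖) ^ m) {f : 𝔼 → ℝ}
    (hf : IsTempered f) (x : 𝔼) :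
    commForm k v (fun y => f y - ((S : 𝔼 → ℝ) ⋆[ContinuousLinearMap.lsmul ℝ ℝ, volume] f) y) x =
      ∫ z, S z * ∫ y, f (x - y) * (fderiv ℝ k y (v x - v (x - y)) -
        fderiv ℝ k (y - z) (v x - v (x - (y - z)))) := by
  have hT {h : 𝔼 → ℝ} (hh : IsTempered h) := hh.smul_of_growth hvc.aestronglyMeasurable hvm
  have hint {h : 𝔼 → ℝ} (hh : IsTempered h) := integrable_commForm k hh (hT hh) x
  obtain ⟨C', m', hC', hS'⟩ := hf.exists_lintegral_le S
  have hFc : Continuous fun y => fderiv ℝ k y (v x - v (x - y)) :=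
    k.grad.continuous.clm_apply (continuous_const.sub (hvc.comp (by fun_prop)))
  -- the integrand of the double integral, for Fubini's theorem
  have hI : Integrable (fun q : 𝔼 × 𝔼 => S q.2 * f (x - q.1 - q.2) *
      fderiv ℝ k q.1 (v x - v (x - q.1))) (volume.prod volume) := by
    have hm : AEStronglyMeasurable (fun q : 𝔼 × 𝔼 => S q.2 * f (x - q.1 - q.2) *
        fderiv ℝ k q.1 (v x - v (x - q.1))) (volume.prod volume) := by
      have h1 : MeasurePreserving (fun q : 𝔼 × 𝔼 => (x - q.1, q.2)) (volume.prod volume)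
        (volume.prod volume) :=
        (Measure.measurePreserving_sub_left volume x).prod (MeasurePreserving.id _)
      exact (S.continuous.aestronglyMeasurable.comp_snd.mul
        ((aestronglyMeasurable_comp_sub hf.aestronglyMeasurable).comp_measurePreserving h1)).mul
        hFc.aestronglyMeasurable.comp_fst
    refine ⟨hm, ?_⟩
    rw [hasFiniteIntegral_iff_enorm, lintegral_prod _ hm.enorm]
    have hpoly : IsTempered fun a : 𝔼 => C' * (1 + ‖a‖) ^ m' :=
      isTempered_of_growth (by fun_prop) (C := C') (n := m') fun a => by
        rw [Real.norm_of_nonneg (by positivity)]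
    refine lt_of_le_of_lt (lintegral_mono fun y => ?_) (hint hpoly).2
    calc ∫⁻ z, ‖S z * f (x - y - z) * fderiv ℝ k y (v x - v (x - y))‖ₑ
        = (∫⁻ z, ‖S z‖ₑ * ‖f (x - y - z)‖ₑ) * ‖fderiv ℝ k y (v x - v (x - y))‖ₑ := by
          simp only [enorm_mul]
          rw [lintegral_mul_const' _ _ enorm_ne_top]
      _ ≤ ENNReal.ofReal (C' * (1 + ‖x - y‖) ^ m') * ‖fderiv ℝ k y (v x - v (x - y))‖ₑ := by
          gcongr
          exact hS' _
      _ = _ := by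
          rw [enorm_mul, Real.enorm_of_nonneg (show 0 ≤ C' * (1 + ‖x - y‖) ^ m' by positivity)]
  have e1 : commForm k v ((S : 𝔼 → ℝ) ⋆[ContinuousLinearMap.lsmul ℝ ℝ, volume] f) x =
      ∫ z, S z * commForm k v (fun a => f (a - z)) x := by
    have h1 := integral_integral_swap (f := fun (y z : 𝔼) => S z * f (x - y - z) *
      fderiv ℝ k y (v x - v (x - y))) hI
    have h2 : commForm k v ((S : 𝔼 → ℝ) ⋆[ContinuousLinearMap.lsmul ℝ ℝ, volume] f) x =
        ∫ y, ∫ z, S z * f (x - y - z) * fderiv ℝ k y (v x - v (x - y)) := by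
      rw [commForm]
      congr 1 with y
      rw [integral_mul_const]
      rfl
    rw [h2, h1]
    congr 1 with z
    rw [commForm, ← integral_const_mul]
    congr 1 with y
    ring
  have hI2 : Integrable fun z => S z * commForm k v (fun a => f (a - z)) x := by
    refine hI.integral_prod_right.congr (Filter.Eventually.of_forall fun z => ?_)
    simp only [commForm]
    rw [← integral_const_mul]
    congr 1 with y
    ring
  rw [commForm_sub_right k hf (hT hf) (hf.conv S) (hT (hf.conv S)), e1]
  have e2 : commForm k v f x = ∫ z, S z * commForm k v f x := by
    rw [integral_mul_const, hS, one_mul]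
  rw [e2, ← integral_sub (S.integrable.mul_const _) hI2]
  congr 1 with z
  rw [← mul_sub]
  congr 1
  have e3 : commForm k v (fun a => f (a - z)) x =
      ∫ y, f (x - y) * fderiv ℝ k (y - z) (v x - v (x - (y - z))) := by
    rw [commForm, ← integral_sub_right_eq_self _ z]
    congr 1 with y
    congr 2
    abel
  have i3 : Integrable fun y => f (x - y) * fderiv ℝ k (y - z) (v x - v (x - (y - z))) := by
    refine ((hint (hf.comp_sub_right z)).comp_sub_right z).congr
      (Filter.Eventually.of_forall fun y => ?_)
    dsimp only
    congr 2
    abel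
  rw [e3, commForm, ← integral_sub (hint hf) i3]
  congr 1 with y
  ring

/-- Fubini's theorem for an average over a segment, followed by a translation. -/
theorem lintegral_mul_lintegral_segment {h K : 𝔼 → ℝ≥0∞} (hh : Measurable h) (hK : Measurable K)
    {c : ℝ≥0∞} (hc : c ≠ ⊤) (z : 𝔼) :
    ∫⁻ y, h y * ∫⁻ s : ℝ, c * K (y - s • z) ∂unitMeasure =
      c * ∫⁻ s : ℝ, (∫⁻ y, h (y + s • z) * K y) ∂unitMeasure := by
  have hm : Measurable fun q : 𝔼 × ℝ => c * (h q.1 * K (q.1 - q.2 • z)) :=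
    ((hh.comp measurable_fst).mul
      (hK.comp (by fun_prop : Measurable fun q : 𝔼 × ℝ => q.1 - q.2 • z))).const_mul c
  have hK1 (y : 𝔼) : Measurable fun s : ℝ => c * K (y - s • z) :=
    (hK.comp (by fun_prop : Measurable fun s : ℝ => y - s • z)).const_mul c
  calc ∫⁻ y, h y * ∫⁻ s : ℝ, c * K (y - s • z) ∂unitMeasure
      = ∫⁻ y, ∫⁻ s : ℝ, c * (h y * K (y - s • z)) ∂unitMeasure := by
        refine lintegral_congr fun y => ?_
        rw [← lintegral_const_mul _ (hK1 y)]
        exact lintegral_congr fun s => mul_left_comm _ _ _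
    _ = ∫⁻ s : ℝ, (∫⁻ y, c * (h y * K (y - s • z))) ∂unitMeasure :=
        lintegral_lintegral_swap hm.aemeasurable
    _ = _ := by
        rw [← lintegral_const_mul' _ _ hc]
        refine lintegral_congr fun s => ?_
        rw [lintegral_const_mul' _ _ hc, ← lintegral_sub_right_eq_self _ (-(s • z))]
        congr 1
        refine lintegral_congr fun y => ?_
        rw [sub_neg_eq_add, add_sub_cancel_right]

/-- Minkowski's inequality for averages of translates along segments. -/
theorem eLpNorm_lintegral_mul_segment_le {A : 𝔼 → ℝ≥0∞} (hA : Measurable A)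
    {Q : 𝔼 → 𝔼 → ℝ≥0∞} (hQ : Measurable (Function.uncurry Q)) {r c : ℝ≥0∞} (hr : 1 ≤ r)
    (h : ∀ w, eLpNorm (fun x => Q x w) r volume ≤ c) :
    eLpNorm (fun x => ∫⁻ z, A z * ∫⁻ s : ℝ, Q x (s • z) ∂unitMeasure) r volume ≤
      (∫⁻ z, A z) * c := by
  have h1 : Measurable fun q : (𝔼 × 𝔼) × ℝ => Q q.1.1 (q.2 • q.1.2) :=
    hQ.comp (by fun_prop : Measurable fun q : (𝔼 × 𝔼) × ℝ => (q.1.1, q.2 • q.1.2))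
  refine eLpNorm_lintegral_mul_le hA (H := fun x z => ∫⁻ s : ℝ, Q x (s • z) ∂unitMeasure)
    h1.lintegral_prod_right' hr fun z => ?_
  have h2 : Measurable fun q : 𝔼 × ℝ => Q q.1 (q.2 • z) :=
    hQ.comp (by fun_prop : Measurable fun q : 𝔼 × ℝ => (q.1, q.2 • z))
  have h3 := eLpNorm_lintegral_mul_le (μ := (volume : Measure 𝔼)) (ν := unitMeasure)
    (A := fun _ => 1) measurable_const (H := fun x s => Q x (s • z)) h2 hr fun s => h (s • z)
  simpa using h3

theorem measurable_lintegral_enorm_mul {f : 𝔼 → ℝ} (hf : Measurable f) {K : 𝔼 → 𝔼 → ℝ≥0∞}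
    (hK : Measurable fun q : 𝔼 × 𝔼 => K q.1 q.2) :
    Measurable fun q : 𝔼 × 𝔼 => ∫⁻ y, ‖f (q.1 - y - q.2)‖ₑ * K q.1 y := by
  have h1 : Measurable fun q : (𝔼 × 𝔼) × 𝔼 => ‖f (q.1.1 - q.2 - q.1.2)‖ₑ := by fun_prop
  have h2 : Measurable fun q : (𝔼 × 𝔼) × 𝔼 => K q.1.1 q.2 :=
    hK.comp (by fun_prop : Measurable fun q : (𝔼 × 𝔼) × 𝔼 => (q.1.1, q.2))
  exact (h1.mul h2).lintegral_prod_right'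

/-- The pointwise form of the next estimate. It allows a measurable representative `f'` of `f` under
the integral sign. -/
theorem enorm_commForm_sub_conv_le (k S : SchwartzMap 𝔼 ℝ) (hS : ∫ z, S z = 1) {v : 𝔼 → 𝔼}
    {g : 𝔼 → 𝔾} (hg : Continuous g)
    (hv : ∀ z x, v x - v (x - z) = matAct d (segmentMean g z x) z)
    (hvc : Continuous v) {C : ℝ} {m : ℕ} (hvm : ∀ x, ‖v x‖ ≤ C * (1 + ‖x‖) ^ m) {f f' : 𝔼 → ℝ}
    (hf : IsTempered f) (hf' : Measurable f') (hff' : f =ᵐ[volume] f') (x : 𝔼) :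
    ‖commForm k v (fun y =>
      f y - ((S : 𝔼 → ℝ) ⋆[ContinuousLinearMap.lsmul ℝ ℝ, volume] f) y) x‖ₑ ≤
      ∫⁻ z, (‖S z‖ₑ * ‖z‖ₑ) *
        ∫⁻ s : ℝ, (∫⁻ y, ‖f' (x - y - s • z)‖ₑ * commKernelBound k g x y) ∂unitMeasure := by
  have hkm := measurable_commKernelBound k hg
  rw [commForm_sub_conv_eq k S hS hvc hvm hf]
  refine (enorm_integral_le_lintegral_enorm _).trans (lintegral_mono fun z => ?_)
  rw [enorm_mul, mul_assoc]
  refine mul_le_mul_right ?_ _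
  have hfx : (f ∘ fun y => x - y) =ᵐ[volume] (f' ∘ fun y => x - y) :=
    (Measure.measurePreserving_sub_left volume x).quasiMeasurePreserving.ae_eq_comp hff'
  have hK : Measurable (commKernelBound k g x) :=
    Measurable.of_uncurry_left (f := commKernelBound k g) hkm
  have hh : Measurable fun y => ‖f' (x - y)‖ₑ :=
    (hf'.comp (measurable_const.sub measurable_id)).enorm
  have h1 := lintegral_mul_lintegral_segment hh hK (enorm_ne_top (x := z)) z
  have h2 : (∫⁻ s : ℝ, (∫⁻ y, ‖f' (x - (y + s • z))‖ₑ * commKernelBound k g x y) ∂unitMeasure) =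
      ∫⁻ s : ℝ, (∫⁻ y, ‖f' (x - y - s • z)‖ₑ * commKernelBound k g x y) ∂unitMeasure := by
    simp only [sub_add_eq_sub_sub]
  rw [← h2, ← h1]
  refine (enorm_integral_le_lintegral_enorm _).trans (lintegral_mono_ae ?_)
  filter_upwards [hfx] with y hy
  have hy' : f (x - y) = f' (x - y) := hy
  rw [enorm_mul, hy']
  exact mul_le_mul_right (enorm_commKernel_sub_le k hg hv x y z) _

/-- The commutator of a smooth vector field with the high-frequency part `f - S * f`: after moving
a finite difference from `f` to the kernel, the first moment of `S` appears as a small factor. -/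
theorem eLpNorm_commForm_sub_conv_le (k S : SchwartzMap 𝔼 ℝ) (hS : ∫ z, S z = 1) {v : 𝔼 → 𝔼}
    {g : 𝔼 → 𝔾} (hg : Continuous g)
    (hv : ∀ z x, v x - v (x - z) = matAct d (segmentMean g z x) z)
    (hvc : Continuous v) {C : ℝ} {m : ℕ} (hvm : ∀ x, ‖v x‖ ≤ C * (1 + ‖x‖) ^ m) {f : 𝔼 → ℝ}
    (hf : IsTempered f) {p p' r : ℝ≥0∞} (hp : 1 ≤ p) (hr : 1 ≤ r) (hpr : p⁻¹ + p'⁻¹ = r⁻¹) :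
    eLpNorm (commForm k v fun y =>
      f y - ((S : 𝔼 → ℝ) ⋆[ContinuousLinearMap.lsmul ℝ ℝ, volume] f) y) r volume ≤
      (∫⁻ z, ‖S z‖ₑ * ‖z‖ₑ) *
        (((∫⁻ y, ‖fderiv ℝ k y‖ₑ) + ∫⁻ y, ‖fderiv ℝ (fderiv ℝ k) y‖ₑ * ‖y‖ₑ) *
          (eLpNorm g p volume * eLpNorm f p' volume)) := by
  have hfm := hf.aestronglyMeasurable
  -- `f` is only almost everywhere measurable, and the majorant has to be jointly measurable
  obtain ⟨f', hf', hff'⟩ : ∃ f' : 𝔼 → ℝ, Measurable f' ∧ f =ᵐ[volume] f' :=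
    ⟨hfm.mk f, hfm.stronglyMeasurable_mk.measurable, hfm.ae_eq_mk⟩
  have hkm := measurable_commKernelBound k hg
  have hQ := measurable_lintegral_enorm_mul hf' hkm
  have hA : Measurable fun z : 𝔼 => ‖S z‖ₑ * ‖z‖ₑ :=
    S.continuous.enorm.measurable.mul measurable_enorm
  calc _ ≤ eLpNorm (fun x => ∫⁻ z, (‖S z‖ₑ * ‖z‖ₑ) *
        ∫⁻ s : ℝ, (∫⁻ y, ‖f' (x - y - s • z)‖ₑ * commKernelBound k g x y) ∂unitMeasure)
          r volume := eLpNorm_mono_enorm fun x => by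
          simpa using enorm_commForm_sub_conv_le k S hS hg hv hvc hvm hf hf' hff' x
    _ ≤ _ := by
        have e : eLpNorm f p' volume = eLpNorm f' p' volume := eLpNorm_congr_ae hff'
        rw [e]
        exact eLpNorm_lintegral_mul_segment_le hA
          (Q := fun x w => ∫⁻ y, ‖f' (x - y - w)‖ₑ * commKernelBound k g x y) hQ hr
          fun w => eLpNorm_lintegral_commKernelBound_le k hg hf' hp hr hpr w

end Estimates

section LowFrequency

variable {d : ℕ}

local notation "𝔼" => EuclideanSpace ℝ (Fin d)
local notation "𝔾" => EuclideanSpace ℝ (Fin d × Fin d)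

/-! ### The commutator of smooth functions -/

theorem SchwartzMap.integrable_eval_mul_fderiv (k : SchwartzMap 𝔼 ℝ) (j : Fin d) (z : 𝔼) :
    Integrable fun y : 𝔼 => y j * fderiv ℝ k y z := by
  refine ((k.grad.integrable_pow_mul volume 1).mul_const ‖z‖).mono'
    (Continuous.aestronglyMeasurable ?_) (Filter.Eventually.of_forall fun y => ?_)
  · have : Continuous fun y => fderiv ℝ k y z := k.grad.continuous.clm_apply continuous_const
    exact (by fun_prop : Continuous fun y : 𝔼 => y j).mul this
  · rw [norm_mul, pow_one, mul_assoc]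
    exact mul_le_mul (PiLp.norm_apply_le y j) ((fderiv ℝ k y).le_opNorm z) (norm_nonneg _)
      (norm_nonneg _)

theorem SchwartzMap.integral_eval_mul_fderiv (k : SchwartzMap 𝔼 ℝ) (j : Fin d) (z : 𝔼) :
    ∫ y : 𝔼, y j * fderiv ℝ k y z = -(z j * ∫ y, k y) := by
  have hd (y : 𝔼) : HasFDerivAt (fun y : 𝔼 => y j) (EuclideanSpace.proj j : 𝔼 →L[ℝ] ℝ) y :=
    (EuclideanSpace.proj j : 𝔼 →L[ℝ] ℝ).hasFDerivAt
  have hf (y : 𝔼) : fderiv ℝ (fun y : 𝔼 => y j) y z = z j := by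
    rw [(hd y).fderiv]
    rfl
  have h := integral_mul_fderiv_eq_neg_fderiv_mul_of_integrable (μ := (volume : Measure 𝔼))
    (f := fun y : 𝔼 => y j) (g := k) (v := z) ?_ (k.integrable_eval_mul_fderiv j z) ?_
    (fun y _ => (hd y).differentiableAt) fun y _ => k.differentiable y
  · simpa only [hf, integral_const_mul] using h
  · simpa only [hf] using k.integrable.const_mul (z j)
  · refine (k.integrable_pow_mul volume 1).mono' (Continuous.aestronglyMeasurable ?_)
      (Filter.Eventually.of_forall fun y => ?_)
    · exact (by fun_prop : Continuous fun y : 𝔼 => y j).mul k.continuous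
    · rw [norm_mul, pow_one]
      exact mul_le_mul_of_nonneg_right (PiLp.norm_apply_le y j) (norm_nonneg _)

theorem fderiv_matAct_eq_sum (k : 𝔼 → ℝ) (A : 𝔾) (y : 𝔼) :
    fderiv ℝ k y (matAct d A y) =
      ∑ i, ∑ j, A (i, j) * (y j * fderiv ℝ k y (EuclideanSpace.single i 1)) := by
  rw [apply_eq_sum_single]
  refine Finset.sum_congr rfl fun i _ => ?_
  rw [matAct_apply, smul_eq_mul, Finset.sum_mul]
  exact Finset.sum_congr rfl fun j _ => mul_assoc _ _ _

theorem SchwartzMap.integrable_fderiv_matAct (k : SchwartzMap 𝔼 ℝ) (A : 𝔾) :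
    Integrable fun y => fderiv ℝ k y (matAct d A y) := by
  simp only [fderiv_matAct_eq_sum]
  exact integrable_finsetSum _ fun i _ => integrable_finsetSum _ fun j _ =>
    (k.integrable_eval_mul_fderiv j _).const_mul _

/-- The cancellation that comes from `div u = 0`: integration by parts gives `-tr A ∫ k`. -/
theorem SchwartzMap.integral_fderiv_matAct (k : SchwartzMap 𝔼 ℝ) {A : 𝔾}
    (hA : ∑ i, A (i, i) = 0) : ∫ y, fderiv ℝ k y (matAct d A y) = 0 := by
  have hi (i j : Fin d) := (k.integrable_eval_mul_fderiv j (EuclideanSpace.single i 1)).const_mul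
    (A (i, j))
  simp only [fderiv_matAct_eq_sum]
  rw [integral_finsetSum _ fun i _ => integrable_finsetSum _ fun j _ => hi i j]
  have h (i : Fin d) : ∫ y : 𝔼, ∑ j, A (i, j) * (y j * fderiv ℝ k y (EuclideanSpace.single i 1)) =
      -(A (i, i) * ∫ y, k y) := by
    rw [integral_finsetSum _ fun j _ => hi i j, Finset.sum_eq_single i]
    · rw [integral_const_mul, k.integral_eval_mul_fderiv]
      simp
    · intro j _ hj
      rw [integral_const_mul, k.integral_eval_mul_fderiv]
      simp [hj]
    · simp
  simp only [h, Finset.sum_neg_distrib, ← Finset.sum_mul, hA, zero_mul, neg_zero]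

theorem eLpNorm_segmentMean_sub_le {g : 𝔼 → 𝔾} (hg : Continuous g) {p L : ℝ≥0∞} (hp : 1 ≤ p)
    (h : ∀ z, eLpNorm (fun x => g (x - z) - g x) p volume ≤ ‖z‖ₑ * L) (y : 𝔼) :
    eLpNorm (fun x => segmentMean g y x - g x) p volume ≤ ‖y‖ₑ * L := by
  have hm : Measurable fun q : 𝔼 × ℝ => ‖g (q.1 - q.2 • y) - g q.1‖ₑ :=
    ((hg.comp (by fun_prop)).sub (hg.comp continuous_fst)).enorm.measurable
  have hpt (x : 𝔼) : ‖segmentMean g y x - g x‖ₑ ≤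
      ∫⁻ t : ℝ, ‖g (x - t • y) - g x‖ₑ ∂unitMeasure := by
    have hi : Integrable (fun t : ℝ => g (x - t • y)) unitMeasure :=
      ((hg.comp (by fun_prop : Continuous fun t : ℝ => x - t • y)).integrableOn_Icc
        (a := 0) (b := 1)).mono_set Ioc_subset_Icc_self
    have : segmentMean g y x - g x = ∫ t : ℝ, (g (x - t • y) - g x) ∂unitMeasure := by
      rw [integral_sub hi (integrable_const _), integral_const, segmentMean]
      simp
    rw [this]
    exact enorm_integral_le_lintegral_enorm _
  calc eLpNorm (fun x => segmentMean g y x - g x) p volume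
      ≤ eLpNorm (fun x => ∫⁻ t : ℝ, ‖g (x - t • y) - g x‖ₑ ∂unitMeasure) p volume :=
        eLpNorm_mono_enorm fun x => by simpa using hpt x
    _ ≤ ∫⁻ _ : ℝ, ‖y‖ₑ * L ∂unitMeasure := by
        refine eLpNorm_lintegral_le (f := fun x (t : ℝ) => ‖g (x - t • y) - g x‖ₑ)
          hm.aemeasurable aemeasurable_const hp ?_
        filter_upwards [ae_restrict_mem measurableSet_Ioc] with t ht
        rw [eLpNorm_enorm]
        refine (h _).trans (mul_le_mul_left ?_ L)
        rw [enorm_smul, Real.enorm_of_nonneg ht.1.le]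
        exact mul_le_of_le_one_left' (ENNReal.ofReal_le_one.2 ht.2)
    _ = _ := by simp

/-- The integral `∫ fderiv k y (g(x) y) dy` vanishes and may be subtracted. -/
theorem commForm_eq_integral_of_trace (k : SchwartzMap 𝔼 ℝ) {v : 𝔼 → 𝔼} {g : 𝔼 → 𝔾}
    (hv : ∀ z x, v x - v (x - z) = matAct d (segmentMean g z x) z)
    (hg0 : ∀ x, ∑ i, g x (i, i) = 0) {f : 𝔼 → ℝ} (hf : IsTempered f)
    (hfv : IsTempered fun y => f y • v y) (x : 𝔼) :
    commForm k v f x = ∫ y, (f (x - y) * fderiv ℝ k y (matAct d (segmentMean g y x) y) -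
      f x * fderiv ℝ k y (matAct d (g x) y)) := by
  have h1 := integrable_commForm k hf hfv x
  simp only [hv] at h1
  rw [integral_sub h1 ((k.integrable_fderiv_matAct (g x)).const_mul _), integral_const_mul,
    k.integral_fderiv_matAct (hg0 x), mul_zero, sub_zero, commForm]
  simp only [hv]

theorem enorm_commForm_le_of_trace (k : SchwartzMap 𝔼 ℝ) {v : 𝔼 → 𝔼} {g : 𝔼 → 𝔾}
    (hv : ∀ z x, v x - v (x - z) = matAct d (segmentMean g z x) z)
    (hg0 : ∀ x, ∑ i, g x (i, i) = 0) {f : 𝔼 → ℝ} (hf : IsTempered f)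
    (hfv : IsTempered fun y => f y • v y) (x : 𝔼) :
    ‖commForm k v f x‖ₑ ≤ ∫⁻ y, (‖fderiv ℝ k y‖ₑ * ‖y‖ₑ) *
      (‖segmentMean g y x‖ₑ * ‖f (x - y) - f x‖ₑ + ‖segmentMean g y x - g x‖ₑ * ‖f x‖ₑ) := by
  rw [commForm_eq_integral_of_trace k hv hg0 hf hfv]
  refine (enorm_integral_le_lintegral_enorm _).trans (lintegral_mono fun y => ?_)
  have hb (A : 𝔾) : ‖fderiv ℝ k y (matAct d A y)‖ₑ ≤ (‖fderiv ℝ k y‖ₑ * ‖y‖ₑ) * ‖A‖ₑ := by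
    refine (ContinuousLinearMap.le_opENorm _ _).trans ?_
    rw [mul_assoc, mul_comm ‖y‖ₑ]
    gcongr
    exact enorm_matAct_le _ _
  have e : f (x - y) * fderiv ℝ k y (matAct d (segmentMean g y x) y) -
      f x * fderiv ℝ k y (matAct d (g x) y) =
      fderiv ℝ k y (matAct d (segmentMean g y x) y) * (f (x - y) - f x) +
        fderiv ℝ k y (matAct d (segmentMean g y x - g x) y) * f x := by
    rw [map_sub, sub_apply, map_sub]
    ring
  rw [e, mul_add, ← mul_assoc, ← mul_assoc]
  refine (enorm_add_le _ _).trans (add_le_add ?_ ?_)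
  · rw [enorm_mul]
    exact mul_le_mul_left (hb _) _
  · rw [enorm_mul]
    exact mul_le_mul_left (hb _) _

/-- The commutator of two smooth functions gains a second moment of the kernel: both functions are
Lipschitz in the mean, and the first-order term vanishes as the gradient is trace-free. -/
theorem eLpNorm_commForm_le_of_trace (k : SchwartzMap 𝔼 ℝ) {v : 𝔼 → 𝔼} {g : 𝔼 → 𝔾}
    (hg : Continuous g) (hv : ∀ z x, v x - v (x - z) = matAct d (segmentMean g z x) z)
    (hg0 : ∀ x, ∑ i, g x (i, i) = 0) {f : 𝔼 → ℝ} (hf : IsTempered f) (hfc : Continuous f)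
    (hfv : IsTempered fun y => f y • v y) {p p' r L L' : ℝ≥0∞} (hp : 1 ≤ p) (hr : 1 ≤ r)
    (hpr : p⁻¹ + p'⁻¹ = r⁻¹)
    (hL : ∀ z, eLpNorm (fun x => g (x - z) - g x) p volume ≤ ‖z‖ₑ * L)
    (hL' : ∀ z, eLpNorm (fun x => f (x - z) - f x) p' volume ≤ ‖z‖ₑ * L') :
    eLpNorm (commForm k v f) r volume ≤ (∫⁻ y, ‖fderiv ℝ k y‖ₑ * ‖y‖ₑ ^ 2) *
      (eLpNorm g p volume * L' + L * eLpNorm f p' volume) := by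
  have hk : Measurable fun y => ‖fderiv ℝ k y‖ₑ := k.grad.continuous.enorm.measurable
  have hk1 : Measurable fun y => ‖fderiv ℝ k y‖ₑ * ‖y‖ₑ := hk.mul measurable_enorm
  have hk2 : Measurable fun y => ‖fderiv ℝ k y‖ₑ * ‖y‖ₑ ^ 2 := hk.mul (measurable_enorm.pow_const 2)
  have hs := measurable_segmentMean hg
  have hm : Measurable fun q : 𝔼 × 𝔼 => (‖fderiv ℝ k q.2‖ₑ * ‖q.2‖ₑ) *
      (‖segmentMean g q.2 q.1‖ₑ * ‖f (q.1 - q.2) - f q.1‖ₑ +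
        ‖segmentMean g q.2 q.1 - g q.1‖ₑ * ‖f q.1‖ₑ) := by
    have m1 : Measurable fun q : 𝔼 × 𝔼 => ‖f (q.1 - q.2) - f q.1‖ₑ :=
      ((hfc.comp (by fun_prop)).sub (hfc.comp continuous_fst)).enorm.measurable
    have m2 : Measurable fun q : 𝔼 × 𝔼 => ‖segmentMean g q.2 q.1 - g q.1‖ₑ :=
      (hs.sub (hg.comp continuous_fst).measurable).enorm
    have m3 : Measurable fun q : 𝔼 × 𝔼 => ‖f q.1‖ₑ := (hfc.comp continuous_fst).enorm.measurable
    exact (hk1.comp measurable_snd).mul ((hs.enorm.mul m1).add (m2.mul m3))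
  have hgm : AEStronglyMeasurable g := hg.aestronglyMeasurable
  have hfm : AEStronglyMeasurable f := hfc.aestronglyMeasurable
  have hc (y : 𝔼) : eLpNorm (fun x => (‖fderiv ℝ k y‖ₑ * ‖y‖ₑ) *
      (‖segmentMean g y x‖ₑ * ‖f (x - y) - f x‖ₑ + ‖segmentMean g y x - g x‖ₑ * ‖f x‖ₑ)) r volume ≤
      ‖fderiv ℝ k y‖ₑ * ‖y‖ₑ ^ 2 * (eLpNorm g p volume * L' + L * eLpNorm f p' volume) := by
    have hsy : AEStronglyMeasurable (segmentMean g y) := hgm.segmentMean y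
    have h1 : eLpNorm (fun x => ‖segmentMean g y x‖ₑ * ‖f (x - y) - f x‖ₑ) r volume ≤
        eLpNorm g p volume * (‖y‖ₑ * L') :=
      (eLpNorm_enorm_mul_enorm_le hsy ((hfm.comp_sub_right y).sub hfm) hpr).trans
        (mul_le_mul' (eLpNorm_segmentMean_le hgm y hp) (hL' y))
    have h2 : eLpNorm (fun x => ‖segmentMean g y x - g x‖ₑ * ‖f x‖ₑ) r volume ≤
        ‖y‖ₑ * L * eLpNorm f p' volume :=
      (eLpNorm_enorm_mul_enorm_le (hsy.sub hgm) hfm hpr).trans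
        (mul_le_mul_left (eLpNorm_segmentMean_sub_le hg hp hL y) _)
    have h3 := (eLpNorm_add_le (μ := (volume : Measure 𝔼))
      (f := fun x => ‖segmentMean g y x‖ₑ * ‖f (x - y) - f x‖ₑ)
      (g := fun x => ‖segmentMean g y x - g x‖ₑ * ‖f x‖ₑ)
      (hsy.enorm.mul ((hfm.comp_sub_right y).sub hfm).enorm).aestronglyMeasurable
      ((hsy.sub hgm).enorm.mul hfm.enorm).aestronglyMeasurable hr).trans (add_le_add h1 h2)
    refine (eLpNorm_le_mul_eLpNorm_of_ae_le_mul' (c := ‖fderiv ℝ k y‖₊ * ‖y‖₊)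
      (g := (fun x => ‖segmentMean g y x‖ₑ * ‖f (x - y) - f x‖ₑ) +
        fun x => ‖segmentMean g y x - g x‖ₑ * ‖f x‖ₑ)
      (Filter.Eventually.of_forall fun x => ?_) r).trans ((mul_le_mul_right h3 _).trans
        (le_of_eq ?_))
    · rw [enorm_eq_self, enorm_eq_self, ENNReal.coe_mul]
      rfl
    · rw [ENNReal.coe_mul, ← enorm_eq_nnnorm, ← enorm_eq_nnnorm]
      ring
  calc eLpNorm (commForm k v f) r volume
      ≤ eLpNorm (fun x => ∫⁻ y, (‖fderiv ℝ k y‖ₑ * ‖y‖ₑ) *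
          (‖segmentMean g y x‖ₑ * ‖f (x - y) - f x‖ₑ + ‖segmentMean g y x - g x‖ₑ * ‖f x‖ₑ))
          r volume := eLpNorm_mono_enorm fun x => by
        simpa using enorm_commForm_le_of_trace k hv hg0 hf hfv x
    _ ≤ ∫⁻ y, ‖fderiv ℝ k y‖ₑ * ‖y‖ₑ ^ 2 *
          (eLpNorm g p volume * L' + L * eLpNorm f p' volume) :=
        eLpNorm_lintegral_le (f := fun x y => (‖fderiv ℝ k y‖ₑ * ‖y‖ₑ) *
          (‖segmentMean g y x‖ₑ * ‖f (x - y) - f x‖ₑ + ‖segmentMean g y x - g x‖ₑ * ‖f x‖ₑ))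
          hm.aemeasurable (hk2.mul_const _).aemeasurable hr (Filter.Eventually.of_forall hc)
    _ = _ := lintegral_mul_const _ hk2

end LowFrequency

section LittlewoodPaley

variable {d : ℕ}

local notation "𝔼" => EuclideanSpace ℝ (Fin d)
local notation "𝔾" => EuclideanSpace ℝ (Fin d × Fin d)
local notation:67 k:68 " ∗ " f:67 =>
  ((k : EuclideanSpace ℝ (Fin d) → ℝ) ⋆[ContinuousLinearMap.lsmul ℝ ℝ, volume] f)

/-! ### Littlewood-Paley projections -/

/-- The low-pass kernel `S_n(x) = 2^{nd} S(2^n x)`, which cuts frequencies off at `2^n`. -/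
noncomputable def lowPass {χ : 𝔼 → ℝ} (hχ : IsLittlewoodPaleyCutoff χ) (n : ℤ) : SchwartzMap 𝔼 ℝ :=
  (lowPassKernel hχ).dilate (δ := 2 ^ (-n)) (by positivity)

/-- The Littlewood-Paley kernel `ψ_n = S_n - S_{n-1}` as a Schwartz function. -/
noncomputable def bandPass {χ : 𝔼 → ℝ} (hχ : IsLittlewoodPaleyCutoff χ) (n : ℤ) :
    SchwartzMap 𝔼 ℝ := lowPass hχ n - lowPass hχ (n - 1)

variable {χ : EuclideanSpace ℝ (Fin d) → ℝ} (hχ : IsLittlewoodPaleyCutoff χ)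

theorem coe_bandPass (n : ℤ) : (bandPass hχ n : 𝔼 → ℝ) = lpKernel χ n := by
  funext x
  rw [lpKernel_eq_sub hχ, bandPass, sub_apply, lowPass, lowPass, SchwartzMap.coe_dilate,
    SchwartzMap.coe_dilate]

theorem integral_lowPass (n : ℤ) : ∫ x, lowPass hχ n x = 1 := by
  rw [lowPass, SchwartzMap.integral_dilate, integral_lowPassKernel]

theorem lowPass_conv_lowPass {m n : ℤ} (h : n + 2 ≤ m) :
    lowPass hχ m ∗ (lowPass hχ n : 𝔼 → ℝ) = lowPass hχ n := by
  rw [lowPass, lowPass, SchwartzMap.coe_dilate, SchwartzMap.coe_dilate]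
  refine conv_lowPassKernel hχ (by positivity) (by positivity) ?_
  have : (4 : ℝ) = 2 ^ (2 : ℤ) := by norm_num
  rw [this, ← zpow_add₀ two_ne_zero]
  exact zpow_le_zpow_right₀ one_le_two (by linarith)

theorem conv_comm (k l : 𝔼 → ℝ) : k ∗ l = l ∗ k := by
  rw [← convolution_flip]
  congr 1
  ext
  simp

variable {V : Type*} [NormedAddCommGroup V] [NormedSpace ℝ V]

theorem sub_conv (k l : SchwartzMap 𝔼 ℝ) {f : 𝔼 → V} (hf : IsTempered f) (x : 𝔼) :
    ((k - l : SchwartzMap 𝔼 ℝ) ∗ f) x = (k ∗ f) x - (l ∗ f) x := by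
  have h (k : SchwartzMap 𝔼 ℝ) := hf.integrable_conv (ContinuousLinearMap.lsmul ℝ ℝ) k x
  rw [convolution_def, convolution_def, convolution_def, ← integral_sub (h k) (h l)]
  congr 1 with y
  simp

theorem bandPass_conv (n : ℤ) {f : 𝔼 → V} (hf : IsTempered f) (x : 𝔼) :
    (bandPass hχ n ∗ f) x = (lowPass hχ n ∗ f) x - (lowPass hχ (n - 1) ∗ f) x :=
  sub_conv _ _ hf x

theorem lowPass_conv_lowPass_conv [CompleteSpace V] {m n : ℤ} (h : n + 2 ≤ m)
    {f : 𝔼 → V} (hf : IsTempered f) :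
    lowPass hχ m ∗ (lowPass hχ n ∗ f) = lowPass hχ n ∗ f := by
  rw [← hf.conv_assoc, lowPass_conv_lowPass hχ h]

theorem lowPass_conv_lowPass_conv' [CompleteSpace V] {m n : ℤ} (h : n + 2 ≤ m)
    {f : 𝔼 → V} (hf : IsTempered f) :
    lowPass hχ n ∗ (lowPass hχ m ∗ f) = lowPass hχ n ∗ f := by
  rw [← hf.conv_assoc, conv_comm, lowPass_conv_lowPass hχ h]

theorem conv_bandPass_conv (k : SchwartzMap 𝔼 ℝ) (n : ℤ) {f : 𝔼 → V} (hf : IsTempered f) (x : 𝔼) :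
    (k ∗ (bandPass hχ n ∗ f)) x =
      (k ∗ (lowPass hχ n ∗ f)) x - (k ∗ (lowPass hχ (n - 1) ∗ f)) x := by
  have h (m : ℤ) := (hf.conv (lowPass hχ m)).integrable_conv (ContinuousLinearMap.lsmul ℝ ℝ) k x
  rw [convolution_def, convolution_def (g := lowPass hχ n ∗ f),
    convolution_def (g := lowPass hχ (n - 1) ∗ f), ← integral_sub (h _) (h _)]
  congr 1 with y
  rw [bandPass_conv hχ n hf, map_sub]

theorem lowPass_conv_bandPass_conv [CompleteSpace V] {m n : ℤ} (h : n + 2 ≤ m)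
    {f : 𝔼 → V} (hf : IsTempered f) :
    lowPass hχ m ∗ (bandPass hχ n ∗ f) = bandPass hχ n ∗ f := by
  funext x
  rw [conv_bandPass_conv hχ _ n hf, lowPass_conv_lowPass_conv hχ h hf,
    lowPass_conv_lowPass_conv hχ (by linarith) hf, bandPass_conv hχ n hf]

theorem lowPass_conv_bandPass_conv_eq_zero [CompleteSpace V] {m n : ℤ} (h : m + 3 ≤ n) {f : 𝔼 → V}
    (hf : IsTempered f) (x : 𝔼) : (lowPass hχ m ∗ (bandPass hχ n ∗ f)) x = 0 := by
  rw [conv_bandPass_conv hχ _ n hf, lowPass_conv_lowPass_conv' hχ (by linarith) hf,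
    lowPass_conv_lowPass_conv' hχ (by linarith) hf, sub_self]

theorem lintegral_enorm_lowPass_mul (n : ℤ) :
    ∫⁻ z, ‖lowPass hχ n z‖ₑ * ‖z‖ₑ =
      ENNReal.ofReal (2 ^ (-n)) * ∫⁻ z, ‖lowPassKernel hχ z‖ₑ * ‖z‖ₑ := by
  have h := lintegral_dilate (lowPassKernel hχ) (δ := 2 ^ (-n)) (by positivity) 0 1
    (lowPass hχ n) fun x => by
      rw [lowPass, SchwartzMap.dilate_apply, enorm_mul, Real.enorm_of_nonneg (by positivity),
        pow_zero, mul_one]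
  simpa using h

theorem lintegral_enorm_lowPass (n : ℤ) :
    ∫⁻ z, ‖lowPass hχ n z‖ₑ = ∫⁻ z, ‖lowPassKernel hχ z‖ₑ := by
  have h := lintegral_dilate (lowPassKernel hχ) (δ := 2 ^ (-n)) (by positivity) 0 0
    (lowPass hχ n) fun x => by
      rw [lowPass, SchwartzMap.dilate_apply, enorm_mul, Real.enorm_of_nonneg (by positivity),
        pow_zero, mul_one]
  simpa using h

theorem SchwartzMap.fderiv_dilate (k : SchwartzMap 𝔼 ℝ) {δ : ℝ} (hδ : 0 < δ) (x : 𝔼) :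
    fderiv ℝ (k.dilate hδ) x = ((δ ^ d)⁻¹ * δ⁻¹) • fderiv ℝ k (δ⁻¹ • x) := by
  have e : (k.dilate hδ : 𝔼 → ℝ) = (δ ^ d)⁻¹ • fun x => k (δ⁻¹ • x) := by
    funext x
    rw [k.dilate_apply, Pi.smul_apply, smul_eq_mul]
  rw [e, fderiv_const_smul_field, Pi.smul_apply, fderiv_comp_smul, smul_smul]

-- The normed structure on second derivatives is found only with a deeper instance search.
set_option maxSynthPendingDepth 3 in
theorem SchwartzMap.fderiv_fderiv_dilate (k : SchwartzMap 𝔼 ℝ) {δ : ℝ} (hδ : 0 < δ) (x : 𝔼) :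
    fderiv ℝ (fderiv ℝ (k.dilate hδ)) x =
      ((δ ^ d)⁻¹ * δ⁻¹ ^ 2) • fderiv ℝ (fderiv ℝ k) (δ⁻¹ • x) := by
  have e : fderiv ℝ (k.dilate hδ) = ((δ ^ d)⁻¹ * δ⁻¹) • fun x => fderiv ℝ k (δ⁻¹ • x) := by
    funext x
    rw [k.fderiv_dilate, Pi.smul_apply]
  rw [e, fderiv_const_smul_field, Pi.smul_apply, fderiv_comp_smul, smul_smul, mul_assoc, sq]

theorem SchwartzMap.lintegral_enorm_fderiv_dilate (k : SchwartzMap 𝔼 ℝ) {δ : ℝ} (hδ : 0 < δ)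
    (j : ℕ) : ∫⁻ y, ‖fderiv ℝ (k.dilate hδ) y‖ₑ * ‖y‖ₑ ^ j =
      ENNReal.ofReal (δ ^ j * δ⁻¹) * ∫⁻ y, ‖fderiv ℝ k y‖ₑ * ‖y‖ₑ ^ j := by
  simpa using lintegral_dilate (fderiv ℝ k) hδ 1 j (fderiv ℝ (k.dilate hδ)) fun x => by
    rw [k.fderiv_dilate, enorm_smul, Real.enorm_of_nonneg (by positivity), pow_one]

set_option maxSynthPendingDepth 3 in
theorem SchwartzMap.lintegral_enorm_fderiv_fderiv_dilate (k : SchwartzMap 𝔼 ℝ) {δ : ℝ}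
    (hδ : 0 < δ) :
    ∫⁻ y, ‖fderiv ℝ (fderiv ℝ (k.dilate hδ)) y‖ₑ * ‖y‖ₑ =
      ENNReal.ofReal δ⁻¹ * ∫⁻ y, ‖fderiv ℝ (fderiv ℝ k) y‖ₑ * ‖y‖ₑ := by
  have h := lintegral_dilate (fderiv ℝ (fderiv ℝ k)) hδ 2 1 (fderiv ℝ (fderiv ℝ (k.dilate hδ)))
    fun x => by
      rw [k.fderiv_fderiv_dilate, enorm_smul, Real.enorm_of_nonneg (by positivity)]
  have e : δ ^ 1 * δ⁻¹ ^ 2 = δ⁻¹ := by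
    field_simp
  rw [e] at h
  simpa only [pow_one] using h

/-- Translation is Lipschitz on `k * f`, as the translations can be moved to the kernel. -/
theorem eLpNorm_conv_translate_sub_le (k : SchwartzMap 𝔼 ℝ) {f : 𝔼 → V} (hf : IsTempered f)
    {p : ℝ≥0∞} (hp : 1 ≤ p) (z : 𝔼) :
    eLpNorm (fun x => (k ∗ f) (x - z) - (k ∗ f) x) p volume ≤
      ‖z‖ₑ * ((∫⁻ y, ‖fderiv ℝ k y‖ₑ) * eLpNorm f p volume) := by
  have hk : Measurable fun y => ‖fderiv ℝ k y‖ₑ := k.grad.continuous.enorm.measurable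
  have e (x : 𝔼) : (k ∗ f) (x - z) - (k ∗ f) x = ((fun y => k (y - z) - k y) ∗ f) x := by
    have i1 : Integrable fun y => k (y - z) • f (x - y) := by
      refine ((hf.integrable_conv (ContinuousLinearMap.lsmul ℝ ℝ) k (x - z)).comp_sub_right
        z).congr (Filter.Eventually.of_forall fun y => ?_)
      simp
    have i2 := hf.integrable_conv (ContinuousLinearMap.lsmul ℝ ℝ) k x
    have e1 : (k ∗ f) (x - z) = ∫ y, k (y - z) • f (x - y) := by
      rw [convolution_def, ← integral_sub_right_eq_self _ z]
      simp
    rw [e1, convolution_def, convolution_def, ← integral_sub i1 i2]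
    simp
  have hb : ∫⁻ y, ‖k (y - z) - k y‖ₑ ≤ ‖z‖ₑ * ∫⁻ y, ‖fderiv ℝ k y‖ₑ := by
    have hs : Measurable fun q : 𝔼 × ℝ => ‖fderiv ℝ k (q.1 + q.2 • -z)‖ₑ :=
      hk.comp (by fun_prop : Measurable fun q : 𝔼 × ℝ => q.1 + q.2 • -z)
    calc ∫⁻ y, ‖k (y - z) - k y‖ₑ
        ≤ ∫⁻ y, ∫⁻ t : ℝ, ‖fderiv ℝ k (y + t • -z)‖ₑ * ‖z‖ₑ ∂unitMeasure := by
          refine lintegral_mono fun y => ?_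
          rw [sub_eq_add_neg y z, sub_comp_add_eq_integral (k.smooth _)]
          refine (enorm_integral_le_lintegral_enorm _).trans (lintegral_mono fun t => ?_)
          rw [← enorm_neg z]
          exact ContinuousLinearMap.le_opENorm _ _
      _ = ∫⁻ t : ℝ, (∫⁻ y, ‖fderiv ℝ k (y + t • -z)‖ₑ * ‖z‖ₑ) ∂unitMeasure :=
          lintegral_lintegral_swap (hs.mul_const _).aemeasurable
      _ = ∫⁻ _ : ℝ, ‖z‖ₑ * (∫⁻ y, ‖fderiv ℝ k y‖ₑ) ∂unitMeasure := by
          refine lintegral_congr fun t => ?_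
          rw [lintegral_mul_const' _ _ enorm_ne_top, mul_comm,
            lintegral_add_right_eq_self (fun y => ‖fderiv ℝ k y‖ₑ) (t • -z)]
      _ = _ := by simp
  simp only [e]
  rw [← mul_assoc]
  refine (eLpNorm_conv_le ?_ hf.aestronglyMeasurable hp).trans (mul_le_mul_left hb _)
  exact ((k.continuous.comp (by fun_prop)).sub k.continuous).aestronglyMeasurable

end LittlewoodPaley

section Telescoping

/-! ### Dyadic sums -/

/-- The dyadic sum `∑_{n > N} 2^{-(n - N - 1)} a_n` over the scales above `N`. -/
noncomputable def highSum (a : ℤ → ℝ≥0∞) (N : ℤ) : ℝ≥0∞ := ∑' i : ℕ, 2⁻¹ ^ i * a (N + 1 + i)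

/-- The dyadic sum `∑_{n ≤ N} 2^{-(N - n)} a_n` over the scales up to `N`. -/
noncomputable def lowSum (a : ℤ → ℝ≥0∞) (N : ℤ) : ℝ≥0∞ := ∑' i : ℕ, 2⁻¹ ^ i * a (N - i)

theorem ofReal_two_zpow_add (m n : ℤ) : ENNReal.ofReal ((2 : ℝ) ^ (m + n)) =
    ENNReal.ofReal (2 ^ m) * ENNReal.ofReal (2 ^ n) := by
  rw [← ENNReal.ofReal_mul (by positivity), zpow_add₀ two_ne_zero]

theorem ofReal_two_zpow_neg_natCast (i : ℕ) :
    ENNReal.ofReal ((2 : ℝ) ^ (-(i : ℤ))) = 2⁻¹ ^ i := by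
  rw [zpow_neg, zpow_natCast, ENNReal.ofReal_inv_of_pos (by positivity),
    ENNReal.ofReal_pow zero_le_two, ENNReal.ofReal_ofNat, ENNReal.inv_pow]

/-- Telescoping, with a geometrically decaying remainder. -/
theorem le_tsum_of_le_add {Z W : ℕ → ℝ≥0∞} (h : ∀ j, Z j ≤ Z (j + 1) + W j) {B : ℝ≥0∞}
    (hB : B ≠ ⊤) (hZ : ∀ j, Z j ≤ 2⁻¹ ^ j * B) : Z 0 ≤ ∑' j, W j := by
  have h1 (j : ℕ) : Z 0 ≤ Z j + ∑ i ∈ Finset.range j, W i := by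
    induction j with
    | zero => simp
    | succ j ih =>
      rw [Finset.sum_range_succ, add_comm _ (W j), ← add_assoc]
      exact ih.trans (add_le_add_left (h j) _)
  have h2 (j : ℕ) : Z 0 ≤ 2⁻¹ ^ j * B + ∑' j, W j :=
    (h1 j).trans (add_le_add (hZ j) (ENNReal.sum_le_tsum _))
  have h3 : Filter.Tendsto (fun j : ℕ => (2⁻¹ : ℝ≥0∞) ^ j * B + ∑' j, W j) Filter.atTop
      (nhds (0 * B + ∑' j, W j)) :=
    (ENNReal.Tendsto.mul_const (ENNReal.tendsto_pow_atTop_nhds_zero_of_lt_one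
      (by simp)) (Or.inr hB)).add_const _
  rw [zero_mul, zero_add] at h3
  exact ge_of_tendsto' h3 h2

end Telescoping

section LittlewoodPaley

variable {d : ℕ}

local notation "𝔼" => EuclideanSpace ℝ (Fin d)
local notation "𝔾" => EuclideanSpace ℝ (Fin d × Fin d)
local notation:67 k:68 " ∗ " f:67 =>
  ((k : EuclideanSpace ℝ (Fin d) → ℝ) ⋆[ContinuousLinearMap.lsmul ℝ ℝ, volume] f)

variable {χ : EuclideanSpace ℝ (Fin d) → ℝ} (hχ : IsLittlewoodPaleyCutoff χ)

/-! ### Bounds for the high- and low-frequency parts -/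

theorem lintegral_enorm_lowPass_shift (N : ℤ) (i : ℕ) :
    ∫⁻ z, ‖lowPass hχ (N + i) z‖ₑ * ‖z‖ₑ = 2⁻¹ ^ i * (ENNReal.ofReal (2 ^ (-N)) *
      ∫⁻ z, ‖lowPassKernel hχ z‖ₑ * ‖z‖ₑ) := by
  rw [lintegral_enorm_lowPass_mul, neg_add, ofReal_two_zpow_add, ofReal_two_zpow_neg_natCast]
  ring

theorem lintegral_enorm_lowPass_shift_sub_three (N : ℤ) (i : ℕ) :
    ∫⁻ z, ‖lowPass hχ (N + 1 + i - 3) z‖ₑ * ‖z‖ₑ = 2⁻¹ ^ i * (ENNReal.ofReal (2 ^ (-N)) *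
      (4 * ∫⁻ z, ‖lowPassKernel hχ z‖ₑ * ‖z‖ₑ)) := by
  have e : (4 : ℝ≥0∞) = ENNReal.ofReal (2 ^ (2 : ℤ)) := by norm_num
  rw [lintegral_enorm_lowPass_mul, show -(N + 1 + i - 3) = -N + 2 + -(i : ℤ) by ring,
    ofReal_two_zpow_add, ofReal_two_zpow_add, ofReal_two_zpow_neg_natCast, ← e]
  ring

theorem lintegral_enorm_lowPassKernel_mul_ne_top :
    ∫⁻ z, ‖lowPassKernel hχ z‖ₑ * ‖z‖ₑ ≠ ⊤ := by
  simpa using ((lowPassKernel hχ).lintegral_enorm_mul_norm_lt_top 1).ne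

theorem bandPass_conv_succ {V : Type*} [NormedAddCommGroup V] [NormedSpace ℝ V] (N : ℤ) (j : ℕ)
    {f : 𝔼 → V} (hf : IsTempered f) (x : 𝔼) : (bandPass hχ (N + 1 + j) ∗ f) x =
      (lowPass hχ (N + (j + 1 : ℕ)) ∗ f) x - (lowPass hχ (N + j) ∗ f) x := by
  rw [bandPass_conv hχ _ hf, show N + 1 + (j : ℤ) - 1 = N + j by ring,
    show N + 1 + (j : ℤ) = N + (j + 1 : ℕ) by push_cast; ring]

/-- The high frequencies of a vector field gain a derivative. As `S_{n-3} * ψ_n * u = 0`, the piece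
`ψ_n * u` is its own difference with `S_{n-3} * ψ_n * u`, which is controlled by the first moment of
`S_{n-3}`. -/
theorem HasSegmentGradient.eLpNorm_sub_lowPass_conv_le {u : 𝔼 → 𝔼} {G : 𝔼 → 𝔾}
    (h : HasSegmentGradient u G) (hu : IsTempered u) {p : ℝ≥0∞} (hp : 1 ≤ p) (hG : MemLp G p)
    (N : ℤ) :
    eLpNorm (fun x => u x - (lowPass hχ N ∗ u) x) p volume ≤
      ENNReal.ofReal (2 ^ (-N)) * (4 * ∫⁻ z, ‖lowPassKernel hχ z‖ₑ * ‖z‖ₑ) *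
        highSum (fun n => eLpNorm (bandPass hχ n ∗ G) p volume) N := by
  have hGT := hG.isTempered hp
  have hS (n : ℤ) := (hu.conv (lowPass hχ n)).aestronglyMeasurable
  have hB (n : ℤ) := hu.conv (bandPass hχ n)
  have key := le_tsum_of_le_add
    (Z := fun j : ℕ => eLpNorm (fun x => u x - (lowPass hχ (N + j) ∗ u) x) p volume)
    (W := fun j : ℕ => eLpNorm (bandPass hχ (N + 1 + j) ∗ u) p volume)
    (B := ENNReal.ofReal (2 ^ (-N)) * (∫⁻ z, ‖lowPassKernel hχ z‖ₑ * ‖z‖ₑ) * eLpNorm G p volume)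
    (fun j => ?_) ?_ fun j => ?_
  · simp only [Nat.cast_zero, add_zero] at key
    refine key.trans ?_
    rw [highSum, ← ENNReal.tsum_mul_left]
    refine ENNReal.tsum_le_tsum fun j => ?_
    have h1 := (h.conv hu hGT (bandPass hχ (N + 1 + j))).eLpNorm_sub_conv_le (hB _)
      (hGT.conv (bandPass hχ (N + 1 + j))).aestronglyMeasurable hp (lowPass hχ (N + 1 + j - 3))
      (integral_lowPass hχ _)
    simp only [lowPass_conv_bandPass_conv_eq_zero hχ
      (show N + 1 + (j : ℤ) - 3 + 3 ≤ N + 1 + j by linarith) hu, sub_zero,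
      lintegral_enorm_lowPass_shift_sub_three] at h1
    refine h1.trans (le_of_eq ?_)
    ring
  · refine le_trans (le_of_eq ?_) (eLpNorm_add_le (hu.aestronglyMeasurable.sub (hS _))
      (hB (N + 1 + j)).aestronglyMeasurable hp)
    congr 1 with x
    simp only [Pi.add_apply, bandPass_conv_succ hχ N j hu]
    simp
  · exact ENNReal.mul_ne_top (ENNReal.mul_ne_top ENNReal.ofReal_ne_top
      (lintegral_enorm_lowPassKernel_mul_ne_top hχ)) hG.2.ne
  · refine (h.eLpNorm_sub_conv_le hu hG.1 hp _ (integral_lowPass hχ _)).trans (le_of_eq ?_)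
    rw [lintegral_enorm_lowPass_shift]
    ring

/-- The commutator of a smooth vector field with the high frequencies of a density. Each piece
`f_n = ψ_n * f` equals `f_n - S_{n-3} * f_n`. -/
theorem eLpNorm_commForm_sub_lowPass_conv_le (k : SchwartzMap 𝔼 ℝ) {v : 𝔼 → 𝔼}
    {g : 𝔼 → 𝔾} (hg : Continuous g)
    (hv : ∀ z x, v x - v (x - z) = matAct d (segmentMean g z x) z)
    (hvc : Continuous v) {C : ℝ} {m : ℕ} (hvm : ∀ x, ‖v x‖ ≤ C * (1 + ‖x‖) ^ m)
    {p p' r : ℝ≥0∞} (hp : 1 ≤ p) (hp' : 1 ≤ p') (hr : 1 ≤ r) (hpr : p⁻¹ + p'⁻¹ = r⁻¹)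
    (hgp : eLpNorm g p volume ≠ ⊤) {f : 𝔼 → ℝ} (hf : MemLp f p') (N : ℤ) :
    eLpNorm (commForm k v fun y => f y - (lowPass hχ N ∗ f) y) r volume ≤
      ENNReal.ofReal (2 ^ (-N)) * (4 * ∫⁻ z, ‖lowPassKernel hχ z‖ₑ * ‖z‖ₑ) *
        (((∫⁻ y, ‖fderiv ℝ k y‖ₑ) + ∫⁻ y, ‖fderiv ℝ (fderiv ℝ k) y‖ₑ * ‖y‖ₑ) *
          (eLpNorm g p volume * highSum (fun n => eLpNorm (bandPass hχ n ∗ f) p' volume) N)) := by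
  have hfT := hf.isTempered hp'
  have hS (n : ℤ) := hfT.conv (lowPass hχ n)
  have hB (n : ℤ) := hfT.conv (bandPass hχ n)
  have hT {f : 𝔼 → ℝ} (hf : IsTempered f) := hf.smul_of_growth hvc.aestronglyMeasurable hvm
  have hest (n : ℤ) {f : 𝔼 → ℝ} (hf : IsTempered f) :=
    eLpNorm_commForm_sub_conv_le k (lowPass hχ n) (integral_lowPass hχ n) hg hv hvc hvm hf
      hp hr hpr
  set D := (∫⁻ y, ‖fderiv ℝ k y‖ₑ) + ∫⁻ y, ‖fderiv ℝ (fderiv ℝ k) y‖ₑ * ‖y‖ₑ with hD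
  have hDt : D ≠ ⊤ := by
    have h1 := (k.grad.lintegral_enorm_mul_norm_lt_top 0).ne
    have h2 := ((SchwartzMap.fderivCLM ℝ 𝔼 (𝔼 →L[ℝ] ℝ)
      k.grad).lintegral_enorm_mul_norm_lt_top 1).ne
    simp only [pow_zero, mul_one, pow_one] at h1 h2
    exact ENNReal.add_ne_top.2 ⟨h1, h2⟩
  have key := le_tsum_of_le_add
    (Z := fun j : ℕ => eLpNorm (commForm k v fun y => f y - (lowPass hχ (N + j) ∗ f) y) r volume)
    (W := fun j : ℕ => eLpNorm (commForm k v (bandPass hχ (N + 1 + j) ∗ f)) r volume)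
    (B := ENNReal.ofReal (2 ^ (-N)) * (∫⁻ z, ‖lowPassKernel hχ z‖ₑ * ‖z‖ₑ) *
      (D * (eLpNorm g p volume * eLpNorm f p' volume)))
    (fun j => ?_) ?_ fun j => ?_
  · simp only [Nat.cast_zero, add_zero] at key
    refine key.trans ?_
    rw [highSum, ← ENNReal.tsum_mul_left, ← ENNReal.tsum_mul_left, ← ENNReal.tsum_mul_left]
    refine ENNReal.tsum_le_tsum fun j => ?_
    have h1 := hest (N + 1 + j - 3) (hB (N + 1 + j))
    simp only [lowPass_conv_bandPass_conv_eq_zero hχ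
      (show N + 1 + (j : ℤ) - 3 + 3 ≤ N + 1 + j by linarith) hfT, sub_zero,
      lintegral_enorm_lowPass_shift_sub_three] at h1
    refine h1.trans (le_of_eq ?_)
    ring
  · have e : commForm k v (fun y => f y - (lowPass hχ (N + j) ∗ f) y) =
        commForm k v (fun y => f y - (lowPass hχ (N + (j + 1 : ℕ)) ∗ f) y) +
          commForm k v (bandPass hχ (N + 1 + j) ∗ f) := by
      funext x
      have h1 := commForm_sub_right k hfT (hT hfT) (hS (N + j)) (hT (hS (N + j))) x
      have h2 := commForm_sub_right k hfT (hT hfT) (hS (N + (j + 1 : ℕ)))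
        (hT (hS (N + (j + 1 : ℕ)))) x
      have h3 := commForm_sub_right k (hS (N + (j + 1 : ℕ))) (hT (hS (N + (j + 1 : ℕ))))
        (hS (N + j)) (hT (hS (N + j))) x
      have h4 : bandPass hχ (N + 1 + j) ∗ f = fun y =>
          (lowPass hχ (N + (j + 1 : ℕ)) ∗ f) y - (lowPass hχ (N + j) ∗ f) y :=
        funext fun y => bandPass_conv_succ hχ N j hfT y
      rw [Pi.add_apply, h4, h1, h2, h3]
      ring
    have hvm' := hvc.aestronglyMeasurable (μ := (volume : Measure 𝔼))
    simp only [e]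
    exact eLpNorm_add_le (aestronglyMeasurable_commForm k
      (hf.1.sub (hS _).aestronglyMeasurable) hvm')
      (aestronglyMeasurable_commForm k (hB _).aestronglyMeasurable hvm') hr
  · exact ENNReal.mul_ne_top (ENNReal.mul_ne_top ENNReal.ofReal_ne_top
      (lintegral_enorm_lowPassKernel_mul_ne_top hχ))
      (ENNReal.mul_ne_top hDt (ENNReal.mul_ne_top hgp hf.2.ne))
  · refine (hest (N + j) hfT).trans (le_of_eq ?_)
    rw [lintegral_enorm_lowPass_shift]
    ring

theorem lintegral_enorm_fderiv_lowPass (n : ℤ) :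
    ∫⁻ y, ‖fderiv ℝ (lowPass hχ n) y‖ₑ =
      ENNReal.ofReal (2 ^ n) * ∫⁻ y, ‖fderiv ℝ (lowPassKernel hχ) y‖ₑ := by
  have h := (lowPassKernel hχ).lintegral_enorm_fderiv_dilate (δ := 2 ^ (-n)) (by positivity) 0
  simpa [lowPass] using h

/-- The low frequencies are Lipschitz in the mean: `ψ_n * f = S_{n+2} * ψ_n * f`, and the
translations can be moved to the kernel `S_{n+2}`. -/
theorem eLpNorm_lowPass_conv_translate_sub_le {V : Type*} [NormedAddCommGroup V] [NormedSpace ℝ V]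
    [CompleteSpace V] {f : 𝔼 → V} {p : ℝ≥0∞} (hp : 1 ≤ p) (hf : MemLp f p) (N : ℤ) (z : 𝔼) :
    eLpNorm (fun x => (lowPass hχ N ∗ f) (x - z) - (lowPass hχ N ∗ f) x) p volume ≤
      ‖z‖ₑ * (ENNReal.ofReal (2 ^ N) * (4 * ∫⁻ y, ‖fderiv ℝ (lowPassKernel hχ) y‖ₑ) *
        lowSum (fun n => eLpNorm (bandPass hχ n ∗ f) p volume) N) := by
  have hfT := hf.isTempered hp
  have hS (n : ℤ) := (hfT.conv (lowPass hχ n)).aestronglyMeasurable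
  have hB (n : ℤ) := hfT.conv (bandPass hχ n)
  set g1 := ∫⁻ y, ‖fderiv ℝ (lowPassKernel hχ) y‖ₑ with hg1
  have hgt : g1 ≠ ⊤ := by
    have h1 := ((lowPassKernel hχ).grad.lintegral_enorm_mul_norm_lt_top 0).ne
    simpa using h1
  have key := le_tsum_of_le_add
    (Z := fun j : ℕ => eLpNorm (fun x =>
      (lowPass hχ (N - j) ∗ f) (x - z) - (lowPass hχ (N - j) ∗ f) x) p volume)
    (W := fun j : ℕ => eLpNorm (fun x =>
      (bandPass hχ (N - j) ∗ f) (x - z) - (bandPass hχ (N - j) ∗ f) x) p volume)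
    (B := ‖z‖ₑ * (ENNReal.ofReal (2 ^ N) * g1 * eLpNorm f p volume))
    (fun j => ?_) ?_ fun j => ?_
  · simp only [Nat.cast_zero, sub_zero] at key
    refine key.trans ?_
    rw [lowSum, ← ENNReal.tsum_mul_left, ← ENNReal.tsum_mul_left]
    refine ENNReal.tsum_le_tsum fun j => ?_
    have h1 := eLpNorm_conv_translate_sub_le (lowPass hχ (N - j + 2)) (hB (N - j)) hp z
    have e : (4 : ℝ≥0∞) = ENNReal.ofReal (2 ^ (2 : ℤ)) := by norm_num
    rw [lowPass_conv_bandPass_conv hχ le_rfl hfT, lintegral_enorm_fderiv_lowPass,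
      sub_eq_add_neg N, ofReal_two_zpow_add, ofReal_two_zpow_add, ofReal_two_zpow_neg_natCast,
      ← e, ← hg1, ← sub_eq_add_neg N] at h1
    refine h1.trans (le_of_eq ?_)
    ring
  · refine le_trans (le_of_eq ?_) (eLpNorm_add_le
      (((hS (N - (j + 1 : ℕ))).comp_sub_right z).sub (hS _))
      (((hB (N - j)).aestronglyMeasurable.comp_sub_right z).sub (hB (N - j)).aestronglyMeasurable)
      hp)
    congr 1 with x
    have e : N - (j : ℤ) - 1 = N - (j + 1 : ℕ) := by push_cast; ring
    simp only [Pi.add_apply, bandPass_conv hχ _ hfT, e]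
    abel
  · exact ENNReal.mul_ne_top enorm_ne_top (ENNReal.mul_ne_top (ENNReal.mul_ne_top
      ENNReal.ofReal_ne_top hgt) hf.2.ne)
  · refine (eLpNorm_conv_translate_sub_le (lowPass hχ (N - j)) hfT hp z).trans (le_of_eq ?_)
    rw [lintegral_enorm_fderiv_lowPass, sub_eq_add_neg N, ofReal_two_zpow_add,
      ofReal_two_zpow_neg_natCast]
    ring

end LittlewoodPaley

section SingleScale

variable {d : ℕ}

local notation "𝔼" => EuclideanSpace ℝ (Fin d)
local notation "𝔾" => EuclideanSpace ℝ (Fin d × Fin d)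
local notation:67 k:68 " ∗ " f:67 =>
  ((k : EuclideanSpace ℝ (Fin d) → ℝ) ⋆[ContinuousLinearMap.lsmul ℝ ℝ, volume] f)

/-! ### The commutator at a single scale -/

set_option maxSynthPendingDepth 3 in
theorem mollifierNorm_eq (φ : SchwartzMap 𝔼 ℝ) : mollifierNorm φ =
    (∫⁻ y, ‖fderiv ℝ φ y‖ₑ) + (∫⁻ y, ‖fderiv ℝ φ y‖ₑ * ‖y‖ₑ ^ 2) +
      ∫⁻ y, ‖fderiv ℝ (fderiv ℝ φ) y‖ₑ * ‖y‖ₑ := by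
  have hk : Measurable fun y => ‖fderiv ℝ φ y‖ₑ := φ.grad.continuous.enorm.measurable
  rw [mollifierNorm, eLpNorm_one_eq_lintegral_enorm, eLpNorm_one_eq_lintegral_enorm,
    ← lintegral_add_left hk]
  congr 1
  · refine lintegral_congr fun x => ?_
    rw [enorm_smul, Real.enorm_of_nonneg (by positivity), ENNReal.ofReal_add zero_le_one
      (by positivity), ENNReal.ofReal_pow (norm_nonneg _), ofReal_norm, ENNReal.ofReal_one]
    ring
  · refine lintegral_congr fun x => ?_
    have h : ‖iteratedFDeriv ℝ 2 φ x‖ = ‖fderiv ℝ (fderiv ℝ φ) x‖ := by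
      rw [← norm_iteratedFDeriv_fderiv (n := 1), norm_iteratedFDeriv_one]
    rw [enorm_smul, enorm_norm, ← ofReal_norm (iteratedFDeriv ℝ 2 φ x), h, ofReal_norm, mul_comm]

/-- Convolutions of an almost everywhere trace-free matrix field are trace-free everywhere. -/
theorem sum_conv_diag_eq_zero (k : SchwartzMap 𝔼 ℝ) {G : 𝔼 → 𝔾} (hG : IsTempered G)
    (h0 : ∀ᵐ x, ∑ i, G x (i, i) = 0) (x : 𝔼) : ∑ i, (k ∗ G) x (i, i) = 0 := by
  let L : 𝔾 →L[ℝ] ℝ := ∑ i, EuclideanSpace.proj (i, i)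
  have hL (A : 𝔾) : L A = ∑ i, A (i, i) := by simp [L]
  have h1 : L ((k ∗ G) x) = ∫ y, L (k y • G (x - y)) :=
    (L.integral_comp_comm (hG.integrable_conv (ContinuousLinearMap.lsmul ℝ ℝ) k x)).symm
  have h2 : ∀ᵐ y, ∑ i, G (x - y) (i, i) = 0 :=
    (Measure.measurePreserving_sub_left volume x).quasiMeasurePreserving.ae h0
  rw [← hL, h1]
  refine integral_eq_zero_of_ae ?_
  filter_upwards [h2] with y hy
  rw [map_smul, hL, hy, smul_zero, Pi.zero_apply]

variable {χ : EuclideanSpace ℝ (Fin d) → ℝ} (hχ : IsLittlewoodPaleyCutoff χ)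

/-- The constant of the single-scale estimate, built from the moments of the low-pass kernel. -/
noncomputable def scaleConstant : ℝ≥0∞ :=
  8 * (∫⁻ z, ‖lowPassKernel hχ z‖ₑ * ‖z‖ₑ) +
    4 * ((∫⁻ z, ‖lowPassKernel hχ z‖ₑ * ‖z‖ₑ) * ∫⁻ z, ‖lowPassKernel hχ z‖ₑ) +
    8 * ((∫⁻ z, ‖fderiv ℝ (lowPassKernel hχ) z‖ₑ) * ∫⁻ z, ‖lowPassKernel hχ z‖ₑ)

theorem scaleConstant_ne_top : scaleConstant hχ ≠ ⊤ := by
  have h0 : ∫⁻ z, ‖lowPassKernel hχ z‖ₑ ≠ ⊤ := by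
    simpa using ((lowPassKernel hχ).lintegral_enorm_mul_norm_lt_top 0).ne
  have h1 := lintegral_enorm_lowPassKernel_mul_ne_top hχ
  have h2 : ∫⁻ z, ‖fderiv ℝ (lowPassKernel hχ) z‖ₑ ≠ ⊤ := by
    simpa using ((lowPassKernel hχ).grad.lintegral_enorm_mul_norm_lt_top 0).ne
  exact ENNReal.add_ne_top.2 ⟨ENNReal.add_ne_top.2 ⟨ENNReal.mul_ne_top (by simp) h1,
    ENNReal.mul_ne_top (by simp) (ENNReal.mul_ne_top h1 h0)⟩,
    ENNReal.mul_ne_top (by simp) (ENNReal.mul_ne_top h2 h0)⟩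

theorem ofReal_two_zpow_mul_neg (N : ℤ) :
    ENNReal.ofReal ((2 : ℝ) ^ N) * ENNReal.ofReal (2 ^ (-N)) = 1 := by
  rw [← ofReal_two_zpow_add, add_neg_cancel, zpow_zero, ENNReal.ofReal_one]

/-- The commutator at a scale `δ ∼ 2^{-N}`: vector field and density are split into low and high
frequencies at `2^N`. -/
theorem eLpNorm_commForm_dilate_le (φ : SchwartzMap 𝔼 ℝ) {M : ℝ≥0∞} (hM : mollifierNorm φ ≤ M)
    {p p' r : ℝ≥0∞} (hp : 1 ≤ p) (hp' : 1 ≤ p') (hr : 1 ≤ r) (hpr : p⁻¹ + p'⁻¹ = r⁻¹)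
    {ρ : 𝔼 → ℝ} (hρ : MemLp ρ p') {u : 𝔼 → 𝔼} {G : 𝔼 → 𝔾} (h : HasSegmentGradient u G)
    (hu : IsTempered u) (hG : MemLp G p) (h0 : ∀ᵐ x, ∑ i, G x (i, i) = 0)
    (hρu : IsTempered fun x => ρ x • u x) {δ : ℝ} (hδ : 0 < δ) {N : ℤ}
    (hN : (2 : ℝ) ^ (-N) ≤ δ) (hN' : δ ≤ 2 * 2 ^ (-N)) :
    eLpNorm (commForm (φ.dilate hδ) u ρ) r volume ≤ M * scaleConstant hχ *
      ((highSum (fun n => eLpNorm (bandPass hχ n ∗ G) p volume) N +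
          lowSum (fun n => eLpNorm (bandPass hχ n ∗ G) p volume) N) * eLpNorm ρ p' volume +
        eLpNorm G p volume * (highSum (fun n => eLpNorm (bandPass hχ n ∗ ρ) p' volume) N +
          lowSum (fun n => eLpNorm (bandPass hχ n ∗ ρ) p' volume) N)) := by
  set k := φ.dilate hδ with hk
  have hρT := hρ.isTempered hp'
  have hGT := hG.isTempered hp
  set v := lowPass hχ N ∗ u with hv_def
  set g := lowPass hχ N ∗ G with hg_def
  set σ := lowPass hχ N ∗ ρ with hσ_def
  have hv : ∀ z x, v x - v (x - z) = matAct d (segmentMean g z x) z :=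
    fun z x => h.conv_sub_conv hu hGT (lowPass hχ N) z x
  have hvc : Continuous v := hu.continuous_conv _
  have hgc : Continuous g := hGT.continuous_conv _
  have hσc : Continuous σ := hρT.continuous_conv _
  have hσT : IsTempered σ := hρT.conv _
  obtain ⟨Cv, mv, -, hvm⟩ := hu.exists_norm_conv_le (lowPass hχ N)
  have hT {f : 𝔼 → ℝ} (hf : IsTempered f) := hf.smul_of_growth hvc.aestronglyMeasurable hvm
  have hvm' := hvc.aestronglyMeasurable (μ := (volume : Measure 𝔼))
  have hσm := hσc.aestronglyMeasurable (μ := (volume : Measure 𝔼))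
  set A := fun n => eLpNorm (bandPass hχ n ∗ G) p volume with hA
  set B := fun n => eLpNorm (bandPass hχ n ∗ ρ) p' volume with hB
  set m0 := ∫⁻ z, ‖lowPassKernel hχ z‖ₑ with hm0
  set m1 := ∫⁻ z, ‖lowPassKernel hχ z‖ₑ * ‖z‖ₑ with hm1
  set g1 := ∫⁻ z, ‖fderiv ℝ (lowPassKernel hχ) z‖ₑ with hg1
  set X := (highSum A N + lowSum A N) * eLpNorm ρ p' volume +
    eLpNorm G p volume * (highSum B N + lowSum B N) with hX
  have hm0t : m0 ≠ ⊤ := by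
    simpa using ((lowPassKernel hχ).lintegral_enorm_mul_norm_lt_top 0).ne
  have hgp : eLpNorm g p volume ≤ m0 * eLpNorm G p volume := by
    have := eLpNorm_conv_le (lowPass hχ N).continuous.aestronglyMeasurable hG.1 hp
    rwa [lintegral_enorm_lowPass] at this
  have hσp : eLpNorm σ p' volume ≤ m0 * eLpNorm ρ p' volume := by
    have := eLpNorm_conv_le (lowPass hχ N).continuous.aestronglyMeasurable hρ.1 hp'
    rwa [lintegral_enorm_lowPass] at this
  -- the moments of the mollifier scale like `δ⁻¹ ≤ 2^N` and, with the factor `‖y‖²`, like `δ`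
  have hδ1 : ENNReal.ofReal δ⁻¹ ≤ ENNReal.ofReal (2 ^ N) := by
    refine ENNReal.ofReal_le_ofReal ?_
    rw [inv_le_comm₀ hδ (by positivity), ← zpow_neg]
    exact hN
  have hδ2 : ENNReal.ofReal δ ≤ 2 * ENNReal.ofReal (2 ^ (-N)) := by
    rw [← ENNReal.ofReal_ofNat 2, ← ENNReal.ofReal_mul zero_le_two]
    exact ENNReal.ofReal_le_ofReal hN'
  have hmol := (mollifierNorm_eq φ).symm.trans_le hM
  have ha0 := φ.lintegral_enorm_fderiv_dilate hδ 0
  have ha2 := φ.lintegral_enorm_fderiv_dilate hδ 2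
  have hb1 := φ.lintegral_enorm_fderiv_fderiv_dilate hδ
  rw [← hk] at ha0 ha2 hb1
  simp only [pow_zero, mul_one, one_mul] at ha0
  rw [show δ ^ 2 * δ⁻¹ = δ by field_simp] at ha2
  have k0 : (∫⁻ y, ‖fderiv ℝ k y‖ₑ) + ∫⁻ y, ‖fderiv ℝ (fderiv ℝ k) y‖ₑ * ‖y‖ₑ ≤
      ENNReal.ofReal (2 ^ N) * M := by
    rw [ha0, hb1, ← mul_add]
    refine mul_le_mul' hδ1 (le_trans ?_ hmol)
    gcongr
    exact le_self_add
  have k0' : ∫⁻ y, ‖fderiv ℝ k y‖ₑ ≤ ENNReal.ofReal (2 ^ N) * M := le_self_add.trans k0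
  have k2 : ∫⁻ y, ‖fderiv ℝ k y‖ₑ * ‖y‖ₑ ^ 2 ≤ 2 * ENNReal.ofReal (2 ^ (-N)) * M := by
    rw [ha2]
    refine mul_le_mul' hδ2 (le_trans ?_ hmol)
    exact le_add_self.trans le_self_add
  have hE := ofReal_two_zpow_mul_neg N
  set E := ENNReal.ofReal ((2 : ℝ) ^ N) with hE_def
  set E' := ENNReal.ofReal ((2 : ℝ) ^ (-N)) with hE'_def
  -- the gain `2^{-N}` of the high frequencies of `u` compensates the factor `2^N`
  have t3 : eLpNorm (commForm k (fun x => u x - v x) ρ) r volume ≤ M * (8 * m1) * X := by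
    have hw : eLpNorm (fun x => u x - v x) p volume ≤ E' * (4 * m1) * highSum A N :=
      h.eLpNorm_sub_lowPass_conv_le hχ hu hp hG N
    refine (eLpNorm_commForm_le_of_memLp k hρ.1 (hu.aestronglyMeasurable.sub hvm') hr
      hpr).trans ?_
    calc _ ≤ E * M * (2 * (E' * (4 * m1) * highSum A N * eLpNorm ρ p' volume)) := by
          gcongr
          exact hw
      _ = (E * E') * (M * (8 * m1) * (highSum A N * eLpNorm ρ p' volume)) := by ring
      _ ≤ _ := by
          rw [hE, one_mul]
          gcongr
          refine le_trans ?_ le_self_add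
          gcongr
          exact le_self_add
  -- the same for the high frequencies of `ρ`
  have t2 : eLpNorm (commForm k v fun x => ρ x - σ x) r volume ≤ M * (4 * (m1 * m0)) * X := by
    refine (eLpNorm_commForm_sub_lowPass_conv_le hχ k hgc hv hvc hvm hp hp' hr hpr
      (hgp.trans_lt (ENNReal.mul_lt_top hm0t.lt_top hG.2)).ne hρ N).trans ?_
    calc _ ≤ E' * (4 * m1) * (E * M * (m0 * eLpNorm G p volume * highSum B N)) := by gcongr
      _ = (E * E') * (M * (4 * (m1 * m0)) * (eLpNorm G p volume * highSum B N)) := by ring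
      _ ≤ _ := by
          rw [hE, one_mul]
          gcongr
          refine le_trans ?_ le_add_self
          gcongr
          exact le_self_add
  -- the Lipschitz bounds for low frequencies cost `2^N`, which is compensated by the factor `δ`
  have t1 : eLpNorm (commForm k v σ) r volume ≤ M * (8 * (g1 * m0)) * X := by
    refine (eLpNorm_commForm_le_of_trace k hgc hv
      (sum_conv_diag_eq_zero (lowPass hχ N) hGT h0) hσT hσc (hT hσT) hp hr hpr
      (eLpNorm_lowPass_conv_translate_sub_le hχ hp hG N)
      (eLpNorm_lowPass_conv_translate_sub_le hχ hp' hρ N)).trans ?_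
    calc _ ≤ 2 * E' * M * (m0 * eLpNorm G p volume * (E * (4 * g1) * lowSum B N) +
          E * (4 * g1) * lowSum A N * (m0 * eLpNorm ρ p' volume)) := by gcongr
      _ = (E * E') * (M * (8 * (g1 * m0)) * (lowSum A N * eLpNorm ρ p' volume +
          eLpNorm G p volume * lowSum B N)) := by ring
      _ ≤ _ := by
          rw [hE, one_mul, hX]
          gcongr
          · exact le_add_self
          · exact le_add_self
  have e : commForm k u ρ = commForm k (fun x => u x - v x) ρ +
      (commForm k v (fun x => ρ x - σ x) + commForm k v σ) := by
    funext x
    rw [Pi.add_apply, Pi.add_apply, commForm_sub_left k hρT hρu (hT hρT),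
      commForm_sub_right k hρT (hT hρT) hσT (hT hσT)]
    ring
  rw [e]
  have hm2 := aestronglyMeasurable_commForm k (hρ.1.sub hσm) hvm'
  have hm1' := aestronglyMeasurable_commForm k hσm hvm'
  refine (eLpNorm_add_le (aestronglyMeasurable_commForm k hρ.1 (hu.aestronglyMeasurable.sub hvm'))
    (hm2.add hm1') hr).trans ((add_le_add t3 ((eLpNorm_add_le hm2 hm1' hr).trans
      (add_le_add t2 t1))).trans (le_of_eq ?_))
  rw [scaleConstant]
  ring

end SingleScale

section Summation

/-! ### Summation over the scales -/

theorem eLpNorm_count_comp_add_right (a : ℤ → ℝ≥0∞) (q : ℝ≥0∞) (k : ℤ) :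
    eLpNorm (fun n => a (n + k)) q Measure.count = eLpNorm a q Measure.count :=
  eLpNorm_comp_measurePreserving (g := a) (measurable_of_countable a).aestronglyMeasurable
    (measurePreserving_add_right Measure.count k)

/-- Minkowski's inequality in `ℓ^q`, for translates with geometric weights. -/
theorem eLpNorm_tsum_geometric_le {a : ℤ → ℝ≥0∞} {q : ℝ≥0∞} (hq : 1 ≤ q) (s : ℕ → ℤ) :
    eLpNorm (fun n => ∑' i : ℕ, 2⁻¹ ^ i * a (n + s i)) q Measure.count ≤
      2 * eLpNorm a q Measure.count := by
  have h := eLpNorm_lintegral_le (μ := (Measure.count : Measure ℤ))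
    (ν := (Measure.count : Measure ℕ)) (f := fun n i => 2⁻¹ ^ i * a (n + s i))
    (c := fun i => 2⁻¹ ^ i * eLpNorm a q Measure.count)
    (measurable_of_countable _).aemeasurable (measurable_of_countable _).aemeasurable hq
    (Filter.Eventually.of_forall fun i => ?_)
  · simpa only [lintegral_count, ENNReal.tsum_mul_right, ENNReal.tsum_geometric_two] using h
  · rw [← eLpNorm_count_comp_add_right a q (s i)]
    exact eLpNorm_le_mul_eLpNorm_of_ae_le_mul'' q
      (measurable_of_countable _).aestronglyMeasurable
      (Filter.Eventually.of_forall fun x => by simp)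

theorem eLpNorm_highSum_le {a : ℤ → ℝ≥0∞} {q : ℝ≥0∞} (hq : 1 ≤ q) :
    eLpNorm (highSum a) q Measure.count ≤ 2 * eLpNorm a q Measure.count := by
  have h := eLpNorm_tsum_geometric_le (a := a) hq fun i => 1 + i
  simp only [← add_assoc] at h
  exact h

theorem eLpNorm_lowSum_le {a : ℤ → ℝ≥0∞} {q : ℝ≥0∞} (hq : 1 ≤ q) :
    eLpNorm (lowSum a) q Measure.count ≤ 2 * eLpNorm a q Measure.count := by
  have h := eLpNorm_tsum_geometric_le (a := a) hq fun i => -i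
  simp only [← sub_eq_add_neg] at h
  exact h

theorem eLpNorm_highSum_add_lowSum_le {a : ℤ → ℝ≥0∞} {q : ℝ≥0∞} (hq : 1 ≤ q) :
    eLpNorm (fun n => highSum a n + lowSum a n) q Measure.count ≤
      4 * eLpNorm a q Measure.count := by
  refine (eLpNorm_add_le (f := highSum a) (g := lowSum a)
    (measurable_of_countable _).aestronglyMeasurable
    (measurable_of_countable _).aestronglyMeasurable hq).trans
    ((add_le_add (eLpNorm_highSum_le hq) (eLpNorm_lowSum_le hq)).trans (le_of_eq ?_))
  ring

theorem eLpNorm_count_const_mul_le (c : ℝ≥0∞) (a : ℤ → ℝ≥0∞) (q : ℝ≥0∞) :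
    eLpNorm (fun n => c * a n) q Measure.count ≤ c * eLpNorm a q Measure.count :=
  eLpNorm_le_mul_eLpNorm_of_ae_le_mul'' q (measurable_of_countable _).aestronglyMeasurable
    (Filter.Eventually.of_forall fun x => by simp)

/-- The integer `N` with `2^{-N} ≤ δ < 2^{-N + 1}`. -/
noncomputable def dyadicIndex (δ : ℝ) : ℤ := -⌊Real.logb 2 δ⌋

theorem measurable_dyadicIndex : Measurable dyadicIndex :=
  ((Real.measurable_log.div_const _).floor).neg

theorem two_zpow_neg_dyadicIndex_le {δ : ℝ} (hδ : 0 < δ) : (2 : ℝ) ^ (-dyadicIndex δ) ≤ δ := by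
  have h : ⌊Real.logb (2 : ℕ) δ⌋ = Int.log 2 δ := Real.floor_logb_natCast hδ.le
  rw [dyadicIndex, neg_neg]
  simpa [← h] using Int.zpow_log_le_self (b := 2) one_lt_two hδ

theorem lt_two_mul_two_zpow_neg_dyadicIndex {δ : ℝ} (hδ : 0 < δ) :
    δ < 2 * (2 : ℝ) ^ (-dyadicIndex δ) := by
  have h : ⌊Real.logb (2 : ℕ) δ⌋ = Int.log 2 δ := Real.floor_logb_natCast hδ.le
  have h1 := Int.lt_zpow_succ_log_self (b := 2) one_lt_two δ
  rw [← h, zpow_add_one₀ (by norm_num), mul_comm] at h1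
  rw [dyadicIndex, neg_neg]
  simpa using h1

/-- Every dyadic interval has mass at most one for the measure `dδ / δ`. -/
theorem map_dyadicIndex_scaleMeasure_le : scaleMeasure.map dyadicIndex ≤ Measure.count := by
  have h (n : ℤ) : scaleMeasure.map dyadicIndex {n} ≤ 1 := by
    have hm := measurable_dyadicIndex (measurableSet_singleton n)
    have hs : dyadicIndex ⁻¹' {n} ∩ Ioi 0 ⊆ Ico (2 ^ (-n)) (2 * 2 ^ (-n) : ℝ) := by
      rintro δ ⟨h1, h2⟩
      have h3 : dyadicIndex δ = n := h1
      exact h3 ▸ ⟨two_zpow_neg_dyadicIndex_le h2, lt_two_mul_two_zpow_neg_dyadicIndex h2⟩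
    rw [Measure.map_apply measurable_dyadicIndex (measurableSet_singleton n), scaleMeasure,
      withDensity_apply _ hm, Measure.restrict_restrict hm]
    calc _ ≤ ∫⁻ δ in Ico (2 ^ (-n)) (2 * 2 ^ (-n) : ℝ), ENNReal.ofReal δ⁻¹ :=
          lintegral_mono_set hs
      _ ≤ ∫⁻ _ in Ico (2 ^ (-n)) (2 * 2 ^ (-n) : ℝ), ENNReal.ofReal (2 ^ n) := by
          refine setLIntegral_mono measurable_const fun δ hδ => ENNReal.ofReal_le_ofReal ?_
          rw [inv_le_comm₀ (lt_of_lt_of_le (by positivity) hδ.1) (by positivity), ← zpow_neg]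
          exact hδ.1
      _ = 1 := by
          rw [setLIntegral_const, Real.volume_Ico, two_mul, add_sub_cancel_right,
            ofReal_two_zpow_mul_neg]
  refine Measure.le_iff.2 fun s hs => ?_
  rw [← Measure.tsum_indicator_apply_singleton _ s hs,
    ← Measure.tsum_indicator_apply_singleton Measure.count s hs]
  refine ENNReal.tsum_le_tsum fun n => ?_
  refine indicator_le_indicator ((h n).trans (by simp))

theorem eLpNorm_scaleMeasure_le {F : ℝ → ℝ≥0∞} {a : ℤ → ℝ≥0∞} (q : ℝ≥0∞)
    (h : ∀ δ, 0 < δ → F δ ≤ a (dyadicIndex δ)) :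
    eLpNorm F q scaleMeasure ≤ eLpNorm a q Measure.count := by
  have hpos : ∀ᵐ δ ∂scaleMeasure, 0 < δ :=
    (withDensity_absolutelyContinuous _ _) (ae_restrict_mem measurableSet_Ioi)
  calc eLpNorm F q scaleMeasure ≤ eLpNorm (a ∘ dyadicIndex) q scaleMeasure :=
        eLpNorm_mono_enorm_ae (hpos.mono fun δ hδ => by simpa using h δ hδ)
    _ = eLpNorm a q (scaleMeasure.map dyadicIndex) :=
        (eLpNorm_map_measure (measurable_of_countable a).aestronglyMeasurable
          measurable_dyadicIndex.aemeasurable).symm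
    _ ≤ eLpNorm a q Measure.count := eLpNorm_mono_measure _ map_dyadicIndex_scaleMeasure_le

end Summation

theorem theorem4p4 (d : ℕ) (hd : 1 ≤ d) (χ : EuclideanSpace ℝ (Fin d) → ℝ)
    (hχ : IsLittlewoodPaleyCutoff χ) (M : ℝ≥0) :
    ∃ C : ℝ≥0, 0 < C ∧
      ∀ φ : SchwartzMap (EuclideanSpace ℝ (Fin d)) ℝ,
        ∫ x, φ x = 1 → mollifierNorm φ ≤ M →
      ∀ p p' q r : ℝ≥0∞, 1 ≤ p → 1 ≤ p' → 1 ≤ q → 1 ≤ r → p⁻¹ + p'⁻¹ = r⁻¹ →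
      ∀ ρ : EuclideanSpace ℝ (Fin d) → ℝ,
        MemLp ρ p' volume → besovZeroNorm χ p' q ρ < ⊤ →
      ∀ (u : EuclideanSpace ℝ (Fin d) → EuclideanSpace ℝ (Fin d))
        (G : EuclideanSpace ℝ (Fin d) → EuclideanSpace ℝ (Fin d × Fin d)),
        IsWeaklyDivergenceFree u → IsWeakGradient u G →
        MemLp G p volume → besovZeroNorm χ p q G < ⊤ →
        eLpNorm (fun δ : ℝ => eLpNorm (diPernaLionsCommutator φ u ρ δ) r volume) q scaleMeasure ≤
          C * (besovZeroNorm χ p q G * eLpNorm ρ p' volume +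
            eLpNorm G p volume * besovZeroNorm χ p' q ρ) := by
  have hK : (4 * (M * scaleConstant hχ) : ℝ≥0∞) ≠ ⊤ := ENNReal.mul_ne_top (by simp)
    (ENNReal.mul_ne_top ENNReal.coe_ne_top (scaleConstant_ne_top hχ))
  refine ⟨(4 * (M * scaleConstant hχ)).toNNReal + 1, by positivity, ?_⟩
  intro φ hφ hM p p' q r hp hp' hq hr hpr ρ hρ _ u G hdiv hgrad hG _
  have h := hgrad.hasSegmentGradient
  have hu := h.isTempered hgrad.1 (hG.isTempered hp)
  have hρu := h.isTempered_smul hu hp hp' hr hpr hG hρ φ hφ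
  simp only [besovZeroNorm, ← coe_bandPass hχ]
  set A := fun n => eLpNorm ((bandPass hχ n : EuclideanSpace ℝ (Fin d) → ℝ)
    ⋆[ContinuousLinearMap.lsmul ℝ ℝ, volume] G) p volume with hA
  set B := fun n => eLpNorm ((bandPass hχ n : EuclideanSpace ℝ (Fin d) → ℝ)
    ⋆[ContinuousLinearMap.lsmul ℝ ℝ, volume] ρ) p' volume with hB
  have h1 := eLpNorm_scaleMeasure_le
    (F := fun δ => eLpNorm (diPernaLionsCommutator φ u ρ δ) r volume)
    (a := fun N => M * scaleConstant hχ * (eLpNorm ρ p' volume * (highSum A N + lowSum A N) +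
      eLpNorm G p volume * (highSum B N + lowSum B N))) q fun δ hδ => by
    rw [funext (diPernaLionsCommutator_eq φ (hρ.isTempered hp') hρu hδ),
      mul_comm (eLpNorm ρ p' volume)]
    exact eLpNorm_commForm_dilate_le hχ φ hM hp hp' hr hpr hρ h hu hG
      (hgrad.ae_trace_eq_zero hdiv) hρu hδ (two_zpow_neg_dyadicIndex_le hδ)
      (lt_two_mul_two_zpow_neg_dyadicIndex hδ).le
  refine h1.trans ((eLpNorm_count_const_mul_le _ _ q).trans ?_)
  have h2 := (eLpNorm_add_le (μ := (Measure.count : Measure ℤ))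
    (f := fun N => eLpNorm ρ p' volume * (highSum A N + lowSum A N))
    (g := fun N => eLpNorm G p volume * (highSum B N + lowSum B N))
    (measurable_of_countable _).aestronglyMeasurable
    (measurable_of_countable _).aestronglyMeasurable hq).trans
    (add_le_add (eLpNorm_count_const_mul_le _ _ q) (eLpNorm_count_const_mul_le _ _ q))
  calc _ ≤ M * scaleConstant hχ * (eLpNorm ρ p' volume * (4 * eLpNorm A q Measure.count) +
        eLpNorm G p volume * (4 * eLpNorm B q Measure.count)) := by
        refine mul_le_mul_right (h2.trans ?_) _
        exact add_le_add (mul_le_mul_right (eLpNorm_highSum_add_lowSum_le hq) _)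
          (mul_le_mul_right (eLpNorm_highSum_add_lowSum_le hq) _)
    _ = 4 * (M * scaleConstant hχ) * (eLpNorm A q Measure.count * eLpNorm ρ p' volume +
        eLpNorm G p volume * eLpNorm B q Measure.count) := by ring
    _ ≤ _ := by
        rw [ENNReal.coe_add, ENNReal.coe_toNNReal hK]
        exact mul_le_mul_left le_self_add _
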